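/- Let $(L,(\cdot,\cdot))$ be an even unimodular lattice of signature $(b,2)$, with $q(v)=(v,v)/2$, and let $k=1+b/2$. Fix an orthogonal basis $e_1,\dots,e_{b+2}$ of $L\otimes\mathbb{R}$ with $(e_j,e_j)=1$ for $j\le b$ and $(e_j,e_j)=-1$ for $j>b$, let $g_0\colon L\otimes\mathbb{R}\to\mathbb{R}^{b,2}$ be the map to coordinates in this basis, and let $z_0$ be the span of $e_{b+1},e_{b+2}$. Let $u,u'\in L$ be isotropic with $(u,u')=1$, and let $K$ be the orthogonal complement of $\langle u,u'\rangle$ in $L$, so that $L=K\oplus\langle u,u'\rangle$. For an isometry $g$ of $L\otimes\mathbb{R}$ put $z=g^{-1}(z_0)$. For a nondegenerate subspace $W$ write $v_W$ for the orthogonal projection of $v$ to $W$, and $v^2=(v,v)$. Let $w$ be the orthogonal complement of $u_z$ in $z$ and $w^\perp$ the orthogonal complement of $u_{z^\perp}$ in $z^\perp$, denote also by $w$ the linear map $v\mapsto g(v_{w^\perp\oplus w})$, write $|u_{z^\perp}|=(u_{z^\perp}^2)^{1/2}$, and put $$\mu=-u'+\frac{u_{z^\perp}}{2u_{z^\perp}^2}+\frac{u_z}{2u_z^2}.$$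 For $\alpha,\beta\in\{1,\dots,b\}$ let $P_{(\alpha,\beta)}(x)=2x_\alpha x_\beta$ on $\mathbb{R}^{b,2}$, and let $P_{(\alpha,\beta),w,h^+,h^-}$ be the polynomials, on the subspace $g_0(g(w^\perp\oplus w))$ of $\mathbb{R}^{b,2}$ (extended to $\mathbb{R}^{b,2}$ through the orthogonal projection), with $$P_{(\alpha,\beta)}\big(g_0(g(v))\big)=\sum_{h^+,h^-}(v,u_{z^\perp})^{h^+}(v,u_z)^{h^-}P_{(\alpha,\beta),w,h^+,h^-}\big(g_0(w(v))\big)\qquad(v\in L\otimes\mathbb{R}).$$ With $e(t)=\exp(2\pi i t)$, $\tau=x+iy\in\mathbb{H}$, $\Delta=\sum_j\partial^2/\partial x_j^2$ and $m,n\in L\otimes\mathbb{R}$, define $$\Theta_L(\tau,g,P)=\sum_{\lambda\in L}\exp(-\Delta/8\pi y)(P)\big(g_0(g(\lambda))\big)\,e\big(\tau q(\lambda_{z^\perp})+\bar\tau q(\lambda_z)\big),$$ $$\Theta_K(\tau,m,n,w,P)=\sum_{\lambda\in K}\exp(-\Delta/8\pi y)(P)\big(g_0(w(\lambda+n))\big)\,e\big(\tau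 q((\lambda+n)_{w^\perp})+\bar\tau q((\lambda+n)_w)-(\lambda+n/2,m)\big),$$ and $\Theta_K(\tau,w,P)=\Theta_K(\tau,0,0,w,P)$. Let $f$ be a cusp form of weight $k$ for $\mathrm{SL}_2(\mathbb{Z})$, and define $$h_{\alpha,\beta}(\tau,g)=\frac{y^{k+1/2}f(\tau)}{\sqrt2\,|u_{z^\perp}|}\sum_{r\ge1}\sum_{h^+=0}^{2}\Big(\frac{r}{2iy}\Big)^{h^+}\exp\Big(-\frac{\pi r^2}{2y\,u_{z^\perp}^2}\Big)\overline{\Theta_K\big(\tau,r\mu,0,w,P_{(\alpha,\beta),w,h^+,0}\big)}.$$ Then the theta series involved and the series over $r$ converge absolutely, the function $h_{\alpha,\beta}(\cdot,g)$ is invariant under $\Gamma_\infty=\{\left(\begin{smallmatrix}1&n\\0&1\end{smallmatrix}\right):n\in\mathbb{Z}\}$, and for all $\tau\in\mathbb{H}$ and all isometries $g$ of $L\otimes\mathbb{R}$ $$y^{k+1}f(\tau)\,\overline{\Theta_L(\tau,g,P_{(\alpha,\beta)})}=\frac{y^{k+1/2}f(\tau)}{\sqrt2\,|u_{z^\perp}|}\,\overline{\Theta_K\big(\tau,w,P_{(\alpha,\beta),w,0,0}\big)}+\sum_{\gamma\in\Gamma_\infty\backslash\mathrm{SL}_2(\mathbb{Z})}h_{\alpha,\beta}(\gamma\tau,g),$$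 where the last series converges absolutely. -/

import Mathlib

open scoped TensorProduct MatrixGroups CongruenceSubgroup

noncomputable section

namespace KMUnfold

/-! ## Even unimodular lattices of signature `(b, 2)` -/

/-- An even unimodular lattice: a symmetric integral bilinear form with even norms `(λ, λ)`, such
that `λ ↦ (λ, ·)` is an isomorphism onto the dual lattice. -/
structure IsEvenUnimodular {L : Type*} [AddCommGroup L] (B : LinearMap.BilinForm ℤ L) : Prop where
  symm : ∀ x y, B x y = B y x
  even : ∀ x, Even (B x x)
  unimodular : Function.Bijective (B : L → (L →ₗ[ℤ] ℤ))

/-- The orthogonal complement `K` in `L` of the sublattice spanned by `u` and `u'`.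
If `u, u'` span a hyperbolic plane `U`, then `L = K ⊕ U`. -/
def complementLattice {L : Type*} [AddCommGroup L] (B : LinearMap.BilinForm ℤ L) (u u' : L) :
    Submodule ℤ L :=
  LinearMap.ker (B u) ⊓ LinearMap.ker (B u')

/-- The image of a lattice vector in `L ⊗ ℝ`. -/
def toReal {L : Type*} [AddCommGroup L] (x : L) : ℝ ⊗[ℤ] L := 1 ⊗ₜ[ℤ] x

section RealSpace

variable {b : ℕ} {V : Type*} [AddCommGroup V] [Module ℝ V]

/-- A basis `e₁, …, e_{b+2}` of the real quadratic space, orthogonal, with `b` vectors of norm `1`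
(indexed by `Fin b`) followed by two vectors of norm `-1` (indexed by `Fin 2`). -/
def IsStandardBasis (Q : LinearMap.BilinForm ℝ V) (e : Module.Basis (Fin b ⊕ Fin 2) ℝ V) : Prop :=
  (∀ i, Q (e (Sum.inl i)) (e (Sum.inl i)) = 1) ∧
  (∀ i, Q (e (Sum.inr i)) (e (Sum.inr i)) = -1) ∧
  ∀ i j, i ≠ j → Q (e i) (e j) = 0

/-- `g` is an isometry of the real quadratic space. -/
def IsIsometry (Q : LinearMap.BilinForm ℝ V) (g : V ≃ₗ[ℝ] V) : Prop :=
  ∀ v v', Q (g v) (g v') = Q v v'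

/-- The quadratic form `q(v) = (v, v) / 2`. -/
def quad (Q : LinearMap.BilinForm ℝ V) (v : V) : ℝ := Q v v / 2

open scoped Classical in
/-- The orthogonal projection `v ↦ v_W` onto a nondegenerate subspace `W`, that is, the projection
onto `W` along the orthogonal complement of `W` (and `0` if `W` is degenerate). -/
def orthProj (Q : LinearMap.BilinForm ℝ V) (W : Submodule ℝ V) : V →ₗ[ℝ] V :=
  if h : IsCompl W (Q.orthogonal W) then W.projection (Q.orthogonal W) h else 0

variable (Q : LinearMap.BilinForm ℝ V) (e : Module.Basis (Fin b ⊕ Fin 2) ℝ V) (g : V ≃ₗ[ℝ] V)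
  (u u' : V)

/-- The base point `z₀` of the Grassmannian: the negative definite plane spanned by the last two
vectors of the standard basis. -/
def basePlane : Submodule ℝ V := Submodule.span ℝ (Set.range fun i : Fin 2 => e (Sum.inr i))

/-- The negative definite plane `z = g⁻¹(z₀)`. -/
def negPlane : Submodule ℝ V := (basePlane e).map (g.symm : V →ₗ[ℝ] V)

/-- The positive definite space `z^⊥`. -/
def posSpace : Submodule ℝ V := Q.orthogonal (negPlane e g)

/-- `u_z` -/
def uNeg : V := orthProj Q (negPlane e g) u

/-- `u_{z^⊥}` -/
def uPos : V := orthProj Q (posSpace Q e g) u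

/-- `w`: the orthogonal complement of `u_z` in `z`. -/
def wNeg : Submodule ℝ V := negPlane e g ⊓ Q.orthogonal (ℝ ∙ uNeg Q e g u)

/-- `w^⊥`: the orthogonal complement of `u_{z^⊥}` in `z^⊥`. -/
def wPos : Submodule ℝ V := posSpace Q e g ⊓ Q.orthogonal (ℝ ∙ uPos Q e g u)

/-- The linear map `v ↦ g(v_{w^⊥ ⊕ w})`, which kills `u_z` and `u_{z^⊥}` and equals `g` on
`w^⊥ ⊕ w`. -/
def wMap : V →ₗ[ℝ] V := (g : V →ₗ[ℝ] V) ∘ₗ orthProj Q (wPos Q e g u ⊔ wNeg Q e g u)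

/-- The isometry `g₀ : L ⊗ ℝ → ℝ^{b,2}` given by the coordinates in the standard basis. -/
def coords : V ≃ₗ[ℝ] (Fin b ⊕ Fin 2 → ℝ) := e.equivFun

/-- `μ = -u' + u_{z^⊥} / (2 u_{z^⊥}²) + u_z / (2 u_z²)`. -/
def mu : V :=
  -u' + (2 * Q (uPos Q e g u) (uPos Q e g u))⁻¹ • uPos Q e g u
    + (2 * Q (uNeg Q e g u) (uNeg Q e g u))⁻¹ • uNeg Q e g u

/-! ## Polynomials on `ℝ^{b,2}` -/

/-- The polynomial `P_{(α,β)}(x) = 2 x_α x_β` on `ℝ^{b,2}`. -/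
def polAB (α β : Fin b) : MvPolynomial (Fin b ⊕ Fin 2) ℝ :=
  2 * MvPolynomial.X (Sum.inl α) * MvPolynomial.X (Sum.inl β)

/-- The Laplacian `Δ = ∑ⱼ ∂²/∂xⱼ²`. -/
def laplacian (P : MvPolynomial (Fin b ⊕ Fin 2) ℝ) : MvPolynomial (Fin b ⊕ Fin 2) ℝ :=
  ∑ j, MvPolynomial.pderiv j (MvPolynomial.pderiv j P)

/-- `exp(-Δ / 8πy)(P) = ∑ₘ (-1 / 8πy)^m / m! · Δ^m P`; terms with `m > deg P` vanish. -/
def expLaplacian (y : ℝ) (P : MvPolynomial (Fin b ⊕ Fin 2) ℝ) :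
    MvPolynomial (Fin b ⊕ Fin 2) ℝ :=
  ∑ m ∈ Finset.range (P.totalDegree + 1),
    ((-1 / (8 * Real.pi * y)) ^ m / (m.factorial : ℝ)) • (laplacian^[m] P)

/-- The linear endomorphism of `ℝ^{b,2}` corresponding under `g₀ ∘ g` to the orthogonal projection
`v ↦ v_{w^⊥ ⊕ w}`. -/
def wProjCoords : (Fin b ⊕ Fin 2 → ℝ) →ₗ[ℝ] (Fin b ⊕ Fin 2 → ℝ) :=
  (coords e : V →ₗ[ℝ] _) ∘ₗ wMap Q e g u ∘ₗ (g.symm : V →ₗ[ℝ] V) ∘ₗ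
    ((coords e).symm : _ →ₗ[ℝ] V)

/-- The substitution that writes `P(g₀(g(v)))`, for
`v = v_{w^⊥ ⊕ w} + S · u_{z^⊥} / u_{z^⊥}² + T · u_z / u_z²`, as a polynomial in `S = (v, u_{z^⊥})`
(the outer variable) and `T = (v, u_z)` (the inner variable), whose coefficients are polynomials
in `v_{w^⊥ ⊕ w}`. -/
def splitPol (P : MvPolynomial (Fin b ⊕ Fin 2) ℝ) :
    Polynomial (Polynomial (MvPolynomial (Fin b ⊕ Fin 2) ℝ)) :=
  MvPolynomial.aeval
    (fun j =>
      Polynomial.C (Polynomial.C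
        (∑ i, MvPolynomial.C (wProjCoords Q e g u (Pi.single i 1) j) * MvPolynomial.X i))
      + Polynomial.C (Polynomial.C (MvPolynomial.C
          (coords e (g (uPos Q e g u)) j / Q (uPos Q e g u) (uPos Q e g u)))) * Polynomial.X
      + Polynomial.C (Polynomial.C (MvPolynomial.C
          (coords e (g (uNeg Q e g u)) j / Q (uNeg Q e g u) (uNeg Q e g u))) * Polynomial.X))
    P

/-- The polynomials `P_{w,h⁺,h⁻}` with
`P(g₀(g(v))) = ∑ (v, u_{z^⊥})^{h⁺} (v, u_z)^{h⁻} P_{w,h⁺,h⁻}(g₀(w(v)))`.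
They are polynomials on the subspace `g₀(g(w^⊥ ⊕ w))` of `ℝ^{b,2}`, considered on all of `ℝ^{b,2}`
by means of the orthogonal projection (so that the Laplacian of the subspace, applied to them, is
that of `ℝ^{b,2}`). -/
def polW (P : MvPolynomial (Fin b ⊕ Fin 2) ℝ) (hp hm : ℕ) : MvPolynomial (Fin b ⊕ Fin 2) ℝ :=
  ((splitPol Q e g u P).coeff hp).coeff hm

/-! ## Siegel theta functions -/

/-- `e(t) = exp(2πit)`. -/
def expi (t : ℂ) : ℂ := Complex.exp (2 * Real.pi * Complex.I * t)

/-- The term of a vector `v` of the lattice in the Siegel theta series, for a positive definite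
subspace `W⁺`, a negative definite subspace `W⁻`, a map `φ` to `ℝ^{b,2}`, a polynomial `P` and
vectors `m, n`:
`exp(-Δ/8πy)(P)(φ(v+n)) · e(τ q((v+n)_{W⁺}) + τ̄ q((v+n)_{W⁻}) - (v+n/2, m))`. -/
def thetaTerm (Wpos Wneg : Submodule ℝ V) (φ : V →ₗ[ℝ] (Fin b ⊕ Fin 2 → ℝ))
    (P : MvPolynomial (Fin b ⊕ Fin 2) ℝ) (τ : UpperHalfPlane) (m n : V) (v : V) : ℂ :=
  ((MvPolynomial.eval (φ (v + n)) (expLaplacian τ.im P) : ℝ) : ℂ) *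
    expi ((τ : ℂ) * (quad Q (orthProj Q Wpos (v + n)) : ℂ)
      + (starRingEnd ℂ) (τ : ℂ) * (quad Q (orthProj Q Wneg (v + n)) : ℂ)
      - (Q (v + (1 / 2 : ℝ) • n) m : ℂ))

end RealSpace

section Lattice

variable {b : ℕ} {L : Type*} [AddCommGroup L] (B : LinearMap.BilinForm ℤ L)
  (e : Module.Basis (Fin b ⊕ Fin 2) ℝ (ℝ ⊗[ℤ] L)) (g : (ℝ ⊗[ℤ] L) ≃ₗ[ℝ] (ℝ ⊗[ℤ] L))
  (u u' : L)

/-- The real bilinear form on `L ⊗ ℝ`. -/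
abbrev realForm : LinearMap.BilinForm ℝ (ℝ ⊗[ℤ] L) := B.baseChange ℝ

/-- The term of `x ∈ L` in `Θ_L(τ, g, P)`. -/
def thetaLTerm (P : MvPolynomial (Fin b ⊕ Fin 2) ℝ) (τ : UpperHalfPlane) (x : L) : ℂ :=
  thetaTerm (realForm B) (posSpace (realForm B) e g) (negPlane e g)
    ((coords e : _ →ₗ[ℝ] (Fin b ⊕ Fin 2 → ℝ)) ∘ₗ (g : (ℝ ⊗[ℤ] L) →ₗ[ℝ] (ℝ ⊗[ℤ] L))) P τ 0 0
    (toReal x)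

/-- The Siegel theta function `Θ_L(τ, g, P)`. -/
def thetaL (P : MvPolynomial (Fin b ⊕ Fin 2) ℝ) (τ : UpperHalfPlane) : ℂ :=
  ∑' x : L, thetaLTerm B e g P τ x

/-- The term of `x ∈ K` in `Θ_K(τ, m, n, w, P)`. -/
def thetaKTerm (P : MvPolynomial (Fin b ⊕ Fin 2) ℝ) (τ : UpperHalfPlane) (m n : ℝ ⊗[ℤ] L)
    (x : complementLattice B u u') : ℂ :=
  thetaTerm (realForm B) (wPos (realForm B) e g (toReal u)) (wNeg (realForm B) e g (toReal u))
    ((coords e : _ →ₗ[ℝ] (Fin b ⊕ Fin 2 → ℝ)) ∘ₗ wMap (realForm B) e g (toReal u)) P τ m n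
    (toReal (x : L))

/-- The Siegel theta function `Θ_K(τ, m, n, w, P)` of the Lorentzian lattice `K`. -/
def thetaK (P : MvPolynomial (Fin b ⊕ Fin 2) ℝ) (τ : UpperHalfPlane) (m n : ℝ ⊗[ℤ] L) : ℂ :=
  ∑' x : complementLattice B u u', thetaKTerm B e g u u' P τ m n x

/-- `u_{z^⊥}²`, a positive real number. -/
def uPosSq : ℝ :=
  realForm B (uPos (realForm B) e g (toReal u)) (uPos (realForm B) e g (toReal u))

/-- The factor `y^{k+1/2} f(τ) / (√2 |u_{z^⊥}|)`. -/
def prefactor (k : ℤ) (f : UpperHalfPlane → ℂ) (τ : UpperHalfPlane) : ℂ :=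
  ((τ.im ^ ((k : ℝ) + 1 / 2) : ℝ) : ℂ) * f τ / ((√2 * √(uPosSq B e g u) : ℝ) : ℂ)

/-- The polynomial `P_{(α,β),w,h⁺,0}`. -/
def polABW (α β : Fin b) (h : ℕ) : MvPolynomial (Fin b ⊕ Fin 2) ℝ :=
  polW (realForm B) e g (toReal u) (polAB α β) h 0

/-- The term of `r` in the series defining `h_{α,β}`:
`∑_{h⁺=0}^{2} (r / 2iy)^{h⁺} exp(-πr² / (2y u_{z^⊥}²)) conj Θ_K(τ, rμ, 0, w, P_{(α,β),w,h⁺,0})`. -/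
def auxTerm (α β : Fin b) (τ : UpperHalfPlane) (r : ℕ) : ℂ :=
  ∑ h ∈ Finset.range 3,
    ((r : ℂ) / (2 * Complex.I * (τ.im : ℂ))) ^ h *
      ((Real.exp (-(Real.pi * (r : ℝ) ^ 2) / (2 * τ.im * uPosSq B e g u)) : ℝ) : ℂ) *
      (starRingEnd ℂ) (thetaK B e g u u' (polABW B e g u α β h) τ
        ((r : ℝ) • mu (realForm B) e g (toReal u) (toReal u')) 0)

/-- The auxiliary function `h_{α,β}(τ, g)`. -/
def auxFun (α β : Fin b) (k : ℤ) (f : UpperHalfPlane → ℂ) (τ : UpperHalfPlane) : ℂ :=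
  prefactor B e g u k f τ * ∑' r : ℕ+, auxTerm B e g u u' α β τ r

end Lattice

/-- The subgroup `Γ_∞ = {(1 n; 0 1) : n ∈ ℤ}` of `SL₂(ℤ)`. -/
def gammaInf : Subgroup SL(2, ℤ) := Subgroup.zpowers ModularGroup.T

/-- The set `Γ_∞ \ SL₂(ℤ)` of cosets `Γ_∞ γ`. -/
abbrev Cosets : Type := Quotient (QuotientGroup.rightRel gammaInf)

end KMUnfold

end

/-! The proof is the unfolding of a Siegel theta function along an isotropic vector. Write a vector
of `L` as `v = x + n u + c u'` with `x ∈ K`. Since `(v, u) = c`, its inner products with `u_{z^⊥}`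
and `u_z` are `a` and `c - a`, with `a` affine in `n`, while its component in `w^⊥ ⊕ w` is that of
`x - c μ` and does not involve `n`. For fixed `x` and `c` the sum over `n` is therefore a
one-dimensional Gaussian series, and Poisson summation (`tsum_lineExp`) replaces `n` by a dual
integer `d`. Summing over `x` afterwards turns `Θ_L` into `(2 y u_{z^⊥}²)^{-1/2}` times a sum over
all `(c, d) ∈ ℤ²` of `PolyData.block`: a Gaussian in `|cτ + d|` times theta series of `K` with
characteristics `dμ` and `-cμ`, weighted by powers of `c τ̄ + d` (`PolyData.tsum_fullTerm_eq`).

The lattice `K` is even and unimodular of signature `(b - 1, 1)`, so these theta series are modular,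
with `SL₂(ℤ)` acting on the characteristics. Inversion is Poisson summation for Gaussians on a
unimodular lattice (`tsum_gauss_frame`). Polynomial weights are obtained from it by a generating
function: the Gaussian is multiplied by `exp (t ℓ)` for a linear form `ℓ`, and Taylor coefficients
in `t` of order at most two are compared (`exp_series_compare`). The operator `exp (-Δ / 8πy)`
supplies exactly the constant that gives the quadratic moment a pure weight
(`PolyData.theta_inversion`). The root of unity `I ^ p` left in the multiplier is trivial because `τ
↦ -1 / (τ + 1)` has order three (`I_pow_eq_one`).

Consequently the `(c, d)` term of the integrand, regarded as a function of `τ` and `(c, d)`,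
satisfies `PolyData.orbitTerm_smul`: moving `τ` by `γ` amounts to multiplying the row `(c, d)` by
`γ` on the right. The term of `r` times the bottom row of `γ` at `τ` is thus the term of `(0, r)` at
`γτ`, which is the `r`-th term of `h_{α,β}(γτ, g)`. Every nonzero pair arises once from a coset `Γ_∞
γ` and an `r ≥ 1` (`cosetVector_bijective`), and `(0, 0)` gives the separate `Θ_K` term. All
rearrangements are justified by Gaussian majorants in `(x, c, n)` and `(x, c, d)`. -/

noncomputable section

namespace KMUnfold

open MeasureTheory Complex Filter Topology

/-! ### Poisson summation on `ℝ^d` through Fourier series on the torus -/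

section Poisson

variable {d : Type*} [Fintype d]

/-- The translate by `m ∈ ℤ^d` of the half-open unit cube. -/
def unitCube (m : d → ℤ) : Set (d → ℝ) := {x | ∀ i, x i ∈ Set.Ioc (m i : ℝ) (m i + 1)}

lemma measurableSet_unitCube (m : d → ℤ) : MeasurableSet (unitCube m) :=
  MeasurableSet.univ_pi' fun _ => measurableSet_Ioc

omit [Fintype d] in
lemma pairwise_disjoint_unitCube : Pairwise (Function.onFun Disjoint (unitCube (d := d))) := by
  intro m n hmn
  refine Set.disjoint_left.2 fun x hm hn => hmn (funext fun i => ?_)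
  have h1 := hm i
  have h2 := hn i
  simp only [Set.mem_Ioc] at h1 h2
  have h3 : (m i : ℝ) < n i + 1 := by linarith
  have h4 : (n i : ℝ) < m i + 1 := by linarith
  norm_cast at h3 h4
  omega

omit [Fintype d] in
lemma iUnion_unitCube : ⋃ m, unitCube (d := d) m = Set.univ := by
  -- The cubes are open on the left and closed on the right, so the corner is `⌈x i⌉ - 1` rather
  -- than `⌊x i⌋`.
  refine Set.eq_univ_of_forall fun x => Set.mem_iUnion.2 ⟨fun i => ⌈x i⌉ - 1, fun i => ?_⟩
  have h1 := Int.ceil_lt_add_one (x i)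
  have h2 := Int.le_ceil (x i)
  simp only [Set.mem_Ioc]
  push_cast
  constructor <;> linarith

lemma setIntegral_unitCube (f : (d → ℝ) → ℂ) (m : d → ℤ) :
    ∫ x in unitCube m, f x = ∫ x in unitCube (0 : d → ℤ), f (x + fun i => (m i : ℝ)) := by
  have hmp := measurePreserving_add_right (volume : Measure (d → ℝ)) (fun i => (m i : ℝ))
  have he := (MeasurableEquiv.addRight (fun i => (m i : ℝ))).measurableEmbedding
  have := hmp.setIntegral_preimage_emb he f (unitCube m)
  rw [← this]
  congr 2
  ext x
  simp only [unitCube, Set.mem_preimage, Set.mem_ofPred_eq, Set.mem_Ioc, Pi.add_apply, Pi.zero_apply,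
    Int.cast_zero]
  refine forall_congr' fun i => ?_
  constructor <;> rintro ⟨h1, h2⟩ <;> constructor <;> linarith

lemma integral_eq_tsum_unitCube (f : (d → ℝ) → ℂ) (hf : Integrable f) :
    ∫ x, f x = ∑' m : d → ℤ, ∫ x in unitCube (0 : d → ℤ), f (x + fun i => (m i : ℝ)) := by
  rw [← setIntegral_univ, ← iUnion_unitCube, integral_iUnion measurableSet_unitCube
    pairwise_disjoint_unitCube (by rw [iUnion_unitCube]; exact hf.integrableOn)]
  exact tsum_congr fun m => setIntegral_unitCube f m

lemma volume_unitCube_zero : volume (unitCube (0 : d → ℤ)) = 1 := by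
  have : unitCube (0 : d → ℤ) = Set.pi Set.univ fun _ => Set.Ioc (0 : ℝ) 1 := by
    ext x
    simp [unitCube]
  rw [this, volume_pi_pi]
  simp

/-- The periodization `x ↦ ∑ m, f (x + m)`, as a function on the torus. -/
def periodize (f : (d → ℝ) → ℂ) (t : UnitAddTorus d) : ℂ :=
  ∑' m : d → ℤ, f ((fun i => ((AddCircle.equivIoc 1 0 (t i) : ℝ))) + fun i => (m i : ℝ))

-- The representative in `(0, 1]` chosen by `AddCircle.equivIoc` differs from `x` by an integral
-- vector, and a shift of the summation index absorbs it.
omit [Fintype d] in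
lemma periodize_coe (f : (d → ℝ) → ℂ) (x : d → ℝ) :
    periodize f (fun i => (x i : UnitAddCircle)) = ∑' m : d → ℤ, f (x + fun i => (m i : ℝ)) := by
  have h : ∀ i, ∃ n : ℤ, ((AddCircle.equivIoc 1 0 ((x i : ℝ) : UnitAddCircle) : ℝ)) = x i + n := by
    intro i
    have h1 : (((AddCircle.equivIoc 1 0 ((x i : ℝ) : UnitAddCircle) : ℝ)) : UnitAddCircle)
        = (x i : UnitAddCircle) := (AddCircle.equivIoc 1 0).symm_apply_apply _
    obtain ⟨n, hn⟩ := (AddCircle.coe_eq_zero_iff (1 : ℝ)).1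
      ((AddCircle.coe_sub (1 : ℝ) _ _).trans (sub_eq_zero.2 h1))
    refine ⟨n, ?_⟩
    rw [zsmul_eq_mul, mul_one] at hn
    linarith
  choose n hn using h
  unfold periodize
  rw [← (Equiv.addLeft n).tsum_eq fun m : d → ℤ => f (x + fun i => (m i : ℝ))]
  refine tsum_congr fun m => congrArg f (funext fun i => ?_)
  simp only [Pi.add_apply, Equiv.coe_addLeft, hn]
  push_cast
  ring

/-- The Weierstrass test on a ball around each point: `hb` provides one summable majorant per
radius. -/
lemma continuous_tsum_translates (f : (d → ℝ) → ℂ) (hf : Continuous f)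
    (hb : ∀ R : ℝ, ∃ v : (d → ℤ) → ℝ, Summable v ∧
      ∀ m, ∀ x : d → ℝ, ‖x‖ ≤ R → ‖f (x + fun i => (m i : ℝ))‖ ≤ v m) :
    Continuous fun x => ∑' m : d → ℤ, f (x + fun i => (m i : ℝ)) := by
  rw [continuous_iff_continuousAt]
  intro x
  obtain ⟨v, hv, hfv⟩ := hb (‖x‖ + 1)
  have h := continuousOn_tsum (s := Metric.closedBall (0 : d → ℝ) (‖x‖ + 1))
    (f := fun (m : d → ℤ) x => f (x + fun i => (m i : ℝ)))
    (fun m => (hf.comp (continuous_id.add continuous_const)).continuousOn) hv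
    (fun m y hy => hfv m y (by simpa using hy))
  refine h.continuousAt (mem_of_superset (Metric.ball_mem_nhds x one_pos) fun y hy => ?_)
  rw [mem_closedBall_zero_iff]
  rw [Metric.mem_ball, dist_eq_norm] at hy
  have := norm_add_le (y - x) x
  rw [sub_add_cancel] at this
  linarith

/-- `ℝ^d → (ℝ/ℤ)^d` is a quotient map, so continuity may be checked on the lifted series. -/
lemma continuous_periodize (f : (d → ℝ) → ℂ) (hf : Continuous f)
    (hb : ∀ R : ℝ, ∃ v : (d → ℤ) → ℝ, Summable v ∧
      ∀ m, ∀ x : d → ℝ, ‖x‖ ≤ R → ‖f (x + fun i => (m i : ℝ))‖ ≤ v m) :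
    Continuous (periodize f) := by
  have hq : IsOpenQuotientMap (Pi.map fun (_ : d) (x : ℝ) => (x : UnitAddCircle)) :=
    IsOpenQuotientMap.piMap fun _ => QuotientAddGroup.isOpenQuotientMap_mk
  rw [hq.isQuotientMap.continuous_iff]
  have : periodize f ∘ (Pi.map fun (_ : d) (x : ℝ) => (x : UnitAddCircle)) =
      fun x => ∑' m : d → ℤ, f (x + fun i => (m i : ℝ)) := by
    ext x
    exact periodize_coe f x
  rw [this]
  exact continuous_tsum_translates f hf hb

lemma mFourier_coe (n : d → ℤ) (x : d → ℝ) :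
    UnitAddTorus.mFourier n (fun i => (x i : UnitAddCircle)) =
      cexp (2 * Real.pi * I * ((∑ i, (n i : ℝ) * x i : ℝ) : ℂ)) := by
  simp only [UnitAddTorus.mFourier, ContinuousMap.coe_mk, fourier_coe_apply]
  rw [← Complex.exp_sum, Complex.ofReal_sum, Finset.mul_sum]
  congr 1
  refine Finset.sum_congr rfl fun i _ => ?_
  push_cast
  ring

lemma mFourier_coe_add_int (n m : d → ℤ) (x : d → ℝ) :
    UnitAddTorus.mFourier n (fun i => ((x i + m i : ℝ) : UnitAddCircle)) =
      UnitAddTorus.mFourier n (fun i => (x i : UnitAddCircle)) := by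
  congr 1
  ext i
  have := AddCircle.coe_add_period (1 : ℝ)
  rw [AddCircle.coe_add]
  have h : ((m i : ℝ) : UnitAddCircle) = 0 := by
    rw [AddCircle.coe_eq_zero_iff]
    exact ⟨m i, by simp⟩
  rw [h, add_zero]

/-- The character is `ℤ^d`-periodic, so it can be moved inside the sum over translates. The majorant
on the unit cube, which has volume one, permits exchanging sum and integral, and the translated
cubes then tile `ℝ^d`. -/
lemma mFourierCoeff_periodize (f : (d → ℝ) → ℂ) (hi : Integrable f)
    (hb : ∀ R : ℝ, ∃ v : (d → ℤ) → ℝ, Summable v ∧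
      ∀ m, ∀ x : d → ℝ, ‖x‖ ≤ R → ‖f (x + fun i => (m i : ℝ))‖ ≤ v m) (n : d → ℤ) :
    UnitAddTorus.mFourierCoeff (periodize f) n =
      ∫ x : d → ℝ, cexp (-(2 * Real.pi * I * ((∑ i, (n i : ℝ) * x i : ℝ) : ℂ))) * f x := by
  rw [UnitAddTorus.mFourierCoeff_eq_integral _ n 0]
  set E : (d → ℝ) → ℂ := fun x => UnitAddTorus.mFourier (-n) fun i => (x i : UnitAddCircle) with hE
  have hEx : ∀ x, E x = cexp (-(2 * Real.pi * I * ((∑ i, (n i : ℝ) * x i : ℝ) : ℂ))) := by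
    intro x
    rw [hE]
    simp only [mFourier_coe]
    simp
  have hEc : Continuous E := by
    have : E = fun x => cexp (-(2 * Real.pi * I * ((∑ i, (n i : ℝ) * x i : ℝ) : ℂ))) := funext hEx
    rw [this]
    fun_prop
  have hEn : ∀ x, ‖E x‖ = 1 := by
    intro x
    rw [hEx, show -(2 * Real.pi * I * ((∑ i, (n i : ℝ) * x i : ℝ) : ℂ))
      = ((-(2 * Real.pi * ∑ i, (n i : ℝ) * x i) : ℝ) : ℂ) * I by push_cast; ring,
      Complex.norm_exp_ofReal_mul_I]
  have hset : {x : d → ℝ | ∀ i, x i ∈ Set.Ioc ((0 : d → ℝ) i) ((0 : d → ℝ) i + 1)} =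
      unitCube (0 : d → ℤ) := by
    ext x
    simp [unitCube]
  have hint : Integrable fun x => E x * f x := by
    refine (hi.bdd_mul (c := 1) hEc.aestronglyMeasurable (.of_forall fun x => (hEn x).le))
  simp_rw [← hEx]
  rw [hset, integral_eq_tsum_unitCube _ hint]
  obtain ⟨v, hv, hfv⟩ := hb 1
  have hbd : ∀ x ∈ unitCube (0 : d → ℤ), ‖x‖ ≤ 1 := by
    intro x hx
    refine (pi_norm_le_iff_of_nonneg zero_le_one).2 fun i => ?_
    have := hx i
    simp only [Pi.zero_apply, Int.cast_zero, zero_add, Set.mem_Ioc] at this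
    rw [Real.norm_eq_abs, abs_le]
    constructor <;> linarith
  have hint2 : ∀ m : d → ℤ, Integrable
      (fun x => E x * f (x + fun i => (m i : ℝ))) (volume.restrict (unitCube (0 : d → ℤ))) := by
    intro m
    refine Integrable.integrableOn ?_
    refine ((hi.comp_add_right fun i => (m i : ℝ)).bdd_mul (c := 1) hEc.aestronglyMeasurable
      (.of_forall fun x => (hEn x).le))
  have hsum : Summable fun m : d → ℤ =>
      ∫ x in unitCube (0 : d → ℤ), ‖E x * f (x + fun i => (m i : ℝ))‖ := by
    refine Summable.of_nonneg_of_le (fun m => integral_nonneg fun x => norm_nonneg _)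
      (fun m => ?_) hv
    have hc : ∫ _ in unitCube (0 : d → ℤ), v m = v m := by
      rw [setIntegral_const, measureReal_def, volume_unitCube_zero]
      simp
    rw [← hc]
    refine setIntegral_mono_on (hint2 m).norm ?_ (measurableSet_unitCube _) fun x hx => ?_
    · exact integrableOn_const (by rw [volume_unitCube_zero]; simp)
    · rw [norm_mul, hEn, one_mul]
      exact hfv m x (hbd x hx)
  have key := (hasSum_integral_of_summable_integral_norm hint2 hsum).tsum_eq
  have hshift : ∀ (m : d → ℤ) (x : d → ℝ), E (x + fun i => (m i : ℝ)) = E x := by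
    intro m x
    exact mFourier_coe_add_int (-n) m x
  simp_rw [hshift]
  rw [key]
  refine setIntegral_congr_fun (measurableSet_unitCube _) fun x _ => ?_
  simp only [smul_eq_mul]
  rw [periodize_coe, tsum_mul_left]

/-- The Poisson summation formula on `ℝ^d`. -/
theorem tsum_int_eq_tsum_fourier (f : (d → ℝ) → ℂ) (hf : Continuous f) (hi : Integrable f)
    (hb : ∀ R : ℝ, ∃ v : (d → ℤ) → ℝ, Summable v ∧
      ∀ m, ∀ x : d → ℝ, ‖x‖ ≤ R → ‖f (x + fun i => (m i : ℝ))‖ ≤ v m)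
    (hF : Summable fun n : d → ℤ =>
      ∫ x : d → ℝ, cexp (-(2 * Real.pi * I * ((∑ i, (n i : ℝ) * x i : ℝ) : ℂ))) * f x) :
    ∑' m : d → ℤ, f (fun i => (m i : ℝ)) =
      ∑' n : d → ℤ, ∫ x : d → ℝ, cexp (-(2 * Real.pi * I * ((∑ i, (n i : ℝ) * x i : ℝ) : ℂ))) * f x := by
  have hc := continuous_periodize f hf hb
  let F : C(UnitAddTorus d, ℂ) := ⟨periodize f, hc⟩
  have hco : UnitAddTorus.mFourierCoeff F = fun n : d → ℤ =>
      ∫ x : d → ℝ, cexp (-(2 * Real.pi * I * ((∑ i, (n i : ℝ) * x i : ℝ) : ℂ))) * f x :=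
    funext fun n => mFourierCoeff_periodize f hi hb n
  -- A continuous function with summable Fourier coefficients is the pointwise sum of its Fourier
  -- series; the formula is its value at the origin.
  have h := UnitAddTorus.hasSum_mFourier_series_apply_of_summable (f := F) (by rw [hco]; exact hF)
    (fun i => ((0 : ℝ) : UnitAddCircle))
  have h0 : F (fun i => ((0 : ℝ) : UnitAddCircle)) = ∑' m : d → ℤ, f (fun i => (m i : ℝ)) := by
    change periodize f _ = _
    rw [show (fun _ : d => ((0 : ℝ) : UnitAddCircle)) =
      fun i => (((0 : d → ℝ) i : ℝ) : UnitAddCircle) from rfl, periodize_coe]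
    simp
  rw [h0] at h
  rw [← h.tsum_eq, hco]
  refine tsum_congr fun n => ?_
  have : UnitAddTorus.mFourier n (fun _ => ((0 : ℝ) : UnitAddCircle)) = 1 := by
    have := mFourier_coe n (0 : d → ℝ)
    simpa using this
  rw [this]
  simp

end Poisson

/-! ### Gaussian functions: lattice sums, decay and integrals -/

section Gaussian

variable {ι : Type*} [Fintype ι]

/-- A finite set of integral vectors lies in the box spanned by its coordinate projections, and the
sum over a box factors into one-dimensional sums. -/
lemma summable_pi_prod {f : ℤ → ℝ} (hf : Summable f) (h0 : ∀ n, 0 ≤ f n) :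
    Summable fun m : ι → ℤ => ∏ i, f (m i) := by
  classical
  refine summable_of_sum_le (c := ∏ _i : ι, ∑' n, f n)
    (fun m => Finset.prod_nonneg fun i _ => h0 _) fun S => ?_
  have hS : S ⊆ Fintype.piFinset fun i => S.image fun m => m i := by
    intro m hm
    rw [Fintype.mem_piFinset]
    exact fun i => Finset.mem_image_of_mem _ hm
  refine (Finset.sum_le_sum_of_subset_of_nonneg hS fun m _ _ =>
    Finset.prod_nonneg fun i _ => h0 _).trans ?_
  rw [← Finset.prod_univ_sum]
  exact Finset.prod_le_prod (fun i _ => Finset.sum_nonneg fun n _ => h0 n)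
    fun i _ => hf.sum_le_tsum _ fun n _ => h0 n

lemma summable_exp_neg_mul_int_sq {ε : ℝ} (hε : 0 < ε) :
    Summable fun n : ℤ => Real.exp (-ε * (n : ℝ) ^ 2) := by
  have hg : Summable fun n : ℕ => Real.exp (-ε * (n : ℝ) ^ 2) := by
    refine Summable.of_nonneg_of_le (fun n => (Real.exp_pos _).le) (fun n => ?_)
      (Real.summable_exp_nat_mul_iff.2 (neg_lt_zero.2 hε))
    rw [Real.exp_le_exp]
    have : (n : ℝ) ≤ (n : ℝ) ^ 2 := by
      exact_mod_cast Nat.le_self_pow two_ne_zero n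
    nlinarith
  refine Summable.of_nat_of_neg (by simpa using hg) (by simpa using hg)

lemma summable_exp_neg_sum_sq {ε : ℝ} (hε : 0 < ε) :
    Summable fun m : ι → ℤ => Real.exp (-ε * ∑ i, (m i : ℝ) ^ 2) := by
  refine (summable_pi_prod (summable_exp_neg_mul_int_sq hε)
    fun n => (Real.exp_pos _).le).congr fun m => ?_
  rw [← Real.exp_sum, Finset.mul_sum]

/-- Cauchy–Schwarz for `x = M⁻¹ (M x)`. The constant is the inverse of the squared Frobenius norm of
`M⁻¹`, increased by one to avoid dividing by zero. -/
lemma exists_mul_sum_sq_le_mulVec [DecidableEq ι] {M : Matrix ι ι ℝ} (hM : M.det ≠ 0) :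
    ∃ δ : ℝ, 0 < δ ∧ ∀ x : ι → ℝ, δ * ∑ i, x i ^ 2 ≤ ∑ i, (M.mulVec x) i ^ 2 := by
  set C : ℝ := ∑ i, ∑ j, M⁻¹ i j ^ 2 with hC
  have hC0 : 0 ≤ C := Finset.sum_nonneg fun i _ => Finset.sum_nonneg fun j _ => sq_nonneg _
  refine ⟨1 / (C + 1), by positivity, fun x => ?_⟩
  set y := M.mulVec x with hy
  have hx : x = M⁻¹.mulVec y := by
    rw [hy, Matrix.mulVec_mulVec, Matrix.nonsing_inv_mul _ (isUnit_iff_ne_zero.2 hM),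
      Matrix.one_mulVec]
  have hle : ∑ i, x i ^ 2 ≤ C * ∑ i, y i ^ 2 := by
    rw [hC, Finset.sum_mul]
    refine Finset.sum_le_sum fun i _ => ?_
    rw [hx]
    exact Finset.sum_mul_sq_le_sq_mul_sq _ _ _
  have hy0 : 0 ≤ ∑ i, y i ^ 2 := Finset.sum_nonneg fun i _ => sq_nonneg _
  rw [one_div, inv_mul_le_iff₀ (by positivity)]
  nlinarith

lemma exists_pos_le_re {b : ι → ℂ} (hb : ∀ i, 0 < (b i).re) :
    ∃ r : ℝ, 0 < r ∧ ∀ i, r ≤ (b i).re := by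
  rcases isEmpty_or_nonempty ι with h | h
  · exact ⟨1, one_pos, fun i => (h.false i).elim⟩
  · obtain ⟨i, hi⟩ := Finite.exists_min fun i => (b i).re
    exact ⟨_, hb i, hi⟩

/-- The Gaussian function `y ↦ exp (∑ i, (-π bᵢ yᵢ² + cᵢ yᵢ))`. -/
def gauss (b c : ι → ℂ) (y : ι → ℝ) : ℂ :=
  cexp (∑ i, (-Real.pi * b i * (y i : ℂ) ^ 2 + c i * y i))

/-- One half of the quadratic exponent absorbs the linear term by completing the square; the other
half is the decay that remains. -/
lemma exists_norm_gauss_le {b : ι → ℂ} (hb : ∀ i, 0 < (b i).re) (c : ι → ℂ) :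
    ∃ ε C : ℝ, 0 < ε ∧ 0 ≤ C ∧ ∀ y, ‖gauss b c y‖ ≤ C * Real.exp (-ε * ∑ i, y i ^ 2) := by
  obtain ⟨r, hr, hrb⟩ := exists_pos_le_re hb
  have hπ := Real.pi_pos
  refine ⟨Real.pi * r / 2, Real.exp (∑ i, (c i).re ^ 2 / (2 * Real.pi * r)), by positivity,
    (Real.exp_pos _).le, fun y => ?_⟩
  rw [gauss, Complex.norm_exp, ← Real.exp_add, Real.exp_le_exp, Complex.re_sum, Finset.mul_sum,
    ← Finset.sum_add_distrib]
  refine Finset.sum_le_sum fun i _ => ?_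
  have h1 : (-Real.pi * b i * (y i : ℂ) ^ 2 + c i * y i).re =
      -Real.pi * (b i).re * y i ^ 2 + (c i).re * y i := by
    have : -(Real.pi : ℂ) * b i * (y i : ℂ) ^ 2 + c i * y i =
      ((-Real.pi * y i ^ 2 : ℝ) : ℂ) * b i + ((y i : ℝ) : ℂ) * c i := by push_cast; ring
    rw [this, Complex.add_re, Complex.re_ofReal_mul, Complex.re_ofReal_mul]
    ring
  rw [h1]
  have h2 : (c i).re ^ 2 / (2 * Real.pi * r) + -(Real.pi * r / 2) * y i ^ 2 -
      ((c i).re * y i - Real.pi * r * y i ^ 2) =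
      ((c i).re - Real.pi * r * y i) ^ 2 / (2 * Real.pi * r) := by
    field_simp
    ring
  have h3 : 0 ≤ ((c i).re - Real.pi * r * y i) ^ 2 / (2 * Real.pi * r) := by positivity
  have h4 : Real.pi * r * y i ^ 2 ≤ Real.pi * (b i).re * y i ^ 2 := by
    have := hrb i
    gcongr
  linarith

lemma integrable_gauss {b : ι → ℂ} (hb : ∀ i, 0 < (b i).re) (c : ι → ℂ) :
    Integrable (gauss b c) := by
  have : gauss b c = fun y => ∏ i, cexp (-Real.pi * b i * (y i : ℂ) ^ 2 + c i * y i) := by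
    ext y
    rw [gauss, Complex.exp_sum]
  rw [this]
  refine Integrable.fintype_prod (f := fun i (y : ℝ) =>
    cexp (-Real.pi * b i * (y : ℂ) ^ 2 + c i * y)) fun i => ?_
  have h : (-(Real.pi : ℂ) * b i).re < 0 := by
    rw [← Complex.ofReal_neg, Complex.re_ofReal_mul]
    have := mul_pos Real.pi_pos (hb i)
    linarith
  simpa using integrable_cexp_quadratic' h (c i) 0

lemma integral_gauss {b : ι → ℂ} (hb : ∀ i, 0 < (b i).re) (c : ι → ℂ) :
    ∫ y, gauss b c y =
      (∏ i, (1 / b i) ^ (1 / 2 : ℂ)) * cexp (∑ i, c i ^ 2 / (4 * Real.pi * b i)) := by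
  have h : ∀ i, 0 < ((Real.pi : ℂ) * b i).re := fun i => by
    rw [Complex.re_ofReal_mul]
    exact mul_pos Real.pi_pos (hb i)
  have := GaussianFourier.integral_cexp_neg_sum_mul_add h c
  rw [Complex.exp_sum, ← Finset.prod_mul_distrib]
  refine Eq.trans ?_ (this.trans ?_)
  · congr 1
    ext y
    rw [gauss, Finset.sum_add_distrib, ← Finset.sum_neg_distrib]
    congr 3
    ext i
    ring
  · refine Finset.prod_congr rfl fun i _ => ?_
    have hπ : (Real.pi : ℂ) ≠ 0 := by exact_mod_cast Real.pi_ne_zero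
    congr 2
    · rw [div_mul_eq_div_div, div_self hπ]
    · ring

end Gaussian

/-! ### Poisson summation for Gaussians on a unimodular lattice -/

section Unimodular

variable {Λ : Type*} [AddCommGroup Λ] [Module.Free ℤ Λ] [Module.Finite ℤ Λ]
  {B : LinearMap.BilinForm ℤ Λ} {ι : Type*} [Fintype ι] {σ : ι → ℝ} {φ : Λ →+ (ι → ℝ)}

/-- `φ` identifies the unimodular lattice `Λ` with a lattice in `ℝ^ι`, where the bilinear form is
the diagonal form with entries `σᵢ = ±1`. -/
structure IsFrame (B : LinearMap.BilinForm ℤ Λ) (σ : ι → ℝ) (φ : Λ →+ (ι → ℝ)) : Prop where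
  bij : Function.Bijective (B : Λ → (Λ →ₗ[ℤ] ℤ))
  card : Module.finrank ℤ Λ = Fintype.card ι
  sq : ∀ i, σ i ^ 2 = 1
  form : ∀ x y, (B x y : ℝ) = ∑ i, σ i * φ x i * φ y i

/-- The matrix of a frame with respect to a basis of the lattice. -/
def frameMatrix (φ : Λ →+ (ι → ℝ)) (v : Module.Basis ι ℤ Λ) : Matrix ι ι ℝ :=
  fun i j => φ (v j) i

omit [Module.Free ℤ Λ] [Module.Finite ℤ Λ] in
lemma frameMatrix_mulVec (v : Module.Basis ι ℤ Λ) (x : Λ) :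
    (frameMatrix φ v).mulVec (fun i => (v.repr x i : ℝ)) = φ x := by
  conv_rhs => rw [← v.sum_repr x]
  ext i
  simp only [Matrix.mulVec, dotProduct, frameMatrix, map_sum, map_zsmul, Finset.sum_apply,
    zsmul_eq_mul]
  exact Finset.sum_congr rfl fun j _ => mul_comm _ _

-- The Gram matrix `Mᵀ diag(σ) M` represents the isomorphism of the lattice with its dual, so its
-- determinant is `±1`, like that of `diag(σ)`; hence `det M ^ 2 = 1`. The lattice has covolume one,
-- and no volume factor appears in Poisson summation.
omit [Module.Free ℤ Λ] [Module.Finite ℤ Λ] in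
lemma abs_det_frameMatrix [DecidableEq ι] (h : IsFrame B σ φ) (v : Module.Basis ι ℤ Λ) :
    |(frameMatrix φ v).det| = 1 := by
  let eB : Λ ≃ₗ[ℤ] Module.Dual ℤ Λ := LinearEquiv.ofBijective B h.bij
  have hu := LinearEquiv.isUnit_det eB v v.dualBasis
  have hG : (LinearMap.toMatrix v v.dualBasis (eB : Λ →ₗ[ℤ] Module.Dual ℤ Λ)).map (Int.cast : ℤ → ℝ)
      = (frameMatrix φ v).transpose * Matrix.diagonal σ * frameMatrix φ v := by
    ext i j
    rw [Matrix.map_apply, LinearMap.toMatrix_apply, Module.Basis.dualBasis_repr,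
      Matrix.mul_assoc, Matrix.mul_apply]
    change ((B (v j) (v i) : ℤ) : ℝ) = _
    rw [h.form]
    refine Finset.sum_congr rfl fun k _ => ?_
    rw [Matrix.diagonal_mul, Matrix.transpose_apply, frameMatrix, frameMatrix]
    ring
  have hd := congrArg Matrix.det hG
  rw [Matrix.det_mul, Matrix.det_mul, Matrix.det_transpose, Matrix.det_diagonal,
    ← Int.cast_det] at hd
  have h1 : |((LinearMap.toMatrix v v.dualBasis (eB : Λ →ₗ[ℤ] Module.Dual ℤ Λ)).det : ℝ)| = 1 := by
    rcases Int.isUnit_iff.1 hu with h | h <;> rw [h] <;> simp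
  have h2 : |∏ i, σ i| = 1 := by
    rw [Finset.abs_prod]
    exact Finset.prod_eq_one fun i _ => by
      rw [← sq_eq_sq₀ (abs_nonneg _) zero_le_one, sq_abs, h.sq, one_pow]
  rw [hd, abs_mul, abs_mul, h2, mul_one] at h1
  nlinarith [abs_nonneg (frameMatrix φ v).det]

/-- The rank of a frame yields a basis of the lattice with the same index set. -/
lemma exists_basis_of_isFrame (h : IsFrame B σ φ) : Nonempty (Module.Basis ι ℤ Λ) :=
  ⟨(Module.finBasisOfFinrankEq ℤ Λ h.card).reindex (Fintype.equivFin ι).symm⟩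

lemma summable_exp_neg_frame (h : IsFrame B σ φ) {ε : ℝ} (hε : 0 < ε) :
    Summable fun x : Λ => Real.exp (-ε * ∑ i, φ x i ^ 2) := by
  classical
  obtain ⟨v⟩ := exists_basis_of_isFrame h
  have hM : (frameMatrix φ v).det ≠ 0 := fun h0 => by
    have := abs_det_frameMatrix h v
    simp [h0] at this
  obtain ⟨δ, hδ, hle⟩ := exists_mul_sum_sq_le_mulVec hM
  have hs := (v.equivFun.toEquiv.summable_iff).2
    (summable_exp_neg_sum_sq (ι := ι) (mul_pos hε hδ))
  refine Summable.of_nonneg_of_le (fun x => (Real.exp_pos _).le) (fun x => ?_) hs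
  have := hle (fun i => (v.repr x i : ℝ))
  rw [frameMatrix_mulVec] at this
  simp only [Function.comp_apply, LinearEquiv.coe_toEquiv, Module.Basis.equivFun_apply]
  rw [Real.exp_le_exp]
  nlinarith

lemma summable_gauss_frame (h : IsFrame B σ φ) {b : ι → ℂ} (hb : ∀ i, 0 < (b i).re) (c : ι → ℂ) :
    Summable fun x : Λ => gauss b c (φ x) := by
  obtain ⟨ε, C, hε, -, hle⟩ := exists_norm_gauss_le hb c
  exact Summable.of_norm_bounded ((summable_exp_neg_frame h hε).mul_left C) fun x => hle (φ x)

lemma re_one_div_pos {z : ℂ} (hz : 0 < z.re) : 0 < (1 / z).re := by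
  rw [one_div, Complex.inv_re]
  exact div_pos hz (Complex.normSq_pos.2 fun h => by simp [h] at hz)

lemma ne_zero_of_re_pos {z : ℂ} (hz : 0 < z.re) : z ≠ 0 := fun h => by simp [h] at hz

lemma measurePreserving_mulVec [DecidableEq ι] {M : Matrix ι ι ℝ} (hM : |M.det| = 1) :
    MeasurePreserving (fun x : ι → ℝ => M.mulVec x) := by
  have h0 : M.det ≠ 0 := fun h => by simp [h] at hM
  refine ⟨?_, ?_⟩
  · exact (Matrix.toLin' M).continuous_of_finiteDimensional.measurable
  · have := Real.map_matrix_volume_pi_eq_smul_volume_pi h0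
    rw [abs_inv, hM, inv_one, ENNReal.ofReal_one, one_smul] at this
    exact this

lemma measurableEmbedding_mulVec [DecidableEq ι] {M : Matrix ι ι ℝ} (hM : M.det ≠ 0) :
    MeasurableEmbedding (fun x : ι → ℝ => M.mulVec x) := by
  have hc : Continuous fun x : ι → ℝ => M.mulVec x :=
    (Matrix.toLin' M).continuous_of_finiteDimensional
  refine hc.measurableEmbedding ?_
  intro x y hxy
  have := congrArg (M⁻¹.mulVec) hxy
  simpa [Matrix.mulVec_mulVec, Matrix.nonsing_inv_mul _ (isUnit_iff_ne_zero.2 hM)] using this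

lemma gauss_mul_exp (b c c' : ι → ℂ) (y : ι → ℝ) :
    cexp (∑ i, c' i * y i) * gauss b c y = gauss b (fun i => c i + c' i) y := by
  rw [gauss, gauss, ← Complex.exp_add, ← Finset.sum_add_distrib]
  congr 1
  exact Finset.sum_congr rfl fun i _ => by ring

/-- Poisson summation for a Gaussian function on a unimodular lattice. -/
theorem tsum_gauss_frame (h : IsFrame B σ φ) {b : ι → ℂ} (hb : ∀ i, 0 < (b i).re) (c : ι → ℂ) :
    ∑' x : Λ, gauss b c (φ x) = (∏ i, (1 / b i) ^ (1 / 2 : ℂ)) *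
      ∑' x : Λ, cexp (∑ i, (c i - 2 * Real.pi * I * (σ i * φ x i : ℝ)) ^ 2 /
        (4 * Real.pi * b i)) := by
  classical
  obtain ⟨v⟩ := exists_basis_of_isFrame h
  set M := frameMatrix φ v with hMdef
  have hM1 : |M.det| = 1 := abs_det_frameMatrix h v
  have hM : M.det ≠ 0 := fun h0 => by simp [h0] at hM1
  have hMc : Continuous fun x : ι → ℝ => M.mulVec x :=
    (Matrix.toLin' M).continuous_of_finiteDimensional
  have hmp := measurePreserving_mulVec hM1
  have hme := measurableEmbedding_mulVec hM
  let f : (ι → ℝ) → ℂ := fun x => gauss b c (M.mulVec x)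
  have hgc : Continuous (gauss b c) := by
    unfold gauss
    fun_prop
  have hfc : Continuous f := hgc.comp hMc
  have hfi : Integrable f := (hmp.integrable_comp_emb hme).2 (integrable_gauss hb c)
  obtain ⟨ε, C, hε, hC, hle⟩ := exists_norm_gauss_le hb c
  obtain ⟨δ, hδ, hδle⟩ := exists_mul_sum_sq_le_mulVec hM
  have hbd : ∀ R : ℝ, ∃ w : (ι → ℤ) → ℝ, Summable w ∧
      ∀ m, ∀ x : ι → ℝ, ‖x‖ ≤ R → ‖f (x + fun i => (m i : ℝ))‖ ≤ w m := by
    intro R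
    -- `δ` compares the norm of `M (x + m)` with that of `x + m`. The bound `(x + m)² ≥ m² / 2 - x²`
    -- in each coordinate then separates `m` from the bounded vector `x`.
    refine ⟨fun m => C * Real.exp (ε * δ * (Fintype.card ι * R ^ 2)) *
      Real.exp (-(ε * δ / 2) * ∑ i, (m i : ℝ) ^ 2),
      (summable_exp_neg_sum_sq (by positivity)).mul_left _, fun m x hx => ?_⟩
    refine (hle _).trans ?_
    simp only
    rw [mul_assoc C, ← Real.exp_add]
    refine mul_le_mul_of_nonneg_left (Real.exp_le_exp.2 ?_) hC
    have h1 := hδle (x + fun i => (m i : ℝ))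
    have h2 : ∑ i, x i ^ 2 ≤ Fintype.card ι * R ^ 2 := by
      rw [← nsmul_eq_mul, ← Finset.card_univ]
      refine Finset.sum_le_card_nsmul _ _ _ fun i _ => ?_
      exact sq_le_sq' (by linarith [neg_abs_le (x i), norm_le_pi_norm x i, Real.norm_eq_abs (x i)])
        (by linarith [le_abs_self (x i), norm_le_pi_norm x i, Real.norm_eq_abs (x i)])
    have h3 : (1 / 2) * ∑ i, (m i : ℝ) ^ 2 - ∑ i, x i ^ 2 ≤
        ∑ i, (x + fun i => (m i : ℝ)) i ^ 2 := by
      rw [Finset.mul_sum, ← Finset.sum_sub_distrib]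
      refine Finset.sum_le_sum fun i _ => ?_
      simp only [Pi.add_apply]
      nlinarith [sq_nonneg (2 * x i + (m i : ℝ))]
    have h4 : δ * ((1 / 2) * ∑ i, (m i : ℝ) ^ 2 - Fintype.card ι * R ^ 2) ≤
        ∑ i, (M.mulVec (x + fun i => (m i : ℝ))) i ^ 2 :=
      (mul_le_mul_of_nonneg_left (by linarith) hδ.le).trans h1
    nlinarith [mul_le_mul_of_nonneg_left h4 hε.le]
  let eB : Λ ≃ₗ[ℤ] Module.Dual ℤ Λ := LinearEquiv.ofBijective B h.bij
  -- Unimodularity: the frequencies `ℤ^ι` are the vectors `(B x (v j))_j` for `x ∈ Λ`, so the dual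
  -- sum runs over `Λ` again.
  let eD : Λ ≃ (ι → ℤ) := (eB.trans v.dualBasis.equivFun).toEquiv
  have heD : ∀ x j, eD x j = B x (v j) := by
    intro x j
    change v.dualBasis.equivFun (B x) j = _
    rw [Module.Basis.equivFun_apply, Module.Basis.dualBasis_repr]
  have hdot : ∀ (x : Λ) (t : ι → ℝ),
      ∑ j, (eD x j : ℝ) * t j = ∑ i, σ i * φ x i * (M.mulVec t) i := by
    intro x t
    simp_rw [heD, h.form, Matrix.mulVec, dotProduct, Finset.mul_sum, Finset.sum_mul]
    rw [Finset.sum_comm]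
    refine Finset.sum_congr rfl fun i _ => Finset.sum_congr rfl fun j _ => ?_
    rw [hMdef, frameMatrix]
    ring
  have hint : ∀ x : Λ, ∫ t : ι → ℝ,
      cexp (-(2 * Real.pi * I * ((∑ j, (eD x j : ℝ) * t j : ℝ) : ℂ))) * f t =
      (∏ i, (1 / b i) ^ (1 / 2 : ℂ)) * cexp (∑ i,
        (c i - 2 * Real.pi * I * (σ i * φ x i : ℝ)) ^ 2 / (4 * Real.pi * b i)) := by
    intro x
    rw [← integral_gauss hb, ← hmp.integral_comp hme (gauss b _)]
    congr 1
    ext t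
    rw [hdot]
    simp only [sub_eq_add_neg]
    rw [← gauss_mul_exp b c (fun i => -(2 * Real.pi * I * (σ i * φ x i : ℝ)))]
    congr 2
    push_cast
    rw [Finset.mul_sum, ← Finset.sum_neg_distrib]
    exact Finset.sum_congr rfl fun i _ => by ring
  have hsum : Summable fun x : Λ => cexp (∑ i,
      (c i - 2 * Real.pi * I * (σ i * φ x i : ℝ)) ^ 2 / (4 * Real.pi * b i)) := by
    -- Expanding the square, with `σ i ^ 2 = 1`, shows that the dual term is a constant times a
    -- Gaussian with quadratic coefficients `1 / b i`.
    refine ((summable_gauss_frame h (fun i => re_one_div_pos (hb i))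
      (fun i => -(I * σ i * c i / b i))).mul_left
      (cexp (∑ i, c i ^ 2 / (4 * Real.pi * b i)))).congr fun x => ?_
    rw [gauss, ← Complex.exp_add, ← Finset.sum_add_distrib]
    congr 1
    refine Finset.sum_congr rfl fun i _ => ?_
    have hb0 := ne_zero_of_re_pos (hb i)
    have hπ : (Real.pi : ℂ) ≠ 0 := by exact_mod_cast Real.pi_ne_zero
    have hs : (σ i : ℂ) ^ 2 = 1 := by exact_mod_cast h.sq i
    push_cast
    field_simp
    linear_combination (4 * Real.pi ^ 2 * (φ x i : ℂ) ^ 2) * hs +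
      (-(4 * Real.pi ^ 2 * (σ i : ℂ) ^ 2 * (φ x i : ℂ) ^ 2)) * I_sq
  have hP := tsum_int_eq_tsum_fourier f hfc hfi hbd (by
    rw [← eD.summable_iff]
    refine (hsum.mul_left (∏ i, (1 / b i) ^ (1 / 2 : ℂ))).congr fun x => ?_
    exact (hint x).symm)
  have hl : ∑' x : Λ, gauss b c (φ x) = ∑' m : ι → ℤ, f fun i => (m i : ℝ) := by
    rw [← v.equivFun.toEquiv.tsum_eq]
    refine tsum_congr fun x => ?_
    change _ = gauss b c (M.mulVec fun i => (v.equivFun x i : ℝ))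
    simp only [Module.Basis.equivFun_apply]
    rw [hMdef, frameMatrix_mulVec]
  rw [hl, hP, ← eD.tsum_eq, ← tsum_mul_left]
  exact tsum_congr hint

end Unimodular

/-! ### Taylor coefficients of series of exponentials -/

section ExpSeries

variable {I₁ I₂ : Type*}

/-- The terms are holomorphic and normally convergent on the disc of radius `R`, so the series may
be differentiated termwise. -/
lemma hasDerivAt_exp_series {C a : I₁ → ℂ} {R : ℝ}
    (h : Summable fun i => ‖C i‖ * Real.exp (R * ‖a i‖)) {z : ℂ} (hz : ‖z‖ < R) :
    HasDerivAt (fun t => ∑' i, C i * cexp (t * a i)) (∑' i, C i * a i * cexp (z * a i)) z := by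
  have hd : ∀ i, DifferentiableOn ℂ (fun t => C i * cexp (t * a i)) (Metric.ball 0 R) :=
    fun i => by fun_prop
  have hle : ∀ i, ∀ w ∈ Metric.ball (0 : ℂ) R,
      ‖C i * cexp (w * a i)‖ ≤ ‖C i‖ * Real.exp (R * ‖a i‖) := by
    intro i w hw
    rw [mem_ball_zero_iff] at hw
    rw [norm_mul]
    refine mul_le_mul_of_nonneg_left ((Complex.norm_exp_le_exp_norm _).trans ?_) (norm_nonneg _)
    rw [Real.exp_le_exp, norm_mul]
    exact mul_le_mul_of_nonneg_right hw.le (norm_nonneg _)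
  have hzm : z ∈ Metric.ball (0 : ℂ) R := mem_ball_zero_iff.2 hz
  have hs := hasSum_deriv_of_summable_norm h hd Metric.isOpen_ball hle hzm
  have hdiff := (differentiableOn_tsum_of_summable_norm h hd Metric.isOpen_ball hle).differentiableAt
    (Metric.isOpen_ball.mem_nhds hzm)
  have hderiv : ∀ i, deriv (fun t => C i * cexp (t * a i)) z = C i * a i * cexp (z * a i) := by
    intro i
    have h1 : HasDerivAt (fun t : ℂ => C i * cexp (t * a i)) (C i * (cexp (z * a i) * (1 * a i))) z :=
      (((hasDerivAt_id z).mul_const (a i)).cexp).const_mul (C i)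
    rw [h1.deriv]
    ring
  have := hdiff.hasDerivAt
  rw [← hs.tsum_eq] at this
  simpa only [hderiv] using this

/-- A derivative costs a factor `a i`, which is paid for by shrinking the radius from `1` to `1 /
2`. -/
lemma summable_mul_exp_half {C a : I₁ → ℂ} (h : Summable fun i => ‖C i‖ * Real.exp ‖a i‖) :
    Summable fun i => ‖C i * a i‖ * Real.exp (1 / 2 * ‖a i‖) := by
  refine Summable.of_nonneg_of_le (fun i => by positivity) (fun i => ?_) (h.mul_left 2)
  have h1 : ‖a i‖ ≤ 2 * Real.exp (1 / 2 * ‖a i‖) := by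
    have := Real.add_one_le_exp (1 / 2 * ‖a i‖)
    linarith
  have h2 : Real.exp ‖a i‖ = Real.exp (1 / 2 * ‖a i‖) * Real.exp (1 / 2 * ‖a i‖) := by
    rw [← Real.exp_add]
    ring_nf
  rw [norm_mul, h2]
  have h3 : 0 ≤ ‖C i‖ * Real.exp (1 / 2 * ‖a i‖) := by positivity
  nlinarith

/-- Comparison of the Taylor coefficients of order `0`, `1`, `2` of two series of exponentials. -/
theorem exp_series_compare {C a : I₁ → ℂ} {D b : I₂ → ℂ} {e : ℂ}
    (hC : Summable fun i => ‖C i‖ * Real.exp ‖a i‖)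
    (hD : Summable fun i => ‖D i‖ * Real.exp ‖b i‖)
    (h : ∀ t : ℂ, ∑' i, C i * cexp (t * a i) = cexp (e * t ^ 2) * ∑' i, D i * cexp (t * b i)) :
    ∑' i, C i = ∑' i, D i ∧ ∑' i, C i * a i = ∑' i, D i * b i ∧
      ∑' i, C i * a i ^ 2 = ∑' i, D i * b i ^ 2 + 2 * e * ∑' i, D i := by
  have hC' : Summable fun i => ‖C i‖ * Real.exp (1 * ‖a i‖) := by simpa using hC
  have hD' : Summable fun i => ‖D i‖ * Real.exp (1 * ‖b i‖) := by simpa using hD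
  -- The first derivative is compared on a whole disc, not only at `0`, because it is differentiated
  -- once more below.
  have h1 : ∀ z : ℂ, ‖z‖ < 1 → ∑' i, C i * a i * cexp (z * a i) =
      cexp (e * z ^ 2) * (e * (2 * z)) * ∑' i, D i * cexp (z * b i) +
        cexp (e * z ^ 2) * ∑' i, D i * b i * cexp (z * b i) := by
    intro z hz
    have hl := hasDerivAt_exp_series hC' hz
    have hr := hasDerivAt_exp_series hD' hz
    have he : HasDerivAt (fun t : ℂ => cexp (e * t ^ 2)) (cexp (e * z ^ 2) * (e * (2 * z))) z := by
      have := (((hasDerivAt_id z).pow 2).const_mul e).cexp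
      simpa using this
    have hrr := he.mul hr
    rw [funext h] at hl
    exact hl.unique hrr
  have h2 : ∑' i, C i * a i * a i * cexp (0 * a i) =
      2 * e * ∑' i, D i * cexp (0 * b i) + ∑' i, D i * b i * b i * cexp (0 * b i) := by
    have hz : ‖(0 : ℂ)‖ < 1 / 2 := by norm_num
    have hz' : ‖(0 : ℂ)‖ < 1 := by norm_num
    have hl := hasDerivAt_exp_series (summable_mul_exp_half hC) hz
    have hr1 := hasDerivAt_exp_series (summable_mul_exp_half hD) hz
    have hr0 := hasDerivAt_exp_series hD' hz'
    have he : HasDerivAt (fun t : ℂ => cexp (e * t ^ 2)) 0 0 := by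
      have := (((hasDerivAt_id (0 : ℂ)).pow 2).const_mul e).cexp
      simpa using this
    have he2 : HasDerivAt (fun t : ℂ => cexp (e * t ^ 2) * (e * (2 * t))) (2 * e) 0 := by
      have := he.mul (((hasDerivAt_id (0 : ℂ)).const_mul 2).const_mul e)
      exact this.congr_deriv (by simp [mul_comm])
    have hrr := (he2.mul hr0).add (he.mul hr1)
    have hev : (fun z : ℂ => ∑' i, C i * a i * cexp (z * a i)) =ᶠ[𝓝 0] fun z =>
        cexp (e * z ^ 2) * (e * (2 * z)) * ∑' i, D i * cexp (z * b i) +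
        cexp (e * z ^ 2) * ∑' i, D i * b i * cexp (z * b i) := by
      filter_upwards [Metric.ball_mem_nhds (0 : ℂ) one_pos] with z hz
      exact h1 z (mem_ball_zero_iff.1 hz)
    have := (hl.congr_of_eventuallyEq hev.symm).unique hrr
    rw [this]
    simp
  refine ⟨by simpa using h 0, by simpa using h1 0 (by simp), ?_⟩
  have : ∑' i, C i * a i * a i = 2 * e * ∑' i, D i + ∑' i, D i * b i * b i := by simpa using h2
  simp_rw [sq, ← mul_assoc]
  rw [this, add_comm]

end ExpSeries

/-! ### Theta series with characteristics and their inversion -/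

section Theta

variable {Λ : Type*} [AddCommGroup Λ] [Module.Free ℤ Λ] [Module.Finite ℤ Λ]
  {B : LinearMap.BilinForm ℤ Λ} {ι₁ ι₂ : Type*} [Fintype ι₁] [Fintype ι₂]
  {φ : Λ →+ (ι₁ ⊕ ι₂ → ℝ)}

/-- The signs of the standard form of signature `(ι₁, ι₂)`. -/
def sgn : ι₁ ⊕ ι₂ → ℝ := Sum.elim (fun _ => 1) fun _ => -1

/-- The standard form of signature `(ι₁, ι₂)`. -/
def stdForm (x y : ι₁ ⊕ ι₂ → ℝ) : ℝ := ∑ i, sgn i * x i * y i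

/-- The linear form on the positive definite part with coefficients `A`. -/
def linForm (A : ι₁ → ℝ) (x : ι₁ ⊕ ι₂ → ℝ) : ℝ := ∑ i, A i * x (Sum.inl i)

/-- The exponential factor of the term of `x` in the Siegel theta series with characteristics
`m`, `n`. -/
def thetaExp (τ : ℂ) (m n x : ι₁ ⊕ ι₂ → ℝ) : ℂ :=
  expi (τ * ((∑ i, (x + n) (Sum.inl i) ^ 2) / 2 : ℝ)
    + (starRingEnd ℂ) τ * (-(∑ i, (x + n) (Sum.inr i) ^ 2) / 2 : ℝ)
    - (stdForm (x + (1 / 2 : ℝ) • n) m : ℝ))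

/-- The coefficients of the Gaussian function `thetaExp`. -/
def thetaCoeff (τ : ℂ) : ι₁ ⊕ ι₂ → ℂ := Sum.elim (fun _ => -I * τ) fun _ => I * (starRingEnd ℂ) τ

omit [Fintype ι₁] [Fintype ι₂] in
lemma thetaCoeff_re {τ : ℂ} (hτ : 0 < τ.im) (i : ι₁ ⊕ ι₂) : 0 < (thetaCoeff τ i).re := by
  rcases i with i | i <;> simpa [thetaCoeff] using hτ

-- Poisson summation replaces the coefficients of a Gaussian by their inverses; this identity
-- recognises the result as `τ ↦ -1 / τ`, for both signs at once.
omit [Fintype ι₁] [Fintype ι₂] in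
lemma thetaCoeff_inv (τ : ℂ) (i : ι₁ ⊕ ι₂) :
    thetaCoeff (-1 / τ) i = 1 / thetaCoeff τ i := by
  rcases i with i | i
  · simp only [thetaCoeff, Sum.elim_inl]
    rw [one_div, mul_inv, inv_neg, inv_I]
    ring
  · simp only [thetaCoeff, Sum.elim_inr, map_div₀, map_neg, map_one]
    rw [one_div, mul_inv, inv_I]
    ring

/-- The factor `cexp (t * linForm A (x + n))` is a generating function: its Taylor coefficients in
`t` put powers of the linear form in front of the exponential. -/
lemma thetaExp_mul_exp (A : ι₁ → ℝ) (τ t : ℂ) (m n x : ι₁ ⊕ ι₂ → ℝ) :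
    thetaExp τ m n x * cexp (t * linForm A (x + n)) =
      cexp (∑ i, (-Real.pi * thetaCoeff τ i * ((x i + n i : ℝ) : ℂ) ^ 2
        + t * (Sum.elim A (fun _ => 0) i : ℝ) * (x i + n i : ℝ)
        - 2 * Real.pi * I * sgn i * (x i + n i / 2 : ℝ) * m i)) := by
  rw [thetaExp, expi, ← Complex.exp_add]
  congr 1
  simp only [Fintype.sum_sum_type, stdForm, linForm, thetaCoeff, sgn, Sum.elim_inl, Sum.elim_inr,
    Pi.add_apply, Pi.smul_apply, smul_eq_mul]
  push_cast
  trans (∑ i, (2 * Real.pi * I * (τ * (((x (Sum.inl i) : ℂ) + n (Sum.inl i)) ^ 2 / 2) -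
        1 * (x (Sum.inl i) + 1 / 2 * n (Sum.inl i)) * m (Sum.inl i)) +
        t * (A i * (x (Sum.inl i) + n (Sum.inl i))))) +
      ∑ i, (2 * Real.pi * I * ((starRingEnd ℂ) τ * (-((x (Sum.inr i) : ℂ) + n (Sum.inr i)) ^ 2 / 2) -
        -1 * (x (Sum.inr i) + 1 / 2 * n (Sum.inr i)) * m (Sum.inr i)))
  · simp only [Finset.sum_add_distrib, Finset.sum_sub_distrib, ← Finset.mul_sum, ← Finset.sum_div,
      Finset.sum_neg_distrib]
    ring
  · congr 1 <;> refine Finset.sum_congr rfl fun i _ => ?_ <;> ring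

/-- The coefficients of the linear part in `thetaExp_mul_exp`. -/
def thetaLin (A : ι₁ → ℝ) (τ t : ℂ) (m n : ι₁ ⊕ ι₂ → ℝ) (i : ι₁ ⊕ ι₂) : ℂ :=
  t * (Sum.elim A (fun _ => 0) i : ℝ) - 2 * Real.pi * I * sgn i * m i
    - 2 * Real.pi * thetaCoeff τ i * n i

/-- The constant part in `thetaExp_mul_exp`. -/
def thetaConst (A : ι₁ → ℝ) (τ t : ℂ) (m n : ι₁ ⊕ ι₂ → ℝ) : ℂ :=
  cexp (∑ i, (-Real.pi * thetaCoeff τ i * (n i : ℂ) ^ 2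
    + t * (Sum.elim A (fun _ => 0) i : ℝ) * n i - Real.pi * I * sgn i * n i * m i))

lemma thetaExp_mul_exp_eq_gauss (A : ι₁ → ℝ) (τ t : ℂ) (m n x : ι₁ ⊕ ι₂ → ℝ) :
    thetaExp τ m n x * cexp (t * linForm A (x + n)) =
      thetaConst A τ t m n * gauss (thetaCoeff τ) (thetaLin A τ t m n) x := by
  rw [thetaExp_mul_exp, thetaConst, gauss, ← Complex.exp_add, ← Finset.sum_add_distrib]
  congr 1
  refine Finset.sum_congr rfl fun i _ => ?_
  rw [thetaLin]
  push_cast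
  ring

/-- Completing the square exchanges the characteristics `(m, n)` for `(-n, m)` and divides `t` by
`τ`. The square of the `t`-part leaves a Gaussian in `t`, the source of the extra term in the second
moment. -/
lemma thetaExp_dual (A : ι₁ → ℝ) {τ : ℂ} (hτ : 0 < τ.im) (t : ℂ) (m n x : ι₁ ⊕ ι₂ → ℝ) :
    thetaConst A τ t m n * cexp (∑ i, (thetaLin A τ t m n i -
        2 * Real.pi * I * (sgn i * x i : ℝ)) ^ 2 / (4 * Real.pi * thetaCoeff τ i)) =
      cexp (I * ((∑ i, A i ^ 2 : ℝ) : ℂ) / (4 * Real.pi * τ) * t ^ 2) *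
        (thetaExp (-1 / τ) (-n) m x * cexp (t * (linForm A (x + m) / τ))) := by
  rw [show t * ((linForm A (x + m) : ℂ) / τ) = t / τ * linForm A (x + m) by ring,
    thetaExp_mul_exp, thetaConst, ← Complex.exp_add, ← Complex.exp_add]
  have hτ0 : τ ≠ 0 := fun h => by simp [h] at hτ
  have hπ : (Real.pi : ℂ) ≠ 0 := by exact_mod_cast Real.pi_ne_zero
  have hA : I * ((∑ i, A i ^ 2 : ℝ) : ℂ) / (4 * Real.pi * τ) * t ^ 2 =
      ∑ i : ι₁ ⊕ ι₂, (t ^ 2 * (Sum.elim A (fun _ => 0) i : ℝ) ^ 2 / (4 * Real.pi) *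
        (1 / thetaCoeff τ i)) := by
    simp only [Fintype.sum_sum_type, thetaCoeff, Sum.elim_inl, Sum.elim_inr]
    push_cast
    rw [Finset.mul_sum, Finset.sum_div, Finset.sum_mul]
    simp only [ne_eq, OfNat.ofNat_ne_zero, not_false_eq_true, zero_pow, mul_zero, zero_div,
      zero_mul, Finset.sum_const_zero, add_zero]
    refine Finset.sum_congr rfl fun i _ => ?_
    field_simp
    linear_combination (t ^ 2 * (A i : ℂ) ^ 2) * I_sq
  rw [hA, ← Finset.sum_add_distrib, ← Finset.sum_add_distrib]
  congr 1
  refine Finset.sum_congr rfl fun i _ => ?_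
  have hb := ne_zero_of_re_pos (thetaCoeff_re hτ i)
  have hs : (sgn i : ℂ) ^ 2 = 1 := by
    rcases i with i | i <;> simp [sgn]
  -- The formula is uniform in the sign because `A` is extended by zero to the negative part, and on
  -- the positive part `1 / thetaCoeff τ i` is `I / τ`.
  have hd : t / τ * (Sum.elim A (fun _ => 0) i : ℝ) =
      -I * t * (Sum.elim A (fun _ => 0) i : ℝ) * sgn i * (1 / thetaCoeff τ i) := by
    rcases i with i | i
    · simp only [thetaCoeff, sgn, Sum.elim_inl]
      push_cast
      field_simp
    · simp
  rw [hd, thetaCoeff_inv, thetaLin]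
  simp only [Pi.neg_apply]
  push_cast
  generalize (sgn i : ℂ) = σ at *
  generalize thetaCoeff τ i = β at *
  field_simp
  linear_combination (4 * Real.pi ^ 2 * ((x i : ℂ) + m i) ^ 2 * σ ^ 2) * I_sq -
    (4 * Real.pi ^ 2 * ((x i : ℂ) + m i) ^ 2) * hs

lemma norm_expi (τ : ℂ) (a b c : ℝ) :
    ‖expi (τ * a + (starRingEnd ℂ) τ * b - c)‖ = Real.exp (-(2 * Real.pi * τ.im * (a - b))) := by
  rw [expi, Complex.norm_exp]
  congr 1
  simp [Complex.mul_re, Complex.mul_im]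
  ring

lemma norm_thetaExp (τ : ℂ) (m n x : ι₁ ⊕ ι₂ → ℝ) :
    ‖thetaExp τ m n x‖ = Real.exp (-(Real.pi * τ.im) * ∑ i, (x i + n i) ^ 2) := by
  rw [thetaExp, norm_expi]
  congr 1
  simp only [Fintype.sum_sum_type, Pi.add_apply]
  ring

/-- `exp |ℓ| ≤ exp ℓ + exp (-ℓ)`, and a Gaussian times the exponential of a linear form is again a
Gaussian of the kind already summed. -/
lemma summable_gaussian_mul_exp (h : IsFrame B sgn φ) {ε : ℝ} (hε : 0 < ε) (A : ι₁ → ℝ)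
    (n : ι₁ ⊕ ι₂ → ℝ) :
    Summable fun x : Λ => Real.exp (-ε * ∑ i, (φ x i + n i) ^ 2) *
      Real.exp |linForm A (φ x + n)| := by
  have key : ∀ s : ℝ, Summable fun x : Λ => Real.exp (-ε * ∑ i, (φ x i + n i) ^ 2) *
      Real.exp (s * linForm A (φ x + n)) := by
    intro s
    have hb : ∀ i : ι₁ ⊕ ι₂, 0 < ((fun _ => ((ε / Real.pi : ℝ) : ℂ)) i : ℂ).re := fun i => by
      rw [Complex.ofReal_re]
      have := Real.pi_pos
      positivity
    let a : ι₁ ⊕ ι₂ → ℝ := Sum.elim A fun _ => 0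
    have hs := (summable_gauss_frame h hb (fun i => ((-2 * ε * n i + s * a i : ℝ) : ℂ))).norm.mul_left
      (Real.exp (∑ i, (-ε * n i ^ 2 + s * a i * n i)))
    refine hs.congr fun x => ?_
    rw [gauss, Complex.norm_exp, ← Real.exp_add, ← Real.exp_add]
    congr 1
    have h1 : (∑ i, (-(Real.pi : ℂ) * ((ε / Real.pi : ℝ) : ℂ) * ((φ x i : ℝ) : ℂ) ^ 2 +
        ((-2 * ε * n i + s * a i : ℝ) : ℂ) * ((φ x i : ℝ) : ℂ))).re =
        ∑ i, (-ε * φ x i ^ 2 + (-2 * ε * n i + s * a i) * φ x i) := by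
      rw [← Complex.ofReal_re (∑ i, (-ε * φ x i ^ 2 + (-2 * ε * n i + s * a i) * φ x i))]
      congr 1
      push_cast
      refine Finset.sum_congr rfl fun i _ => ?_
      have hπ : (Real.pi : ℂ) ≠ 0 := by exact_mod_cast Real.pi_ne_zero
      field_simp
    have h2 : linForm A (φ x + n) = ∑ i, a i * (φ x i + n i) := by
      simp [linForm, a, Fintype.sum_sum_type]
    rw [h1, h2, Finset.mul_sum, Finset.mul_sum, ← Finset.sum_add_distrib, ← Finset.sum_add_distrib]
    exact Finset.sum_congr rfl fun i _ => by ring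
  refine Summable.of_nonneg_of_le (fun x => by positivity) (fun x => ?_) ((key 1).add (key (-1)))
  rw [← mul_add]
  refine mul_le_mul_of_nonneg_left ?_ (Real.exp_pos _).le
  rcases abs_choice (linForm A (φ x + n)) with h | h <;> rw [h]
  · rw [one_mul]
    linarith [Real.exp_pos (-1 * linForm A (φ x + n))]
  · rw [neg_one_mul]
    linarith [Real.exp_pos (1 * linForm A (φ x + n))]

lemma summable_thetaExp_mul_exp (h : IsFrame B sgn φ) {τ : ℂ} (hτ : 0 < τ.im) (A : ι₁ → ℝ)
    (m n : ι₁ ⊕ ι₂ → ℝ) :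
    Summable fun x : Λ => ‖thetaExp τ m n (φ x)‖ * Real.exp |linForm A (φ x + n)| := by
  simp_rw [norm_thetaExp]
  exact summable_gaussian_mul_exp h (mul_pos Real.pi_pos hτ) A n

omit [Fintype ι₂] in
lemma linForm_smul (r : ℝ) (A : ι₁ → ℝ) (x : ι₁ ⊕ ι₂ → ℝ) :
    linForm (r • A) x = r * linForm A x := by
  simp [linForm, Finset.mul_sum, mul_assoc]

omit [Fintype ι₂] in
lemma linForm_add (A A' : ι₁ → ℝ) (x : ι₁ ⊕ ι₂ → ℝ) :
    linForm (A + A') x = linForm A x + linForm A' x := by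
  simp [linForm, Finset.sum_add_distrib, add_mul]

/-- The factor of automorphy of the theta series under `τ ↦ -1 / τ`. -/
def thetaFactor (ι₁ ι₂ : Type*) [Fintype ι₁] [Fintype ι₂] (τ : ℂ) : ℂ :=
  ∏ i : ι₁ ⊕ ι₂, (1 / thetaCoeff τ i) ^ (1 / 2 : ℂ)

lemma neg_one_div_im_pos {τ : ℂ} (hτ : 0 < τ.im) : 0 < (-1 / τ).im := by
  have := UpperHalfPlane.im_inv_neg_coe_pos ⟨τ, hτ⟩
  rwa [show -1 / τ = (-τ)⁻¹ by rw [inv_neg, neg_div, one_div]]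

/-- The inversion formula for the theta series, with its moments of order at most two in the
direction of a linear form. -/
theorem theta_inversion (h : IsFrame B sgn φ) {τ : ℂ} (hτ : 0 < τ.im) (A : ι₁ → ℝ)
    (m n : ι₁ ⊕ ι₂ → ℝ) :
    (∑' x : Λ, thetaExp τ m n (φ x) =
      thetaFactor ι₁ ι₂ τ * ∑' x : Λ, thetaExp (-1 / τ) (-n) m (φ x)) ∧
    (∑' x : Λ, thetaExp τ m n (φ x) * linForm A (φ x + n) =
      thetaFactor ι₁ ι₂ τ * τ⁻¹ *
        ∑' x : Λ, thetaExp (-1 / τ) (-n) m (φ x) * linForm A (φ x + m)) ∧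
    ∑' x : Λ, thetaExp τ m n (φ x) * (linForm A (φ x + n) : ℂ) ^ 2 =
      thetaFactor ι₁ ι₂ τ * (τ⁻¹ ^ 2 *
        ∑' x : Λ, thetaExp (-1 / τ) (-n) m (φ x) * (linForm A (φ x + m) : ℂ) ^ 2 +
        I * ((∑ i, A i ^ 2 : ℝ) : ℂ) / (2 * Real.pi * τ) *
          ∑' x : Λ, thetaExp (-1 / τ) (-n) m (φ x)) := by
  have hτ' := neg_one_div_im_pos hτ
  have hτ0 : τ ≠ 0 := fun h => by simp [h] at hτ
  have hC : Summable fun x : Λ => ‖thetaExp τ m n (φ x)‖ *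
      Real.exp ‖(linForm A (φ x + n) : ℂ)‖ := by
    simpa using summable_thetaExp_mul_exp h hτ A m n
  -- The exponent `ℓ / τ` is complex, but its norm is that of the real linear form with coefficients
  -- `‖τ‖⁻¹ • A`.
  have hD : Summable fun x : Λ => ‖thetaFactor ι₁ ι₂ τ * thetaExp (-1 / τ) (-n) m (φ x)‖ *
      Real.exp ‖(linForm A (φ x + m) : ℂ) / τ‖ := by
    refine ((summable_thetaExp_mul_exp h hτ' (‖τ‖⁻¹ • A) (-n) m).mul_left
      ‖thetaFactor ι₁ ι₂ τ‖).congr fun x => ?_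
    rw [linForm_smul, abs_mul, abs_inv, abs_norm, norm_mul, norm_div, Complex.norm_real,
      Real.norm_eq_abs, mul_assoc, inv_mul_eq_div]
  have hcmp := exp_series_compare (e := I * ((∑ i, A i ^ 2 : ℝ) : ℂ) / (4 * Real.pi * τ)) hC hD
    (fun t => by
      simp_rw [thetaExp_mul_exp_eq_gauss]
      rw [tsum_mul_left, tsum_gauss_frame h (thetaCoeff_re hτ), mul_left_comm, ← tsum_mul_left]
      simp_rw [thetaExp_dual A hτ]
      rw [tsum_mul_left, ← thetaFactor, mul_left_comm, ← tsum_mul_left]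
      simp_rw [mul_assoc])
  obtain ⟨h0, h1, h2⟩ := hcmp
  refine ⟨by rw [h0, tsum_mul_left], ?_, ?_⟩
  · rw [h1, ← tsum_mul_left]
    exact tsum_congr fun x => by ring
  · have e1 : ∑' x : Λ, thetaFactor ι₁ ι₂ τ * thetaExp (-1 / τ) (-n) m (φ x) *
        ((linForm A (φ x + m) : ℂ) / τ) ^ 2 = thetaFactor ι₁ ι₂ τ * (τ⁻¹ ^ 2 *
        ∑' x : Λ, thetaExp (-1 / τ) (-n) m (φ x) * (linForm A (φ x + m) : ℂ) ^ 2) := by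
      rw [← tsum_mul_left, ← tsum_mul_left]
      exact tsum_congr fun x => by ring
    rw [h2, e1, tsum_mul_left]
    ring

end Theta

/-! ### Quadratic polynomial weights and the inversion of their theta series -/

/-- The data entering the polynomials `P_{w,h⁺,0}` on the positive definite space: two linear forms
and the values of the two coordinates at `u_{z^⊥}`, of norm `s`. -/
structure PolyData (ι₁ : Type*) where
  A : ι₁ → ℝ
  A' : ι₁ → ℝ
  c : ℝ
  c' : ℝ
  s : ℝ

section Core

variable {Λ : Type*} [AddCommGroup Λ] [Module.Free ℤ Λ] [Module.Finite ℤ Λ]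
  {B : LinearMap.BilinForm ℤ Λ} {ι₁ ι₂ : Type*} [Fintype ι₁] [Fintype ι₂]
  {φ : Λ →+ (ι₁ ⊕ ι₂ → ℝ)}

/-- The value at `x` of `exp (-Δ / 8πy) (P_{w,h,0})`. -/
def PolyData.val (D : PolyData ι₁) (h : ℕ) (y : ℝ) (x : ι₁ ⊕ ι₂ → ℝ) : ℝ :=
  match h with
  | 0 => 2 * (linForm D.A x * linForm D.A' x - (∑ i, D.A i * D.A' i) / (4 * Real.pi * y))
  | 1 => 2 / D.s * (D.c' * linForm D.A x + D.c * linForm D.A' x)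
  | 2 => 2 * D.c * D.c' / D.s ^ 2
  | _ => 0

/-- The theta series with the polynomial `P_{w,h,0}` of a lattice in a standard quadratic space. -/
def PolyData.theta (D : PolyData ι₁) (φ : Λ →+ (ι₁ ⊕ ι₂ → ℝ)) (h : ℕ) (τ : ℂ)
    (m n : ι₁ ⊕ ι₂ → ℝ) : ℂ :=
  ∑' x : Λ, thetaExp τ m n (φ x) * (D.val h τ.im (φ x + n) : ℝ)

lemma summable_thetaExp (h : IsFrame B sgn φ) {τ : ℂ} (hτ : 0 < τ.im) (m n : ι₁ ⊕ ι₂ → ℝ) :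
    Summable fun x : Λ => thetaExp τ m n (φ x) := by
  refine Summable.of_norm ?_
  simpa [linForm] using summable_thetaExp_mul_exp h hτ (0 : ι₁ → ℝ) m n

lemma summable_thetaExp_mul_sq (h : IsFrame B sgn φ) {τ : ℂ} (hτ : 0 < τ.im) (A : ι₁ → ℝ)
    (m n : ι₁ ⊕ ι₂ → ℝ) :
    Summable fun x : Λ => thetaExp τ m n (φ x) * (linForm A (φ x + n) : ℂ) ^ 2 := by
  refine Summable.of_norm_bounded ((summable_thetaExp_mul_exp h hτ A m n).mul_left 2) fun x => ?_
  rw [norm_mul, norm_pow, Complex.norm_real, Real.norm_eq_abs]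
  have := Real.quadratic_le_exp_of_nonneg (abs_nonneg (linForm A (φ x + n)))
  have h1 := abs_nonneg (linForm A (φ x + n))
  rw [mul_left_comm]
  exact mul_le_mul_of_nonneg_left (by linarith) (norm_nonneg _)

lemma summable_thetaExp_mul_linForm (h : IsFrame B sgn φ) {τ : ℂ} (hτ : 0 < τ.im) (A : ι₁ → ℝ)
    (m n : ι₁ ⊕ ι₂ → ℝ) :
    Summable fun x : Λ => thetaExp τ m n (φ x) * (linForm A (φ x + n) : ℂ) := by
  refine Summable.of_norm_bounded (summable_thetaExp_mul_exp h hτ A m n) fun x => ?_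
  rw [norm_mul, Complex.norm_real, Real.norm_eq_abs]
  have := Real.add_one_le_exp |linForm A (φ x + n)|
  exact mul_le_mul_of_nonneg_left (by linarith) (norm_nonneg _)

-- Polarization reduces products of two linear forms to squares, for which the inversion formula is
-- available.
omit [Fintype ι₂] in
lemma linForm_mul_linForm (A A' : ι₁ → ℝ) (x : ι₁ ⊕ ι₂ → ℝ) :
    (linForm A x : ℂ) * linForm A' x =
      ((linForm (A + A') x : ℂ) ^ 2 - (linForm A x : ℂ) ^ 2 - (linForm A' x : ℂ) ^ 2) / 2 := by
  rw [linForm_add]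
  push_cast
  ring

lemma summable_thetaExp_mul_mul (h : IsFrame B sgn φ) {τ : ℂ} (hτ : 0 < τ.im) (A A' : ι₁ → ℝ)
    (m n : ι₁ ⊕ ι₂ → ℝ) :
    Summable fun x : Λ =>
      thetaExp τ m n (φ x) * ((linForm A (φ x + n) : ℂ) * linForm A' (φ x + n)) := by
  refine ((((summable_thetaExp_mul_sq h hτ (A + A') m n).sub
    (summable_thetaExp_mul_sq h hτ A m n)).sub
    (summable_thetaExp_mul_sq h hτ A' m n)).mul_right (1 / 2)).congr fun x => ?_
  rw [linForm_mul_linForm]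
  ring

lemma tsum_thetaExp_mul_mul (h : IsFrame B sgn φ) {τ : ℂ} (hτ : 0 < τ.im) (A A' : ι₁ → ℝ)
    (m n : ι₁ ⊕ ι₂ → ℝ) :
    ∑' x : Λ, thetaExp τ m n (φ x) * ((linForm A (φ x + n) : ℂ) * linForm A' (φ x + n)) =
      (∑' x : Λ, thetaExp τ m n (φ x) * (linForm (A + A') (φ x + n) : ℂ) ^ 2 -
        ∑' x : Λ, thetaExp τ m n (φ x) * (linForm A (φ x + n) : ℂ) ^ 2 -
        ∑' x : Λ, thetaExp τ m n (φ x) * (linForm A' (φ x + n) : ℂ) ^ 2) / 2 := by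
  rw [← (summable_thetaExp_mul_sq h hτ (A + A') m n).tsum_sub
    (summable_thetaExp_mul_sq h hτ A m n), ← ((summable_thetaExp_mul_sq h hτ (A + A') m n).sub
    (summable_thetaExp_mul_sq h hτ A m n)).tsum_sub (summable_thetaExp_mul_sq h hτ A' m n),
    ← tsum_div_const]
  refine tsum_congr fun x => ?_
  rw [linForm_mul_linForm]
  ring

lemma PolyData.summable_theta (D : PolyData ι₁) (h : IsFrame B sgn φ) {τ : ℂ} (hτ : 0 < τ.im)
    (k : ℕ) (m n : ι₁ ⊕ ι₂ → ℝ) :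
    Summable fun x : Λ => thetaExp τ m n (φ x) * (D.val k τ.im (φ x + n) : ℝ) := by
  match k with
  | 0 =>
    refine (((summable_thetaExp_mul_mul h hτ D.A D.A' m n).sub ((summable_thetaExp h hτ m n).mul_left
      (((∑ i, D.A i * D.A' i) / (4 * Real.pi * τ.im) : ℝ) : ℂ))).mul_left 2).congr fun x => ?_
    simp only [PolyData.val]
    push_cast
    ring
  | 1 =>
    refine (((summable_thetaExp_mul_linForm h hτ D.A m n).mul_left ((2 / D.s * D.c' : ℝ) : ℂ)).add
      ((summable_thetaExp_mul_linForm h hτ D.A' m n).mul_left ((2 / D.s * D.c : ℝ) : ℂ))).congr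
      fun x => ?_
    simp only [PolyData.val]
    push_cast
    ring
  | 2 =>
    refine ((summable_thetaExp h hτ m n).mul_right
      ((2 * D.c * D.c' / D.s ^ 2 : ℝ) : ℂ)).congr fun x => ?_
    simp only [PolyData.val]
  | (k + 3) =>
    simp only [PolyData.val, Complex.ofReal_zero, mul_zero]
    exact summable_zero

lemma PolyData.theta_zero (D : PolyData ι₁) (h : IsFrame B sgn φ) {τ : ℂ} (hτ : 0 < τ.im)
    (m n : ι₁ ⊕ ι₂ → ℝ) :
    D.theta φ 0 τ m n = 2 * (∑' x : Λ, thetaExp τ m n (φ x) *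
      ((linForm D.A (φ x + n) : ℂ) * linForm D.A' (φ x + n)) -
      (((∑ i, D.A i * D.A' i) / (4 * Real.pi * τ.im) : ℝ) : ℂ) *
        ∑' x : Λ, thetaExp τ m n (φ x)) := by
  rw [PolyData.theta, ← tsum_mul_left (a := (((∑ i, D.A i * D.A' i) / (4 * Real.pi * τ.im) : ℝ) : ℂ)),
    ← (summable_thetaExp_mul_mul h hτ D.A D.A' m n).tsum_sub
      ((summable_thetaExp h hτ m n).mul_left _), ← tsum_mul_left]
  refine tsum_congr fun x => ?_
  simp only [PolyData.val]
  push_cast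
  ring

lemma PolyData.theta_one (D : PolyData ι₁) (h : IsFrame B sgn φ) {τ : ℂ} (hτ : 0 < τ.im)
    (m n : ι₁ ⊕ ι₂ → ℝ) :
    D.theta φ 1 τ m n = 2 / D.s * (D.c' * ∑' x : Λ, thetaExp τ m n (φ x) * linForm D.A (φ x + n) +
      D.c * ∑' x : Λ, thetaExp τ m n (φ x) * linForm D.A' (φ x + n)) := by
  rw [PolyData.theta, ← tsum_mul_left (a := (D.c' : ℂ)), ← tsum_mul_left (a := (D.c : ℂ)),
    ← ((summable_thetaExp_mul_linForm h hτ D.A m n).mul_left _).tsum_add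
      ((summable_thetaExp_mul_linForm h hτ D.A' m n).mul_left _), ← tsum_mul_left]
  refine tsum_congr fun x => ?_
  simp only [PolyData.val]
  push_cast
  ring

omit [Module.Free ℤ Λ] [Module.Finite ℤ Λ] in
lemma PolyData.theta_two (D : PolyData ι₁) (τ : ℂ) (m n : ι₁ ⊕ ι₂ → ℝ) :
    D.theta φ 2 τ m n =
      ((2 * D.c * D.c' / D.s ^ 2 : ℝ) : ℂ) * ∑' x : Λ, thetaExp τ m n (φ x) := by
  rw [PolyData.theta, ← tsum_mul_left]
  exact tsum_congr fun x => mul_comm _ _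

lemma im_neg_one_div (τ : ℂ) : (-1 / τ).im = τ.im / normSq τ := by
  rw [neg_div, one_div, Complex.neg_im, Complex.inv_im]
  ring

/-- The weight has degree `2 - k`, hence the power of `τ`. For `k = 0` the second moment produces
the extra term `I / (2πτ)`, and the subtracted constant repairs it: with `y = Im τ` and `Im (-1 / τ)
= y / |τ|²`, one has `I / (2πτ) - 1 / (4πy) = -τ⁻² |τ|² / (4πy)`. -/
theorem PolyData.theta_inversion (D : PolyData ι₁) (h : IsFrame B sgn φ) {τ : ℂ} (hτ : 0 < τ.im)
    (m n : ι₁ ⊕ ι₂ → ℝ) {k : ℕ} (hk : k < 3) :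
    D.theta φ k τ m n =
      thetaFactor ι₁ ι₂ τ * τ⁻¹ ^ (2 - k) * D.theta φ k (-1 / τ) (-n) m := by
  have hτ' := neg_one_div_im_pos hτ
  have hτ0 : τ ≠ 0 := fun h => by simp [h] at hτ
  have hA := KMUnfold.theta_inversion h hτ D.A m n
  have hA' := KMUnfold.theta_inversion h hτ D.A' m n
  have hAA := KMUnfold.theta_inversion h hτ (D.A + D.A') m n
  interval_cases k
  · rw [D.theta_zero h hτ, D.theta_zero h hτ', tsum_thetaExp_mul_mul h hτ,
      tsum_thetaExp_mul_mul h hτ', hA.2.2, hA'.2.2, hAA.2.2, hA.1, im_neg_one_div]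
    set T := ∑' x : Λ, thetaExp (-1 / τ) (-n) m (φ x)
    have hsum : ((∑ i, (D.A + D.A') i ^ 2 : ℝ) : ℂ) = ((∑ i, D.A i ^ 2 : ℝ) : ℂ) +
        ((∑ i, D.A' i ^ 2 : ℝ) : ℂ) + 2 * ((∑ i, D.A i * D.A' i : ℝ) : ℂ) := by
      norm_cast
      rw [Finset.mul_sum, ← Finset.sum_add_distrib, ← Finset.sum_add_distrib]
      exact Finset.sum_congr rfl fun i _ => by simp only [Pi.add_apply]; ring
    rw [hsum]
    generalize ∑' x : Λ, thetaExp (-1 / τ) (-n) m (φ x) * (linForm D.A (φ x + m) : ℂ) ^ 2 = t1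
    generalize ∑' x : Λ, thetaExp (-1 / τ) (-n) m (φ x) * (linForm D.A' (φ x + m) : ℂ) ^ 2 = t2
    generalize ∑' x : Λ, thetaExp (-1 / τ) (-n) m (φ x) * (linForm (D.A + D.A') (φ x + m) : ℂ) ^ 2
      = t3
    generalize ((∑ i, D.A i ^ 2 : ℝ) : ℂ) = a1
    generalize ((∑ i, D.A' i ^ 2 : ℝ) : ℂ) = a2
    have hy : (τ.im : ℂ) ≠ 0 := by exact_mod_cast hτ.ne'
    have hπ : (Real.pi : ℂ) ≠ 0 := by exact_mod_cast Real.pi_ne_zero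
    -- Replacing `τ̄` by `τ - 2iy` makes the claim a rational identity in `τ` and `y`.
    have hn : ((normSq τ : ℝ) : ℂ) = τ * (τ - 2 * τ.im * I) := by
      rw [← Complex.mul_conj]
      congr 1
      apply Complex.ext <;> simp
      ring
    have hn0 : ((normSq τ : ℝ) : ℂ) ≠ 0 := by
      exact_mod_cast (Complex.normSq_pos.2 hτ0).ne'
    rw [Complex.ofReal_div, Complex.ofReal_div (∑ i, D.A i * D.A' i)]
    generalize ((∑ i, D.A i * D.A' i : ℝ) : ℂ) = g
    push_cast
    rw [hn] at hn0 ⊢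
    have hτ1 := right_ne_zero_of_mul hn0
    field_simp
    ring
  · rw [D.theta_one h hτ, D.theta_one h hτ', hA.2.1, hA'.2.1]
    ring
  · rw [D.theta_two, D.theta_two, hA.1]
    ring

end Core

/-! ### The multiplier system: inversion, translation, triviality of the root of unity -/

section Factor

variable {Λ : Type*} [AddCommGroup Λ] [Module.Free ℤ Λ] [Module.Finite ℤ Λ]
  {B : LinearMap.BilinForm ℤ Λ} {ι₁ ι₂ : Type*} [Fintype ι₁] [Fintype ι₂]
  {φ : Λ →+ (ι₁ ⊕ ι₂ → ℝ)}

/-- Of the `2p + 1` square roots of `I / τ`, all but one pair up to `(I / τ)^p`. The last meets the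
square root of the conjugate from the negative direction and gives an absolute value. The principal
branch commutes with conjugation because `Re (I / τ) > 0`. -/
lemma thetaFactor_eq {p : ℕ} (h₁ : Fintype.card ι₁ = 2 * p + 1) (h₂ : Fintype.card ι₂ = 1) {τ : ℂ}
    (hτ : 0 < τ.im) : thetaFactor ι₁ ι₂ τ = (I / τ) ^ p * (‖τ‖⁻¹ : ℝ) := by
  have hw : 0 < (I / τ).re := by
    have := neg_one_div_im_pos hτ
    have h2 : I / τ = -(I * (-1 / τ)) := by ring
    rw [h2]
    simpa using this
  have hne := ne_zero_of_re_pos hw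
  have e1 : 1 / (-I * τ) = I / τ := by
    rw [one_div, mul_inv, inv_neg, inv_I, neg_neg, div_eq_mul_inv]
  have e2 : 1 / (I * (starRingEnd ℂ) τ) = (starRingEnd ℂ) (I / τ) := by
    rw [one_div, mul_inv, inv_I, map_div₀, conj_I, div_eq_mul_inv]
  have harg : (I / τ).arg ≠ Real.pi := by
    intro harg
    have := (Complex.arg_eq_pi_iff.1 harg).1
    linarith
  have hsq : ((I / τ) ^ (1 / 2 : ℂ)) ^ 2 = I / τ := by
    rw [← Complex.cpow_nat_mul]
    norm_num
  rw [thetaFactor, Fintype.prod_sum_type]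
  simp only [thetaCoeff, Sum.elim_inl, Sum.elim_inr, Finset.prod_const, Finset.card_univ, h₁, h₂]
  rw [e1, e2, pow_succ, pow_mul, hsq, pow_one, mul_assoc]
  congr 1
  have hc : (starRingEnd ℂ) (I / τ) ^ (1 / 2 : ℂ) = (starRingEnd ℂ) ((I / τ) ^ (1 / 2 : ℂ)) := by
    rw [Complex.conj_cpow _ _ harg, map_div₀, map_one, Complex.conj_ofNat]
  rw [hc, Complex.mul_conj, Complex.normSq_eq_norm_sq, ← norm_pow, hsq, norm_div, norm_I, one_div]

-- Translation multiplies by `e(q(x - cν))`, where `q(x - cν) = q(x) - c (x - cν/2, ν)`. Evenness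
-- makes `q(x)` an integer, and the remaining phase shifts the first characteristic from `d` to `c +
-- d`.
omit [Module.Free ℤ Λ] [Module.Finite ℤ Λ] in
lemma thetaExp_add_one (h : IsFrame B sgn φ) (heven : ∀ x, Even (B x x)) (τ : ℂ) (c d : ℤ)
    (ν : ι₁ ⊕ ι₂ → ℝ) (x : Λ) :
    thetaExp (τ + 1) ((d : ℝ) • ν) (-(c : ℝ) • ν) (φ x) =
      thetaExp τ (((c + d : ℤ) : ℝ) • ν) (-(c : ℝ) • ν) (φ x) := by
  obtain ⟨r, hr⟩ := heven x
  have hf := h.form x x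
  rw [hr] at hf
  have hexp : ∀ (y : ι₁ ⊕ ι₂ → ℝ), (∑ i, y (Sum.inl i) ^ 2) - ∑ i, y (Sum.inr i) ^ 2 =
      ∑ i, sgn i * y i * y i := by
    intro y
    simp [Fintype.sum_sum_type, sgn, sq, sub_eq_add_neg]
  have hq := hexp (φ x + -(c : ℝ) • ν)
  have h1 : ∑ i, sgn i * (φ x + -(c : ℝ) • ν) i * (φ x + -(c : ℝ) • ν) i =
      2 * r - 2 * c * stdForm (φ x + (1 / 2 : ℝ) • (-(c : ℝ) • ν)) ν := by
    have : (2 * r : ℝ) = ((r + r : ℤ) : ℝ) := by push_cast; ring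
    rw [this, hf, stdForm, Finset.mul_sum, ← Finset.sum_sub_distrib]
    refine Finset.sum_congr rfl fun i _ => ?_
    simp only [Pi.add_apply, Pi.smul_apply, smul_eq_mul]
    ring
  have h2 : ∀ t : ℝ, stdForm (φ x + (1 / 2 : ℝ) • (-(c : ℝ) • ν)) (t • ν) =
      t * stdForm (φ x + (1 / 2 : ℝ) • (-(c : ℝ) • ν)) ν := by
    intro t
    rw [stdForm, stdForm, Finset.mul_sum]
    refine Finset.sum_congr rfl fun i _ => ?_
    simp only [Pi.smul_apply, smul_eq_mul]
    ring
  rw [thetaExp, thetaExp, h2, h2, expi, expi, Complex.exp_eq_exp_iff_exists_int]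
  refine ⟨r, ?_⟩
  rw [h1] at hq
  generalize stdForm (φ x + (1 / 2 : ℝ) • (-(c : ℝ) • ν)) ν = S at *
  have hq' := congrArg (fun t : ℝ => (t : ℂ)) hq
  rw [map_add, map_one]
  push_cast at hq' ⊢
  linear_combination (Real.pi * I) * hq'

omit [Module.Free ℤ Λ] [Module.Finite ℤ Λ] in
lemma PolyData.theta_add_one (D : PolyData ι₁) (h : IsFrame B sgn φ) (heven : ∀ x, Even (B x x))
    (k : ℕ) (τ : ℂ) (c d : ℤ) (ν : ι₁ ⊕ ι₂ → ℝ) :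
    D.theta φ k (τ + 1) ((d : ℝ) • ν) (-(c : ℝ) • ν) =
      D.theta φ k τ (((c + d : ℤ) : ℝ) • ν) (-(c : ℝ) • ν) := by
  simp only [PolyData.theta, thetaExp_add_one h heven]
  simp

/-- The signature of an even unimodular lattice is divisible by `8`, in the Lorentzian case. -/
theorem I_pow_eq_one (h : IsFrame B sgn φ) (heven : ∀ x, Even (B x x)) {p : ℕ}
    (h₁ : Fintype.card ι₁ = 2 * p + 1) (h₂ : Fintype.card ι₂ = 1) : I ^ p = 1 := by
  let θ : ℂ → ℂ := fun τ => ∑' x : Λ, thetaExp τ 0 0 (φ x)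
  have hT : ∀ τ, θ (τ + 1) = θ τ := by
    intro τ
    refine tsum_congr fun x => ?_
    simpa using thetaExp_add_one h heven τ 0 0 0 x
  have hS : ∀ τ : ℂ, 0 < τ.im → θ τ = (I / τ) ^ p * (‖τ‖⁻¹ : ℝ) * θ (-1 / τ) := by
    intro τ hτ
    have := (KMUnfold.theta_inversion h hτ (0 : ι₁ → ℝ) 0 0).1
    rw [thetaFactor_eq h₁ h₂ hτ] at this
    simpa using this
  -- At `τ = I` both definite parts enter with the same sign, so the series is a sum of positive
  -- reals.
  have hI : θ I ≠ 0 := by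
    have hterm : ∀ x : Λ, thetaExp I 0 0 (φ x) =
        ((Real.exp (-Real.pi * ∑ i, φ x i ^ 2) : ℝ) : ℂ) := by
      intro x
      rw [thetaExp, expi]
      push_cast
      congr 1
      simp only [Fintype.sum_sum_type, stdForm, add_zero, conj_I, Pi.zero_apply, mul_zero,
        Finset.sum_const_zero]
      push_cast
      linear_combination (Real.pi * ∑ i, (φ x (Sum.inl i) : ℂ) ^ 2 +
        Real.pi * ∑ i, (φ x (Sum.inr i) : ℂ) ^ 2) * I_sq
    have hs : Summable fun x : Λ => Real.exp (-Real.pi * ∑ i, φ x i ^ 2) :=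
      summable_exp_neg_frame h Real.pi_pos
    have hpos := hs.tsum_pos (fun x => (Real.exp_pos _).le) 0 (Real.exp_pos _)
    change ∑' x : Λ, thetaExp I 0 0 (φ x) ≠ 0
    simp_rw [hterm]
    rw [← Complex.ofReal_tsum]
    exact_mod_cast hpos.ne'
  -- The map `τ ↦ -1 / (τ + 1)` has order three. Going once around the orbit of `I` returns `θ I`
  -- multiplied by the product of the three multipliers, which is `I ^ p`.
  have step : ∀ τ : ℂ, 0 < τ.im →
      θ τ = (I / (τ + 1)) ^ p * (‖τ + 1‖⁻¹ : ℝ) * θ (-1 / (τ + 1)) := by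
    intro τ hτ
    rw [← hT τ]
    exact hS (τ + 1) (by simpa using hτ)
  have hne : (I + 1 : ℂ) ≠ 0 := fun h => by
    have := congrArg Complex.re h
    simp at this
  have a0 : (0 : ℝ) < (I : ℂ).im := by simp
  have e1 : -1 / (I + 1) + 1 = I / (I + 1) := by
    field_simp
    ring
  have a1 : 0 < (-1 / (I + 1)).im := neg_one_div_im_pos (by simp)
  have e2 : -1 / (-1 / (I + 1) + 1) = -(I + 1) / I := by
    rw [e1]
    field_simp
  have e3 : -(I + 1) / I + 1 = -1 / I := by
    field_simp
    ring
  have a2 : 0 < (-(I + 1) / I).im := by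
    rw [← e2]
    exact neg_one_div_im_pos (by simpa using a1)
  have e4 : -1 / (-(I + 1) / I + 1) = I := by
    rw [e3]
    field_simp
  have s0 := step I a0
  have s1 := step _ a1
  have s2 := step _ a2
  rw [e2] at s1
  rw [e4] at s2
  rw [e1] at s1
  rw [e3] at s2
  rw [s2] at s1
  rw [s1] at s0
  have hprod : ((I / (I + 1)) * (I / (I / (I + 1))) * (I / (-1 / I))) = I := by
    field_simp
    simp
  have hnorm : ‖(I + 1 : ℂ)‖⁻¹ * ‖I / (I + 1)‖⁻¹ * ‖-1 / I‖⁻¹ = 1 := by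
    have : ‖(I + 1 : ℂ)‖ ≠ 0 := norm_ne_zero_iff.2 hne
    simp only [norm_div, norm_neg, norm_one, norm_I]
    field_simp
  have hfin : θ I = I ^ p * θ I := by
    calc θ I = ((I / (I + 1)) * (I / (I / (I + 1))) * (I / (-1 / I))) ^ p *
        ((‖(I + 1 : ℂ)‖⁻¹ * ‖I / (I + 1)‖⁻¹ * ‖-1 / I‖⁻¹ : ℝ) : ℂ) * θ I := by
          rw [mul_pow, mul_pow]
          push_cast
          push_cast at s0
          linear_combination s0
      _ = I ^ p * θ I := by
          rw [hprod, hnorm]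
          simp
  exact (mul_right_cancel₀ hI (hfin.symm.trans (one_mul _).symm))

end Factor

/-! ### Poisson summation along the isotropic line -/

section OneDim

/-- `(c τ̄ + d) / (-2iy)`. -/
def zFactor (τ : ℂ) (c d : ℤ) : ℂ := I * (c * (starRingEnd ℂ) τ + d) / (2 * τ.im)

/-- `exp (-π |cτ + d|² / (2ys))`. -/
def gaussFactor (s : ℝ) (τ : ℂ) (c d : ℤ) : ℝ :=
  Real.exp (-(Real.pi * normSq (c * τ + d)) / (2 * τ.im * s))

/-- The Gaussian factor of the component along `u`. -/
def lineExp (s : ℝ) (τ : ℂ) (c : ℤ) (a : ℝ) : ℂ :=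
  cexp (Real.pi * I * (τ * (a : ℂ) ^ 2 - (starRingEnd ℂ) τ * ((c : ℂ) - a) ^ 2) / s)

/-- The Fourier transform of `lineExp`. -/
def lineDual (s : ℝ) (τ : ℂ) (c : ℤ) (a₀ : ℝ) (d : ℤ) : ℂ :=
  gaussFactor s τ c d * expi (d * (c - 2 * a₀) / (2 * s) : ℝ)

lemma norm_lineExp {s : ℝ} (τ : ℂ) (c : ℤ) (a : ℝ) :
    ‖lineExp s τ c a‖ = Real.exp (-(Real.pi * τ.im / s) * (a ^ 2 + (c - a) ^ 2)) := by
  have : lineExp s τ c a = expi (τ * (a ^ 2 / (2 * s) : ℝ) +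
      (starRingEnd ℂ) τ * (-(c - a) ^ 2 / (2 * s) : ℝ) - (0 : ℝ)) := by
    rw [lineExp, expi]
    congr 1
    push_cast
    ring
  rw [this, norm_expi]
  congr 1
  ring

lemma norm_expi_ofReal (t : ℝ) : ‖expi t‖ = 1 := by
  rw [expi, show 2 * (Real.pi : ℂ) * I * t = ((2 * Real.pi * t : ℝ) : ℂ) * I by push_cast; ring,
    Complex.norm_exp_ofReal_mul_I]

lemma norm_lineDual (s : ℝ) (τ : ℂ) (c : ℤ) (a₀ : ℝ) (d : ℤ) :
    ‖lineDual s τ c a₀ d‖ = gaussFactor s τ c d := by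
  rw [lineDual, norm_mul, norm_expi_ofReal, mul_one, Complex.norm_real, Real.norm_eq_abs,
    gaussFactor, Real.abs_exp]

/-- Half of the Gaussian exponent absorbs the linear term; the other half is compared with `n²`
after discarding the shift `β`. -/
lemma summable_exp_neg_sq_affine {ε α : ℝ} (hε : 0 < ε) (hα : α ≠ 0) (β R : ℝ) :
    Summable fun n : ℤ => Real.exp (-ε * (β + α * n) ^ 2 + R * |β + α * n|) := by
  have hα2 : 0 < α ^ 2 := by positivity
  refine Summable.of_nonneg_of_le (fun n => (Real.exp_pos _).le) (fun n => ?_)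
    ((summable_exp_neg_mul_int_sq (ε := ε * α ^ 2 / 4) (by positivity)).mul_left
      (Real.exp (R ^ 2 / (2 * ε) + ε / 2 * β ^ 2)))
  rw [← Real.exp_add, Real.exp_le_exp]
  set u := β + α * n with hu
  have h1 : R * |u| ≤ R ^ 2 / (2 * ε) + ε / 2 * u ^ 2 := by
    have h2 : R ^ 2 / (2 * ε) + ε / 2 * u ^ 2 - R * |u| = (R - ε * |u|) ^ 2 / (2 * ε) := by
      rw [← sq_abs u]
      field_simp
      ring
    have h3 : 0 ≤ (R - ε * |u|) ^ 2 / (2 * ε) := by positivity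
    linarith
  have h4 : α ^ 2 * (n : ℝ) ^ 2 / 2 - β ^ 2 ≤ u ^ 2 := by
    rw [hu]
    nlinarith [sq_nonneg (2 * β + α * n)]
  have h5 := mul_le_mul_of_nonneg_left h4 (by positivity : 0 ≤ ε / 2)
  nlinarith

lemma summable_lineExp {s : ℝ} (hs : 0 < s) {τ : ℂ} (hτ : 0 < τ.im) (c : ℤ) (a₀ : ℝ) :
    Summable fun n : ℤ => ‖lineExp s τ c (a₀ + s * n)‖ * Real.exp |a₀ + s * n| := by
  have hπ := Real.pi_pos
  refine Summable.of_nonneg_of_le (fun n => by positivity) (fun n => ?_)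
    (summable_exp_neg_sq_affine (ε := Real.pi * τ.im / s) (by positivity) hs.ne' a₀ 1)
  rw [norm_lineExp, ← Real.exp_add, Real.exp_le_exp, one_mul]
  have : 0 ≤ Real.pi * τ.im / s * ((c : ℝ) - (a₀ + s * n)) ^ 2 := by positivity
  linarith

lemma normSq_mul_add (τ : ℂ) (c d : ℤ) :
    normSq (c * τ + d) = (c * τ.re + d) ^ 2 + c ^ 2 * τ.im ^ 2 := by
  simp [normSq_apply]
  ring

lemma normSq_zFactor (τ : ℂ) (c d : ℤ) :
    normSq (zFactor τ c d) = normSq (c * τ + d) / (4 * τ.im ^ 2) := by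
  rw [zFactor, normSq_div, normSq_mul, normSq_I, one_mul, normSq_mul_add]
  simp [normSq_apply]
  ring

lemma summable_lineDual {s : ℝ} (hs : 0 < s) {τ : ℂ} (hτ : 0 < τ.im) (c : ℤ) (a₀ : ℝ) :
    Summable fun d : ℤ => ‖lineDual s τ c a₀ d‖ * Real.exp ‖zFactor τ c d‖ := by
  have hπ := Real.pi_pos
  refine Summable.of_nonneg_of_le (fun n => by positivity) (fun d => ?_)
    ((summable_exp_neg_sq_affine (ε := Real.pi / (2 * τ.im * s)) (by positivity) one_ne_zero
      (c * τ.re) (1 / (2 * τ.im))).mul_left (Real.exp (|(c : ℝ)| / 2)))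
  rw [norm_lineDual, gaussFactor, ← Real.exp_add, ← Real.exp_add, Real.exp_le_exp, normSq_mul_add,
    one_mul]
  have h1 : ‖zFactor τ c d‖ ≤ |(c : ℝ)| / 2 + 1 / (2 * τ.im) * |c * τ.re + d| := by
    have : zFactor τ c d = ((c / 2 : ℝ) : ℂ) + (((c * τ.re + d) / (2 * τ.im) : ℝ) : ℂ) * I := by
      have hy : (τ.im : ℂ) ≠ 0 := by exact_mod_cast hτ.ne'
      rw [zFactor]
      have hc : (starRingEnd ℂ) τ = τ.re - τ.im * I := by
        apply Complex.ext <;> simp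
      rw [hc]
      push_cast
      field_simp
      linear_combination (-(c * τ.im : ℂ)) * I_sq
    rw [this]
    refine (norm_add_le _ _).trans ?_
    rw [norm_mul, norm_I, mul_one, Complex.norm_real, Complex.norm_real, Real.norm_eq_abs,
      Real.norm_eq_abs, abs_div, abs_div, abs_two, abs_of_pos (by positivity : 0 < 2 * τ.im)]
    refine le_of_eq ?_
    ring
  have h2 : -(Real.pi * ((c * τ.re + d) ^ 2 + c ^ 2 * τ.im ^ 2)) / (2 * τ.im * s) ≤
      -(Real.pi / (2 * τ.im * s)) * (c * τ.re + d) ^ 2 := by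
    have : 0 ≤ Real.pi * (c ^ 2 * τ.im ^ 2) / (2 * τ.im * s) := by positivity
    have e : -(Real.pi * ((c * τ.re + d) ^ 2 + c ^ 2 * τ.im ^ 2)) / (2 * τ.im * s) =
      -(Real.pi / (2 * τ.im * s)) * (c * τ.re + d) ^ 2 -
        Real.pi * (c ^ 2 * τ.im ^ 2) / (2 * τ.im * s) := by ring
    linarith
  linarith

/-- The exponent is quadratic in `n` with leading coefficient `πi (τ - τ̄) s = -2πys`, which is
real, so the sum over `n` is a Jacobi theta series. The parameter `t` generates the moments in `a`,
as for the lattice theta series. -/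
lemma tsum_lineExp_mul_exp {s : ℝ} (hs : 0 < s) {τ : ℂ} (hτ : 0 < τ.im) (c : ℤ) (a₀ : ℝ) (t : ℂ) :
    ∑' n : ℤ, lineExp s τ c (a₀ + s * n) * cexp (t * (a₀ + s * n : ℝ)) =
      cexp (s / (8 * Real.pi * τ.im) * t ^ 2) * ∑' d : ℤ,
        ((1 / √(2 * τ.im * s) : ℝ) : ℂ) * lineDual s τ c a₀ d * cexp (t * zFactor τ c d) := by
  have hπ : (Real.pi : ℂ) ≠ 0 := by exact_mod_cast Real.pi_ne_zero
  have hy : (τ.im : ℂ) ≠ 0 := by exact_mod_cast hτ.ne'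
  have hs0 : (s : ℂ) ≠ 0 := by exact_mod_cast hs.ne'
  have hA : 0 < ((2 * τ.im * s : ℝ) : ℂ).re := by
    rw [Complex.ofReal_re]
    positivity
  have hc : (starRingEnd ℂ) τ = τ.re - τ.im * I := by
    apply Complex.ext <;> simp
  have hτe : τ = τ.re + τ.im * I := (Complex.re_add_im τ).symm
  set β : ℂ := (-4 * Real.pi * τ.im * a₀ + t * s + 2 * Real.pi * I * (starRingEnd ℂ) τ * c) /
    (2 * Real.pi) with hβ
  set K : ℂ := cexp (-2 * Real.pi * τ.im * a₀ ^ 2 / s + (t + 2 * Real.pi * I * (starRingEnd ℂ) τ * c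
    / s) * a₀ - Real.pi * I * (starRingEnd ℂ) τ * c ^ 2 / s) with hK
  have h1 : ∀ n : ℤ, lineExp s τ c (a₀ + s * n) * cexp (t * (a₀ + s * n : ℝ)) =
      K * cexp (-Real.pi * ((2 * τ.im * s : ℝ) : ℂ) * n ^ 2 + 2 * Real.pi * β * n) := by
    intro n
    rw [lineExp, hK, ← Complex.exp_add, ← Complex.exp_add, hβ]
    congr 1
    have hτ2 : τ = (starRingEnd ℂ) τ + 2 * τ.im * I := by
      rw [hc]
      linear_combination hτe
    push_cast
    generalize (starRingEnd ℂ) τ = σ at *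
    generalize (τ.im : ℂ) = y at *
    field_simp
    rw [hτ2]
    ring_nf
    simp only [I_sq]
    ring
  have hsq : 1 / ((2 * τ.im * s : ℝ) : ℂ) ^ (1 / 2 : ℂ) = ((1 / √(2 * τ.im * s) : ℝ) : ℂ) := by
    rw [Real.sqrt_eq_rpow]
    push_cast [Complex.ofReal_cpow (by positivity : 0 ≤ 2 * τ.im * s)]
    rfl
  simp_rw [h1]
  -- The dual index is reversed so that it agrees with the sign of `d` in `zFactor`.
  rw [tsum_mul_left, Complex.tsum_exp_neg_quadratic hA, hsq, ← tsum_mul_left, ← tsum_mul_left,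
    ← tsum_mul_left, ← (Equiv.neg ℤ).tsum_eq]
  refine tsum_congr fun d => ?_
  have key : K * cexp (-Real.pi / ((2 * τ.im * s : ℝ) : ℂ) * ((-d : ℤ) + I * β) ^ 2) =
      cexp (s / (8 * Real.pi * τ.im) * t ^ 2) * (lineDual s τ c a₀ d * cexp (t * zFactor τ c d)) := by
    rw [lineDual, gaussFactor, expi, zFactor, Complex.ofReal_exp, normSq_mul_add, hK,
      ← Complex.exp_add, ← Complex.exp_add, ← Complex.exp_add, ← Complex.exp_add, hβ, hc]
    congr 1
    push_cast
    generalize (τ.im : ℂ) = y at *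
    generalize (τ.re : ℂ) = x at *
    field_simp
    ring_nf
    have hI5 : I ^ 5 = I := by rw [pow_succ, I_pow_four, one_mul]
    have hI6 : I ^ 6 = -1 := by rw [pow_succ, hI5, I_mul_I]
    simp only [I_sq, I_pow_three, I_pow_four, hI5, hI6]
    ring
  rw [Equiv.neg_apply]
  linear_combination ((1 / √(2 * τ.im * s) : ℝ) : ℂ) * key

lemma summable_moments {J : Type*} {C a : J → ℂ} (h : Summable fun i => ‖C i‖ * Real.exp ‖a i‖) :
    Summable C ∧ (Summable fun i => C i * a i) ∧ Summable fun i => C i * a i ^ 2 := by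
  refine ⟨Summable.of_norm_bounded h fun i => ?_, Summable.of_norm_bounded h fun i => ?_,
    Summable.of_norm_bounded (h.mul_left 2) fun i => ?_⟩
  · exact le_mul_of_one_le_right (norm_nonneg _) (Real.one_le_exp (norm_nonneg _))
  · rw [norm_mul]
    have := Real.add_one_le_exp ‖a i‖
    exact mul_le_mul_of_nonneg_left (by linarith) (norm_nonneg _)
  · rw [norm_mul, norm_pow, mul_left_comm]
    have := Real.quadratic_le_exp_of_nonneg (norm_nonneg (a i))
    exact mul_le_mul_of_nonneg_left (by linarith [norm_nonneg (a i)]) (norm_nonneg _)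

/-- Poisson summation along the line spanned by `u`, for polynomials of degree at most two. -/
theorem tsum_lineExp {s : ℝ} (hs : 0 < s) {τ : ℂ} (hτ : 0 < τ.im) (c : ℤ) (a₀ : ℝ)
    (v₀ v₁ v₂ : ℂ) :
    ∑' n : ℤ, lineExp s τ c (a₀ + s * n) *
        (v₀ + v₁ * (a₀ + s * n : ℝ) + v₂ * ((a₀ + s * n : ℝ) : ℂ) ^ 2) =
      ((1 / √(2 * τ.im * s) : ℝ) : ℂ) * ∑' d : ℤ, lineDual s τ c a₀ d *
        (v₀ + v₁ * zFactor τ c d + v₂ * (zFactor τ c d ^ 2 + s / (4 * Real.pi * τ.im))) := by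
  set N : ℂ := ((1 / √(2 * τ.im * s) : ℝ) : ℂ) with hN
  have hC : Summable fun n : ℤ => ‖lineExp s τ c (a₀ + s * n)‖ *
      Real.exp ‖((a₀ + s * n : ℝ) : ℂ)‖ := by
    simpa only [Complex.norm_real, Real.norm_eq_abs] using summable_lineExp hs hτ c a₀
  have hD := summable_lineDual hs hτ c a₀
  have hD' : Summable fun d : ℤ => ‖N * lineDual s τ c a₀ d‖ * Real.exp ‖zFactor τ c d‖ := by
    refine (hD.mul_left ‖N‖).congr fun d => ?_
    rw [norm_mul, mul_assoc]
  obtain ⟨h0, h1, h2⟩ := exp_series_compare hC hD' (tsum_lineExp_mul_exp hs hτ c a₀)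
  obtain ⟨c0, c1, c2⟩ := summable_moments hC
  obtain ⟨d0, d1, d2⟩ := summable_moments hD'
  have e1 : ∑' n : ℤ, lineExp s τ c (a₀ + s * n) *
        (v₀ + v₁ * (a₀ + s * n : ℝ) + v₂ * ((a₀ + s * n : ℝ) : ℂ) ^ 2) =
      v₀ * ∑' n : ℤ, lineExp s τ c (a₀ + s * n) +
      v₁ * ∑' n : ℤ, lineExp s τ c (a₀ + s * n) * (a₀ + s * n : ℝ) +
      v₂ * ∑' n : ℤ, lineExp s τ c (a₀ + s * n) * ((a₀ + s * n : ℝ) : ℂ) ^ 2 := by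
    rw [← tsum_mul_left, ← tsum_mul_left, ← tsum_mul_left,
      ← (c0.mul_left v₀).tsum_add (c1.mul_left v₁),
      ← ((c0.mul_left v₀).add (c1.mul_left v₁)).tsum_add (c2.mul_left v₂)]
    exact tsum_congr fun n => by ring
  have e2 : N * ∑' d : ℤ, lineDual s τ c a₀ d *
        (v₀ + v₁ * zFactor τ c d + v₂ * (zFactor τ c d ^ 2 + s / (4 * Real.pi * τ.im))) =
      (v₀ + v₂ * (s / (4 * Real.pi * τ.im))) * ∑' d : ℤ, N * lineDual s τ c a₀ d +
      v₁ * ∑' d : ℤ, N * lineDual s τ c a₀ d * zFactor τ c d +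
      v₂ * ∑' d : ℤ, N * lineDual s τ c a₀ d * zFactor τ c d ^ 2 := by
    rw [← tsum_mul_left, ← tsum_mul_left, ← tsum_mul_left, ← tsum_mul_left,
      ← (d0.mul_left _).tsum_add (d1.mul_left v₁),
      ← ((d0.mul_left _).add (d1.mul_left v₁)).tsum_add (d2.mul_left v₂)]
    exact tsum_congr fun n => by ring
  rw [e1, e2, h0, h1, h2]
  ring

end OneDim

/-! ### Terms of the theta series before and after partial Poisson summation -/

section Unfold

variable {Λ : Type*} [AddCommGroup Λ] [Module.Free ℤ Λ] [Module.Finite ℤ Λ]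
  {B : LinearMap.BilinForm ℤ Λ} {ι₁ ι₂ : Type*} [Fintype ι₁] [Fintype ι₂]
  {φ : Λ →+ (ι₁ ⊕ ι₂ → ℝ)}

/-- The inner product of `x + n u + c u'` with `u_{z^⊥}`. -/
def lineCoord (s : ℝ) (ν x : ι₁ ⊕ ι₂ → ℝ) (c n : ℤ) : ℝ :=
  s * stdForm x ν + c * (1 - s * stdForm ν ν) / 2 + s * n

/-- The value of `exp (-Δ / 8πy) (P)` in terms of the component `x` in `w^⊥` and the inner product
`a` with `u_{z^⊥}`. -/
def PolyData.fullVal (D : PolyData ι₁) (y : ℝ) (x : ι₁ ⊕ ι₂ → ℝ) (a : ℝ) : ℝ :=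
  2 * (linForm D.A x + a / D.s * D.c) * (linForm D.A' x + a / D.s * D.c') -
    (∑ i, D.A i * D.A' i + D.c * D.c' / D.s) / (2 * Real.pi * y)

/-- The term of `x + n u + c u'` in the Siegel theta series of the unimodular lattice. -/
def PolyData.fullTerm (D : PolyData ι₁) (φ : Λ →+ (ι₁ ⊕ ι₂ → ℝ)) (ν : ι₁ ⊕ ι₂ → ℝ) (τ : ℂ)
    (x : Λ) (c n : ℤ) : ℂ :=
  thetaExp τ 0 (-(c : ℝ) • ν) (φ x) * (lineExp D.s τ c (lineCoord D.s ν (φ x) c n) *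
    (D.fullVal τ.im (φ x + -(c : ℝ) • ν) (lineCoord D.s ν (φ x) c n) : ℝ))

/-- The term of `x` in `PolyData.block`. -/
def PolyData.blockTerm (D : PolyData ι₁) (φ : Λ →+ (ι₁ ⊕ ι₂ → ℝ)) (ν : ι₁ ⊕ ι₂ → ℝ) (τ : ℂ)
    (x : Λ) (c d : ℤ) : ℂ :=
  gaussFactor D.s τ c d * ∑ h ∈ Finset.range 3, zFactor τ c d ^ h *
    (thetaExp τ ((d : ℝ) • ν) (-(c : ℝ) • ν) (φ x) * (D.val h τ.im (φ x + -(c : ℝ) • ν) : ℝ))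

/-- The contribution of the pair `(c, d)` to the unfolded theta series. -/
def PolyData.block (D : PolyData ι₁) (φ : Λ →+ (ι₁ ⊕ ι₂ → ℝ)) (ν : ι₁ ⊕ ι₂ → ℝ) (τ : ℂ)
    (c d : ℤ) : ℂ :=
  gaussFactor D.s τ c d * ∑ h ∈ Finset.range 3, zFactor τ c d ^ h *
    D.theta φ h τ ((d : ℝ) • ν) (-(c : ℝ) • ν)

lemma PolyData.tsum_blockTerm (D : PolyData ι₁) (h : IsFrame B sgn φ) (ν : ι₁ ⊕ ι₂ → ℝ) {τ : ℂ}
    (hτ : 0 < τ.im) (c d : ℤ) : ∑' x : Λ, D.blockTerm φ ν τ x c d = D.block φ ν τ c d := by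
  simp only [PolyData.blockTerm, PolyData.block, PolyData.theta]
  rw [tsum_mul_left, Summable.tsum_finsetSum
    fun k _ => (D.summable_theta h hτ k _ _).mul_left _]
  simp_rw [tsum_mul_left]

/-- The phase created by Poisson summation in `n` simplifies to `e(-(x - cν/2, dν))`: the terms in
`c / s` cancel. This is how the dual integer `d` becomes a characteristic of the theta series of
`K`. -/
lemma thetaExp_smul_char (τ : ℂ) (ν x : ι₁ ⊕ ι₂ → ℝ) (s : ℝ) (hs : s ≠ 0) (c d : ℤ) :
    thetaExp τ 0 (-(c : ℝ) • ν) x * expi (d * (c - 2 * (s * stdForm x ν +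
      c * (1 - s * stdForm ν ν) / 2)) / (2 * s) : ℝ) =
    thetaExp τ ((d : ℝ) • ν) (-(c : ℝ) • ν) x := by
  have h1 : stdForm (x + (1 / 2 : ℝ) • (-(c : ℝ) • ν)) ((d : ℝ) • ν) =
      d * stdForm x ν - c * d * stdForm ν ν / 2 := by
    simp only [stdForm, Finset.mul_sum, Finset.sum_div, ← Finset.sum_sub_distrib]
    refine Finset.sum_congr rfl fun i _ => ?_
    simp only [Pi.add_apply, Pi.smul_apply, smul_eq_mul]
    ring
  have h2 : stdForm (x + (1 / 2 : ℝ) • (-(c : ℝ) • ν)) 0 = 0 := by simp [stdForm]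
  rw [thetaExp, thetaExp, expi, expi, expi, ← Complex.exp_add, h1, h2]
  congr 1
  have hs' : (s : ℂ) ≠ 0 := by exact_mod_cast hs
  push_cast
  field_simp
  ring

omit [Module.Free ℤ Λ] [Module.Finite ℤ Λ] in
/-- Partial Poisson summation along `u`. -/
lemma PolyData.tsum_fullTerm (D : PolyData ι₁) (hs : 0 < D.s) (ν : ι₁ ⊕ ι₂ → ℝ) {τ : ℂ}
    (hτ : 0 < τ.im) (x : Λ) (c : ℤ) :
    ∑' n : ℤ, D.fullTerm φ ν τ x c n =
      ((1 / √(2 * τ.im * D.s) : ℝ) : ℂ) * ∑' d : ℤ, D.blockTerm φ ν τ x c d := by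
  set a₀ := D.s * stdForm (φ x) ν + c * (1 - D.s * stdForm ν ν) / 2 with ha₀
  set X := φ x + -(c : ℝ) • ν with hX
  have hy : (τ.im : ℂ) ≠ 0 := by exact_mod_cast hτ.ne'
  have hs' : (D.s : ℂ) ≠ 0 := by exact_mod_cast hs.ne'
  have hπ : (Real.pi : ℂ) ≠ 0 := by exact_mod_cast Real.pi_ne_zero
  -- The constant subtracted from `val 0` is the Laplacian in the direction of `u_{z^⊥}`. It cancels
  -- against `val 2` times `s / (4πy)`, the shift of the second moment under Poisson summation, so
  -- only `val 0`, `val 1` and `val 2` remain.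
  have key := tsum_lineExp hs hτ c a₀
    (D.val 0 τ.im X - (D.c * D.c' / (2 * Real.pi * τ.im * D.s) : ℝ)) (D.val 1 τ.im X)
    (D.val 2 τ.im X)
  have h1 : ∀ n : ℤ, D.fullTerm φ ν τ x c n = thetaExp τ 0 (-(c : ℝ) • ν) (φ x) *
      (lineExp D.s τ c (a₀ + D.s * n) *
        ((D.val 0 τ.im X - (D.c * D.c' / (2 * Real.pi * τ.im * D.s) : ℝ)) +
          D.val 1 τ.im X * (a₀ + D.s * n : ℝ) +
          D.val 2 τ.im X * ((a₀ + D.s * n : ℝ) : ℂ) ^ 2)) := by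
    intro n
    rw [PolyData.fullTerm, lineCoord, ← ha₀, ← hX]
    congr 2
    simp only [PolyData.fullVal, PolyData.val]
    generalize a₀ + D.s * n = a
    push_cast
    field_simp
    ring
  have h2 : ∀ d : ℤ, D.blockTerm φ ν τ x c d = thetaExp τ 0 (-(c : ℝ) • ν) (φ x) *
      (lineDual D.s τ c a₀ d *
        ((D.val 0 τ.im X - (D.c * D.c' / (2 * Real.pi * τ.im * D.s) : ℝ)) +
          D.val 1 τ.im X * zFactor τ c d +
          D.val 2 τ.im X * (zFactor τ c d ^ 2 + D.s / (4 * Real.pi * τ.im)))) := by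
    intro d
    rw [PolyData.blockTerm, ← thetaExp_smul_char τ ν (φ x) D.s hs.ne' c d, lineDual, ← ha₀, ← hX,
      Finset.sum_range_succ, Finset.sum_range_succ, Finset.sum_range_one]
    generalize expi _ = E
    generalize thetaExp τ 0 (-(c : ℝ) • ν) (φ x) = T
    simp only [PolyData.val]
    push_cast
    field_simp
    ring
  simp_rw [h1, h2]
  rw [tsum_mul_left, key, tsum_mul_left]
  ring

end Unfold

/-! ### Gaussian majorants and the interchange of summations -/

section Convergence

variable {Λ : Type*} [AddCommGroup Λ] [Module.Free ℤ Λ] [Module.Finite ℤ Λ]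
  {B : LinearMap.BilinForm ℤ Λ} {ι₁ ι₂ : Type*} [Fintype ι₁] [Fintype ι₂]
  {φ : Λ →+ (ι₁ ⊕ ι₂ → ℝ)}

/-- The square of the Euclidean norm. -/
def normSqSum (x : ι₁ ⊕ ι₂ → ℝ) : ℝ := ∑ i, x i ^ 2

lemma normSqSum_nonneg (x : ι₁ ⊕ ι₂ → ℝ) : 0 ≤ normSqSum x :=
  Finset.sum_nonneg fun _ _ => sq_nonneg _

lemma normSqSum_le (x ν : ι₁ ⊕ ι₂ → ℝ) (c : ℝ) :
    normSqSum x ≤ 2 * normSqSum (x + -c • ν) + 2 * c ^ 2 * normSqSum ν := by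
  simp only [normSqSum, Finset.mul_sum, ← Finset.sum_add_distrib]
  refine Finset.sum_le_sum fun i _ => ?_
  simp only [Pi.add_apply, Pi.smul_apply, smul_eq_mul]
  nlinarith [sq_nonneg (x i - 2 * c * ν i)]

lemma stdForm_sq_le (x y : ι₁ ⊕ ι₂ → ℝ) : stdForm x y ^ 2 ≤ normSqSum x * normSqSum y := by
  have h := Finset.sum_mul_sq_le_sq_mul_sq Finset.univ (fun i => sgn i * x i) y
  have h1 : ∑ i, (sgn i * x i) ^ 2 = normSqSum x := by
    refine Finset.sum_congr rfl fun i _ => ?_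
    rcases i with i | i <;> simp [sgn]
  rw [h1] at h
  exact h

lemma linForm_sq_le (A : ι₁ → ℝ) (x : ι₁ ⊕ ι₂ → ℝ) :
    linForm A x ^ 2 ≤ (∑ i, A i ^ 2) * normSqSum x := by
  refine (Finset.sum_mul_sq_le_sq_mul_sq Finset.univ A fun i => x (Sum.inl i)).trans ?_
  refine mul_le_mul_of_nonneg_left ?_ (Finset.sum_nonneg fun _ _ => sq_nonneg _)
  rw [normSqSum, Fintype.sum_sum_type]
  exact le_add_of_nonneg_right (Finset.sum_nonneg fun _ _ => sq_nonneg _)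

lemma summable_exp_neg_triple (h : IsFrame B sgn φ) {ε : ℝ} (hε : 0 < ε) :
    Summable fun t : (Λ × ℤ) × ℤ =>
      Real.exp (-ε * (normSqSum (φ t.1.1) + (t.1.2 : ℝ) ^ 2 + (t.2 : ℝ) ^ 2)) := by
  have h1 : Summable fun x : Λ => Real.exp (-ε * normSqSum (φ x)) := summable_exp_neg_frame h hε
  have h2 := summable_exp_neg_mul_int_sq hε
  have h3 := (h1.mul_of_nonneg h2 (fun _ => (Real.exp_pos _).le) fun _ => (Real.exp_pos _).le)
  refine (h3.mul_of_nonneg h2 (fun _ => by positivity) fun _ => (Real.exp_pos _).le).congr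
    fun t => ?_
  rw [← Real.exp_add, ← Real.exp_add]
  congr 1
  ring

/-- A family indexed by `Λ × ℤ × ℤ` which is dominated by a Gaussian function is summable. -/
lemma summable_of_le_gaussian (h : IsFrame B sgn φ) {F : (Λ × ℤ) × ℤ → ℂ} {C ε K : ℝ} (hε : 0 < ε)
    (hK : 0 < K) (q : (Λ × ℤ) × ℤ → ℝ) (hF : ∀ t, ‖F t‖ ≤ C * Real.exp (-ε * q t))
    (hq : ∀ t, normSqSum (φ t.1.1) + (t.1.2 : ℝ) ^ 2 + (t.2 : ℝ) ^ 2 ≤ K * q t) :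
    Summable F := by
  have hC : 0 ≤ C ∨ ∀ t, F t = 0 := by
    by_cases hC : 0 ≤ C
    · exact Or.inl hC
    · refine Or.inr fun t => norm_le_zero_iff.1 ((hF t).trans ?_)
      exact mul_nonpos_of_nonpos_of_nonneg (not_le.1 hC).le (Real.exp_pos _).le
  rcases hC with hC | h0
  · refine Summable.of_norm_bounded
      ((summable_exp_neg_triple h (ε := ε / K) (by positivity)).mul_left C) fun t => ?_
    refine (hF t).trans (mul_le_mul_of_nonneg_left (Real.exp_le_exp.2 ?_) hC)
    have := mul_le_mul_of_nonneg_left (hq t) (by positivity : 0 ≤ ε / K)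
    have e : ε / K * (K * q t) = ε * q t := by
      field_simp
    linarith
  · rw [funext h0]
    exact summable_zero

lemma one_add_le_mul_exp {ε : ℝ} (hε : 0 < ε) {q : ℝ} (hq : 0 ≤ q) :
    1 + q ≤ (1 + 1 / ε) * Real.exp (ε * q) := by
  have h := Real.add_one_le_exp (ε * q)
  have h2 : (1 + 1 / ε) * (ε * q + 1) = 1 + q + ε * q + 1 / ε := by
    field_simp
    ring
  have h3 : 0 ≤ ε * q + 1 / ε := by positivity
  have h4 := mul_le_mul_of_nonneg_left h (by positivity : 0 ≤ 1 + 1 / ε)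
  linarith

/-- Half of each Gaussian exponent pays for the polynomial factor. In the applications `q` measures
the component in `w^⊥ ⊕ w` and `ρ` the component along `u` or its dual variable. -/
lemma summable_of_le_poly_gaussian (h : IsFrame B sgn φ) {F : (Λ × ℤ) × ℤ → ℂ} {C ε₀ ε₁ K : ℝ}
    (hC : 0 ≤ C) (hε₀ : 0 < ε₀) (hε₁ : 0 < ε₁) (hK : 0 < K) (q ρ : (Λ × ℤ) × ℤ → ℝ)
    (hq : ∀ t, 0 ≤ q t) (hρ : ∀ t, 0 ≤ ρ t)
    (hF : ∀ t, ‖F t‖ ≤ C * ((1 + q t) * (1 + ρ t)) *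
      (Real.exp (-(2 * ε₀) * q t) * Real.exp (-(2 * ε₁) * ρ t)))
    (hN : ∀ t, normSqSum (φ t.1.1) + (t.1.2 : ℝ) ^ 2 + (t.2 : ℝ) ^ 2 ≤ K * (q t + ρ t)) :
    Summable F := by
  refine summable_of_le_gaussian h (C := C * ((1 + 1 / ε₀) * (1 + 1 / ε₁)))
    (lt_min hε₀ hε₁) hK (fun t => q t + ρ t) (fun t => (hF t).trans ?_) hN
  have h0 := one_add_le_mul_exp hε₀ (hq t)
  have h1 := one_add_le_mul_exp hε₁ (hρ t)
  have e0 : Real.exp (-(2 * ε₀) * q t) = Real.exp (-ε₀ * q t) * Real.exp (-ε₀ * q t) := by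
    rw [← Real.exp_add]
    ring_nf
  have e1 : Real.exp (-(2 * ε₁) * ρ t) = Real.exp (-ε₁ * ρ t) * Real.exp (-ε₁ * ρ t) := by
    rw [← Real.exp_add]
    ring_nf
  have i0 : Real.exp (ε₀ * q t) * Real.exp (-ε₀ * q t) = 1 := by
    rw [← Real.exp_add]
    simp
  have i1 : Real.exp (ε₁ * ρ t) * Real.exp (-ε₁ * ρ t) = 1 := by
    rw [← Real.exp_add]
    simp
  calc C * ((1 + q t) * (1 + ρ t)) * (Real.exp (-(2 * ε₀) * q t) * Real.exp (-(2 * ε₁) * ρ t))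
      ≤ C * (((1 + 1 / ε₀) * Real.exp (ε₀ * q t)) * ((1 + 1 / ε₁) * Real.exp (ε₁ * ρ t))) *
        (Real.exp (-(2 * ε₀) * q t) * Real.exp (-(2 * ε₁) * ρ t)) := by
        have := hq t
        have := hρ t
        gcongr
    _ = C * ((1 + 1 / ε₀) * (1 + 1 / ε₁)) * (Real.exp (-ε₀ * q t) * Real.exp (-ε₁ * ρ t)) := by
        rw [e0, e1]
        linear_combination (C * (1 + 1 / ε₀) * (1 + 1 / ε₁) * Real.exp (-ε₀ * q t) *
          Real.exp (-ε₁ * ρ t) * (Real.exp (ε₁ * ρ t) * Real.exp (-ε₁ * ρ t))) * i0 +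
          (C * (1 + 1 / ε₀) * (1 + 1 / ε₁) * Real.exp (-ε₀ * q t) * Real.exp (-ε₁ * ρ t)) * i1
    _ ≤ C * ((1 + 1 / ε₀) * (1 + 1 / ε₁)) * Real.exp (-min ε₀ ε₁ * (q t + ρ t)) := by
        rw [← Real.exp_add]
        refine mul_le_mul_of_nonneg_left (Real.exp_le_exp.2 ?_) (by positivity)
        have := mul_le_mul_of_nonneg_right (min_le_left ε₀ ε₁) (hq t)
        have := mul_le_mul_of_nonneg_right (min_le_right ε₀ ε₁) (hρ t)
        linarith

lemma abs_le_one_add_sq (x : ℝ) : |x| ≤ 1 + x ^ 2 := by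
  rw [← sq_abs]
  nlinarith [sq_nonneg (|x| - 1), abs_nonneg x]

lemma PolyData.exists_abs_val_le (D : PolyData ι₁) (y : ℝ) :
    ∃ C : ℝ, 0 ≤ C ∧ ∀ k < 3, ∀ x : ι₁ ⊕ ι₂ → ℝ, |D.val k y x| ≤ C * (1 + normSqSum x) := by
  set a := ∑ i, D.A i ^ 2 with ha
  set a' := ∑ i, D.A' i ^ 2 with ha'
  have ha0 : 0 ≤ a := Finset.sum_nonneg fun _ _ => sq_nonneg _
  have ha0' : 0 ≤ a' := Finset.sum_nonneg fun _ _ => sq_nonneg _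
  set g := (∑ i, D.A i * D.A' i) / (4 * Real.pi * y) with hg
  have hl : ∀ x : ι₁ ⊕ ι₂ → ℝ, |linForm D.A x| ≤ (1 + a) * (1 + normSqSum x) := by
    intro x
    have h1 := linForm_sq_le D.A x
    have h2 := normSqSum_nonneg x
    have h3 := abs_le_one_add_sq (linForm D.A x)
    linarith
  have hl' : ∀ x : ι₁ ⊕ ι₂ → ℝ, |linForm D.A' x| ≤ (1 + a') * (1 + normSqSum x) := by
    intro x
    have h1 := linForm_sq_le D.A' x
    have h2 := normSqSum_nonneg x
    have h3 := abs_le_one_add_sq (linForm D.A' x)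
    linarith
  have hll : ∀ x : ι₁ ⊕ ι₂ → ℝ,
      |linForm D.A x * linForm D.A' x| ≤ (a + a') * (1 + normSqSum x) := by
    intro x
    have h1 := linForm_sq_le D.A x
    have h1' := linForm_sq_le D.A' x
    have h2 := normSqSum_nonneg x
    have h3 : |linForm D.A x * linForm D.A' x| ≤ linForm D.A x ^ 2 + linForm D.A' x ^ 2 := by
      rw [abs_le]
      constructor <;>
      nlinarith [sq_nonneg (linForm D.A x + linForm D.A' x),
        sq_nonneg (linForm D.A x - linForm D.A' x), sq_nonneg (linForm D.A x),
        sq_nonneg (linForm D.A' x)]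
    linarith
  refine ⟨2 * ((a + a') + |g|) + |2 / D.s| * (|D.c'| * (1 + a) + |D.c| * (1 + a')) +
    |2 * D.c * D.c' / D.s ^ 2|, by positivity, fun k hk x => ?_⟩
  have h2 := normSqSum_nonneg x
  set Q := 1 + normSqSum x with hQ
  have hQ1 : 1 ≤ Q := by linarith
  have b0 : |D.val 0 y x| ≤ 2 * ((a + a') + |g|) * Q := by
    simp only [PolyData.val, ← hg]
    rw [abs_mul, abs_two, mul_assoc]
    refine mul_le_mul_of_nonneg_left ((abs_sub _ _).trans ?_) zero_le_two
    have := hll x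
    have := le_mul_of_one_le_right (abs_nonneg g) hQ1
    linarith
  have b1 : |D.val 1 y x| ≤ |2 / D.s| * (|D.c'| * (1 + a) + |D.c| * (1 + a')) * Q := by
    simp only [PolyData.val]
    rw [abs_mul, mul_assoc]
    refine mul_le_mul_of_nonneg_left ((abs_add_le _ _).trans ?_) (abs_nonneg _)
    rw [abs_mul, abs_mul]
    have := mul_le_mul_of_nonneg_left (hl x) (abs_nonneg D.c')
    have := mul_le_mul_of_nonneg_left (hl' x) (abs_nonneg D.c)
    linarith
  have b2 : |D.val 2 y x| ≤ |2 * D.c * D.c' / D.s ^ 2| * Q := by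
    simp only [PolyData.val]
    exact le_mul_of_one_le_right (abs_nonneg _) hQ1
  have p0 : 0 ≤ 2 * ((a + a') + |g|) * Q := by positivity
  have p1 : 0 ≤ |2 / D.s| * (|D.c'| * (1 + a) + |D.c| * (1 + a')) * Q := by positivity
  have p2 : 0 ≤ |2 * D.c * D.c' / D.s ^ 2| * Q := by positivity
  interval_cases k <;> linarith

-- The Taylor coefficients in `a` are the values of `PolyData.val`. The leftover constant is the
-- part of the Laplacian along `u_{z^⊥}`, which `val 0` does not contain.
omit [Fintype ι₂] in
lemma PolyData.fullVal_eq (D : PolyData ι₁) (hs : D.s ≠ 0) {y : ℝ} (hy : y ≠ 0)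
    (x : ι₁ ⊕ ι₂ → ℝ) (a : ℝ) :
    D.fullVal y x a = D.val 0 y x + D.val 1 y x * a + D.val 2 y x * a ^ 2 -
      D.c * D.c' / (2 * Real.pi * y * D.s) := by
  have hπ := Real.pi_ne_zero
  simp only [PolyData.fullVal, PolyData.val]
  field_simp
  ring

/-- The absolute value decays in `X = x - cν`, `a` and `c - a`, and these determine `x`, `c` and `n`
linearly. The constant `K` adds up the resulting bounds for `|x|²`, `c²` and `n²`. -/
lemma summable_fullTerm (D : PolyData ι₁) (h : IsFrame B sgn φ) (hs : 0 < D.s) (ν : ι₁ ⊕ ι₂ → ℝ)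
    {τ : ℂ} (hτ : 0 < τ.im) :
    Summable fun t : (Λ × ℤ) × ℤ => D.fullTerm φ ν τ t.1.1 t.1.2 t.2 := by
  have hπ := Real.pi_pos
  obtain ⟨C, hC, hval⟩ := D.exists_abs_val_le (ι₂ := ι₂) τ.im
  set η := (1 - D.s * stdForm ν ν) / 2 with hη
  set V := normSqSum ν with hV
  have hV0 : 0 ≤ V := normSqSum_nonneg ν
  set k := |D.c * D.c' / (2 * Real.pi * τ.im * D.s)|
  set a : (Λ × ℤ) × ℤ → ℝ := fun t => lineCoord D.s ν (φ t.1.1) t.1.2 t.2 with ha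
  refine summable_of_le_poly_gaussian h (C := 2 * C + k) (ε₀ := Real.pi * τ.im / 2)
    (ε₁ := Real.pi * τ.im / D.s / 2)
    (K := (2 + 4 * V + 2) + 3 * (1 / D.s ^ 2 + V * (2 + 4 * V) + 2 * η ^ 2 / D.s ^ 2))
    (by positivity) (by positivity) (by positivity) (by positivity)
    (fun t => normSqSum (φ t.1.1 + -(t.1.2 : ℝ) • ν)) (fun t => a t ^ 2 + (t.1.2 - a t) ^ 2)
    (fun t => normSqSum_nonneg _) (fun t => by positivity) (fun t => ?_) (fun t => ?_)
  · rw [PolyData.fullTerm, norm_mul, norm_mul, norm_thetaExp, norm_lineExp, Complex.norm_real,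
      Real.norm_eq_abs]
    change Real.exp (-(Real.pi * τ.im) * normSqSum (φ t.1.1 + -(t.1.2 : ℝ) • ν)) *
      (Real.exp (-(Real.pi * τ.im / D.s) * (a t ^ 2 + (t.1.2 - a t) ^ 2)) *
        |D.fullVal τ.im (φ t.1.1 + -(t.1.2 : ℝ) • ν) (a t)|) ≤ _
    set X := φ t.1.1 + -(t.1.2 : ℝ) • ν
    have hX := normSqSum_nonneg X
    have hb : |D.fullVal τ.im X (a t)| ≤ (2 * C + k) * ((1 + normSqSum X) *
        (1 + (a t ^ 2 + (t.1.2 - a t) ^ 2))) := by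
      rw [D.fullVal_eq hs.ne' hτ.ne']
      have v0 := hval 0 (by norm_num) X
      have v1 := hval 1 (by norm_num) X
      have v2 := hval 2 (by norm_num) X
      have h1 := abs_le_one_add_sq (a t)
      have hk : 0 ≤ k := abs_nonneg _
      have hCX : 0 ≤ C * (1 + normSqSum X) := by positivity
      have m1 : |D.val 1 τ.im X * a t| ≤ C * (1 + normSqSum X) * (1 + a t ^ 2) := by
        rw [abs_mul]
        exact mul_le_mul v1 h1 (abs_nonneg _) hCX
      have m2 : |D.val 2 τ.im X * a t ^ 2| ≤ C * (1 + normSqSum X) * a t ^ 2 := by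
        rw [abs_mul, abs_of_nonneg (sq_nonneg (a t))]
        exact mul_le_mul_of_nonneg_right v2 (sq_nonneg _)
      have tri := abs_sub (D.val 0 τ.im X + D.val 1 τ.im X * a t + D.val 2 τ.im X * a t ^ 2)
        (D.c * D.c' / (2 * Real.pi * τ.im * D.s))
      have tri2 := abs_add_three (D.val 0 τ.im X) (D.val 1 τ.im X * a t) (D.val 2 τ.im X * a t ^ 2)
      have hone : 1 ≤ (1 + normSqSum X) * (1 + (a t ^ 2 + (t.1.2 - a t) ^ 2)) :=
        one_le_mul_of_one_le_of_one_le (by linarith)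
          (by nlinarith [sq_nonneg (a t), sq_nonneg ((t.1.2 : ℝ) - a t)])
      have hk2 := le_mul_of_one_le_right hk hone
      have hb2 : 0 ≤ C * (1 + normSqSum X) * ((t.1.2 : ℝ) - a t) ^ 2 := by positivity
      nlinarith
    have e0 : -(2 * (Real.pi * τ.im / 2)) = -(Real.pi * τ.im) := by ring
    have e1 : -(2 * (Real.pi * τ.im / D.s / 2)) = -(Real.pi * τ.im / D.s) := by ring
    rw [e0, e1, ← mul_assoc, mul_comm]
    exact mul_le_mul_of_nonneg_right hb (by positivity)
  · set X := φ t.1.1 + -(t.1.2 : ℝ) • ν with hX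
    have hX0 := normSqSum_nonneg X
    have hφ := normSqSum_le (φ t.1.1) ν t.1.2
    rw [← hX, ← hV] at hφ
    set c : ℝ := (t.1.2 : ℝ)
    set ρ := a t ^ 2 + (c - a t) ^ 2 with hρ
    have hρ0 : 0 ≤ ρ := by positivity
    have hc : c ^ 2 ≤ 2 * ρ := by
      rw [hρ]
      nlinarith [sq_nonneg (2 * a t - c)]
    have hcV : 2 * c ^ 2 * V ≤ 4 * V * ρ := by nlinarith
    have hstd := stdForm_sq_le (φ t.1.1) ν
    rw [← hV] at hstd
    have hst : stdForm (φ t.1.1) ν ^ 2 ≤ V * (2 + 4 * V) * (normSqSum X + ρ) := by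
      have : normSqSum (φ t.1.1) * V ≤ (2 * normSqSum X + 4 * V * ρ) * V :=
        mul_le_mul_of_nonneg_right (by linarith) hV0
      have p1 : 0 ≤ V * V * normSqSum X := by positivity
      have p2 : 0 ≤ V * ρ := by positivity
      nlinarith
    -- The definition of `lineCoord` solved for `n`.
    have hn : (t.2 : ℝ) = a t / D.s - stdForm (φ t.1.1) ν - c * η / D.s := by
      simp only [ha, lineCoord, hη]
      field_simp
      ring
    have hn2 : (t.2 : ℝ) ^ 2 ≤ 3 * ((a t / D.s) ^ 2 + stdForm (φ t.1.1) ν ^ 2 +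
        (c * η / D.s) ^ 2) := by
      rw [hn]
      nlinarith [sq_nonneg (a t / D.s + stdForm (φ t.1.1) ν), sq_nonneg (a t / D.s + c * η / D.s),
        sq_nonneg (stdForm (φ t.1.1) ν - c * η / D.s)]
    have h1 : (a t / D.s) ^ 2 ≤ 1 / D.s ^ 2 * (normSqSum X + ρ) := by
      rw [div_pow, div_eq_inv_mul, one_div]
      refine mul_le_mul_of_nonneg_left ?_ (by positivity)
      have : 0 ≤ (c - a t) ^ 2 := sq_nonneg _
      linarith
    have h3 : (c * η / D.s) ^ 2 ≤ 2 * η ^ 2 / D.s ^ 2 * (normSqSum X + ρ) := by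
      have e : (c * η / D.s) ^ 2 = η ^ 2 / D.s ^ 2 * c ^ 2 := by ring
      have e' : 2 * η ^ 2 / D.s ^ 2 * (normSqSum X + ρ) =
        η ^ 2 / D.s ^ 2 * (2 * (normSqSum X + ρ)) := by ring
      rw [e, e']
      exact mul_le_mul_of_nonneg_left (by linarith) (by positivity)
    have p3 : 0 ≤ 4 * V * normSqSum X := by positivity
    nlinarith

/-- The Gaussian factor is `exp (-(2πy / s) |Z|²)` with `Z = zFactor τ c d`, and `|Z|²` is positive
definite in `(c, d)` because `τ` is not real. The powers `1, Z, Z²` are bounded by a multiple of `1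
+ |Z|²`. -/
lemma summable_blockTerm (D : PolyData ι₁) (h : IsFrame B sgn φ) (hs : 0 < D.s)
    (ν : ι₁ ⊕ ι₂ → ℝ) {τ : ℂ} (hτ : 0 < τ.im) :
    Summable fun t : (Λ × ℤ) × ℤ => D.blockTerm φ ν τ t.1.1 t.1.2 t.2 := by
  have hπ := Real.pi_pos
  obtain ⟨C, hC, hval⟩ := D.exists_abs_val_le (ι₂ := ι₂) τ.im
  set V := normSqSum ν with hV
  have hV0 : 0 ≤ V := normSqSum_nonneg ν
  refine summable_of_le_poly_gaussian h (C := 2 * C) (ε₀ := Real.pi * τ.im / 2)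
    (ε₁ := Real.pi * τ.im / D.s)
    (K := 2 + 8 * V + 4 + (8 * τ.im ^ 2 + 8 * τ.re ^ 2))
    (by positivity) (by positivity) (by positivity) (by positivity)
    (fun t => normSqSum (φ t.1.1 + -(t.1.2 : ℝ) • ν))
    (fun t => normSq (zFactor τ t.1.2 t.2))
    (fun t => normSqSum_nonneg _) (fun t => normSq_nonneg _) (fun t => ?_) (fun t => ?_)
  · set X := φ t.1.1 + -(t.1.2 : ℝ) • ν with hX
    set Z := zFactor τ t.1.2 t.2 with hZ
    have hX0 := normSqSum_nonneg X
    have hE : ‖thetaExp τ ((t.2 : ℝ) • ν) (-(t.1.2 : ℝ) • ν) (φ t.1.1)‖ =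
      Real.exp (-(Real.pi * τ.im) * normSqSum X) := norm_thetaExp _ _ _ _
    have hG : gaussFactor D.s τ t.1.2 t.2 = Real.exp (-(2 * (Real.pi * τ.im / D.s)) * normSq Z) := by
      rw [gaussFactor, hZ, normSq_zFactor]
      congr 1
      field_simp
      ring
    have hsum : ‖∑ k ∈ Finset.range 3, Z ^ k *
        (thetaExp τ ((t.2 : ℝ) • ν) (-(t.1.2 : ℝ) • ν) (φ t.1.1) * (D.val k τ.im X : ℝ))‖ ≤
        2 * C * ((1 + normSqSum X) * (1 + normSq Z)) *
          Real.exp (-(Real.pi * τ.im) * normSqSum X) := by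
      refine (norm_sum_le _ _).trans ?_
      have hterm : ∀ k ∈ Finset.range 3, ‖Z ^ k *
          (thetaExp τ ((t.2 : ℝ) • ν) (-(t.1.2 : ℝ) • ν) (φ t.1.1) * (D.val k τ.im X : ℝ))‖ ≤
          ‖Z‖ ^ k * (C * (1 + normSqSum X) * Real.exp (-(Real.pi * τ.im) * normSqSum X)) := by
        intro k hk
        rw [norm_mul, norm_mul, norm_pow, hE, Complex.norm_real, Real.norm_eq_abs,
          mul_comm (Real.exp _)]
        have := hval k (Finset.mem_range.1 hk) X
        gcongr
      refine (Finset.sum_le_sum hterm).trans ?_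
      rw [← Finset.sum_mul]
      have hgeo : ∑ k ∈ Finset.range 3, ‖Z‖ ^ k ≤ 2 * (1 + normSq Z) := by
        rw [Finset.sum_range_succ, Finset.sum_range_succ, Finset.sum_range_one,
          Complex.normSq_eq_norm_sq]
        nlinarith [sq_nonneg (‖Z‖ - 1)]
      have h0 : 0 ≤ C * (1 + normSqSum X) * Real.exp (-(Real.pi * τ.im) * normSqSum X) := by
        positivity
      refine (mul_le_mul_of_nonneg_right hgeo h0).trans (le_of_eq ?_)
      ring
    rw [PolyData.blockTerm, norm_mul, Complex.norm_real, Real.norm_eq_abs, hG, Real.abs_exp]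
    have e0 : -(2 * (Real.pi * τ.im / 2)) = -(Real.pi * τ.im) := by ring
    rw [e0, mul_comm, ← mul_assoc]
    exact mul_le_mul_of_nonneg_right hsum (Real.exp_pos _).le
  · rw [normSq_zFactor, normSq_mul_add]
    set X := φ t.1.1 + -(t.1.2 : ℝ) • ν with hX
    have hX0 := normSqSum_nonneg X
    have hφ := normSqSum_le (φ t.1.1) ν t.1.2
    rw [← hX, ← hV] at hφ
    set c : ℝ := (t.1.2 : ℝ)
    set d : ℝ := (t.2 : ℝ)
    set ρ := ((c * τ.re + d) ^ 2 + c ^ 2 * τ.im ^ 2) / (4 * τ.im ^ 2) with hρ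
    have hρ0 : 0 ≤ ρ := by positivity
    have hρe : 4 * τ.im ^ 2 * ρ = (c * τ.re + d) ^ 2 + c ^ 2 * τ.im ^ 2 := by
      rw [hρ]
      field_simp
    have hc : c ^ 2 ≤ 4 * ρ := by
      have hy2 : 0 < τ.im ^ 2 := by positivity
      have : c ^ 2 * τ.im ^ 2 ≤ 4 * ρ * τ.im ^ 2 := by nlinarith [sq_nonneg (c * τ.re + d)]
      exact le_of_mul_le_mul_right this hy2
    have hcV : 2 * c ^ 2 * V ≤ 8 * V * ρ := by nlinarith
    have hcx : c ^ 2 * τ.re ^ 2 ≤ 4 * ρ * τ.re ^ 2 := mul_le_mul_of_nonneg_right hc (sq_nonneg _)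
    have hd : d ^ 2 ≤ 8 * τ.im ^ 2 * ρ + 8 * τ.re ^ 2 * ρ := by
      have : 0 ≤ c ^ 2 * τ.im ^ 2 := by positivity
      nlinarith [sq_nonneg (2 * c * τ.re + d)]
    have p1 : 0 ≤ (8 * V + 4 + (8 * τ.im ^ 2 + 8 * τ.re ^ 2)) * normSqSum X := by positivity
    nlinarith

/-- The unfolding of the Siegel theta series of the unimodular lattice. -/
theorem PolyData.tsum_fullTerm_eq (D : PolyData ι₁) (h : IsFrame B sgn φ) (hs : 0 < D.s)
    (ν : ι₁ ⊕ ι₂ → ℝ) {τ : ℂ} (hτ : 0 < τ.im) :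
    (Summable fun p : ℤ × ℤ => D.block φ ν τ p.1 p.2) ∧
    ∑' t : (Λ × ℤ) × ℤ, D.fullTerm φ ν τ t.1.1 t.1.2 t.2 =
      ((1 / √(2 * τ.im * D.s) : ℝ) : ℂ) * ∑' p : ℤ × ℤ, D.block φ ν τ p.1 p.2 := by
  have hL := (summable_fullTerm D h hs ν hτ).tsum_prod
  have hK := summable_blockTerm D h hs ν hτ
  have hin : ∀ p : Λ × ℤ, ∑' n : ℤ, D.fullTerm φ ν τ p.1 p.2 n =
      ((1 / √(2 * τ.im * D.s) : ℝ) : ℂ) * ∑' d : ℤ, D.blockTerm φ ν τ p.1 p.2 d :=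
    fun p => D.tsum_fullTerm hs ν hτ p.1 p.2
  have hout : ∀ p : ℤ × ℤ, ∑' x : Λ, D.blockTerm φ ν τ x p.1 p.2 = D.block φ ν τ p.1 p.2 :=
    fun p => D.tsum_blockTerm h ν hτ p.1 p.2
  generalize D.blockTerm φ ν τ = G at *
  generalize D.block φ ν τ = H at *
  generalize D.fullTerm φ ν τ = F at *
  -- The same absolutely convergent triple series, rearranged so that the lattice sum is innermost.
  let e : (ℤ × ℤ) × Λ ≃ (Λ × ℤ) × ℤ :=
    (Equiv.prodComm _ _).trans (Equiv.prodAssoc Λ ℤ ℤ).symm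
  have hK' : Summable fun t : (ℤ × ℤ) × Λ => G t.2 t.1.1 t.1.2 := e.summable_iff.2 hK
  have hb := hK'.prod
  simp only [hout] at hb
  refine ⟨hb, ?_⟩
  rw [hL]
  simp only [hin]
  rw [tsum_mul_left, ← hK.tsum_prod, ← e.tsum_eq]
  congr 1
  refine hK'.tsum_prod.trans ?_
  simp only [hout]

end Convergence

/-! ### Equivariance of the unfolded terms under `SL₂(ℤ)` -/

section Modular

variable {Λ : Type*} [AddCommGroup Λ] [Module.Free ℤ Λ] [Module.Finite ℤ Λ]
  {B : LinearMap.BilinForm ℤ Λ} {ι₁ ι₂ : Type*} [Fintype ι₁] [Fintype ι₂]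
  {φ : Λ →+ (ι₁ ⊕ ι₂ → ℝ)}

omit [Module.Free ℤ Λ] [Module.Finite ℤ Λ] in
lemma PolyData.block_add_one (D : PolyData ι₁) (h : IsFrame B sgn φ) (heven : ∀ x, Even (B x x))
    (ν : ι₁ ⊕ ι₂ → ℝ) (τ : ℂ) (c d : ℤ) :
    D.block φ ν (τ + 1) c d = D.block φ ν τ c (c + d) := by
  have h1 : (c : ℂ) * (τ + 1) + d = c * τ + (c + d : ℤ) := by push_cast; ring
  have h2 : (c : ℂ) * (starRingEnd ℂ) (τ + 1) + d = c * (starRingEnd ℂ) τ + (c + d : ℤ) := by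
    rw [map_add, map_one]
    push_cast
    ring
  simp only [PolyData.block, gaussFactor, zFactor, D.theta_add_one h heven]
  rw [h1, h2]
  simp

lemma conj_mul_eq_normSq (τ : ℂ) : (starRingEnd ℂ) τ * τ = (normSq τ : ℝ) := by
  rw [mul_comm, Complex.mul_conj]

lemma zFactor_neg_one_div {τ : ℂ} (hτ : 0 < τ.im) (c d : ℤ) :
    zFactor (-1 / τ) c d = τ * zFactor τ d (-c) := by
  have hτ0 : τ ≠ 0 := fun h => by simp [h] at hτ
  have hy : (τ.im : ℂ) ≠ 0 := by exact_mod_cast hτ.ne'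
  have hn := conj_mul_eq_normSq τ
  have hn0 : ((normSq τ : ℝ) : ℂ) ≠ 0 := by exact_mod_cast (Complex.normSq_pos.2 hτ0).ne'
  have hc : (starRingEnd ℂ) τ ≠ 0 := (map_ne_zero _).2 hτ0
  rw [zFactor, zFactor, im_neg_one_div, map_div₀, map_neg, map_one]
  push_cast
  rw [← hn]
  field_simp
  ring

lemma gaussFactor_neg_one_div (s : ℝ) {τ : ℂ} (hτ : 0 < τ.im) (c d : ℤ) :
    gaussFactor s (-1 / τ) c d = gaussFactor s τ d (-c) := by
  have hτ0 : τ ≠ 0 := fun h => by simp [h] at hτ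
  have hn0 := (Complex.normSq_pos.2 hτ0).ne'
  have h1 : (c : ℂ) * (-1 / τ) + d = (d * τ + (-c : ℤ)) / τ := by
    push_cast
    field_simp
    ring
  rw [gaussFactor, gaussFactor, h1, normSq_div, im_neg_one_div]
  congr 1
  have hy := hτ.ne'
  rcases eq_or_ne s 0 with rfl | hs
  · simp
  · field_simp

/-- The `h`-th theta series transforms with `τ^{2-h}` in place of `τ^2`, and `zFactor ^ h` supplies
the missing `τ^h`, so all three summands acquire the common factor `τ^{p+2} |τ|`. -/
lemma PolyData.block_neg_one_div (D : PolyData ι₁) (h : IsFrame B sgn φ)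
    (heven : ∀ x, Even (B x x)) {p : ℕ} (h₁ : Fintype.card ι₁ = 2 * p + 1)
    (h₂ : Fintype.card ι₂ = 1) (ν : ι₁ ⊕ ι₂ → ℝ) {τ : ℂ} (hτ : 0 < τ.im) (c d : ℤ) :
    D.block φ ν (-1 / τ) c d = τ ^ (p + 2) * (‖τ‖ : ℝ) * D.block φ ν τ d (-c) := by
  have hτ0 : τ ≠ 0 := fun h => by simp [h] at hτ
  have hn : ((‖τ‖ : ℝ) : ℂ) ≠ 0 := by exact_mod_cast norm_ne_zero_iff.2 hτ0
  have hI := I_pow_eq_one h heven h₁ h₂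
  simp only [PolyData.block, gaussFactor_neg_one_div _ hτ, zFactor_neg_one_div hτ]
  rw [mul_left_comm]
  congr 1
  rw [Finset.mul_sum]
  refine Finset.sum_congr rfl fun k hk => ?_
  have hk3 := Finset.mem_range.1 hk
  have key := D.theta_inversion h hτ (((-c : ℤ) : ℝ) • ν) (-(d : ℝ) • ν) hk3
  have e : (((-c : ℤ) : ℝ) • ν) = -(c : ℝ) • ν := by push_cast; rfl
  have e' : -(-(d : ℝ) • ν) = (d : ℝ) • ν := by rw [neg_smul, neg_neg]
  rw [key, thetaFactor_eq h₁ h₂ hτ, div_pow, hI, e, e']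
  have e2 : τ ^ (p + 2) = τ ^ p * τ ^ k * τ ^ (2 - k) := by
    rw [← pow_add, ← pow_add]
    congr 1
    omega
  rw [e2, mul_pow, inv_pow]
  push_cast
  field_simp

open UpperHalfPlane ModularGroup

/-- The contribution of `(c, d)` to the unfolded integrand. -/
def PolyData.orbitTerm (D : PolyData ι₁) (φ : Λ →+ (ι₁ ⊕ ι₂ → ℝ)) (ν : ι₁ ⊕ ι₂ → ℝ) (k : ℤ)
    (f : ℍ → ℂ) (τ : ℍ) (c d : ℤ) : ℂ :=
  ((τ.im ^ ((k : ℝ) + 1 / 2) : ℝ) : ℂ) * f τ * (starRingEnd ℂ) (D.block φ ν τ c d)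

lemma cuspForm_smul {k : ℤ} (f : CuspForm 𝒮ℒ k) (γ : SL(2, ℤ)) (τ : ℍ) :
    f (γ • τ) = ((γ 1 0 : ℤ) * (τ : ℂ) + (γ 1 1 : ℤ)) ^ k * f τ := by
  have := SlashInvariantForm.slash_action_eqn'' f (γ := Matrix.SpecialLinearGroup.mapGL ℝ γ)
    (MonoidHom.mem_range.2 ⟨γ, rfl⟩) τ
  rw [show Matrix.SpecialLinearGroup.mapGL ℝ γ • τ = γ • τ from rfl] at this
  simpa [UpperHalfPlane.denom, UpperHalfPlane.σ] using this

lemma cuspForm_S {k : ℤ} (f : CuspForm 𝒮ℒ k) (τ : ℍ) : f (S • τ) = (τ : ℂ) ^ k * f τ := by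
  rw [cuspForm_smul]
  simp [S]

lemma cuspForm_T {k : ℤ} (f : CuspForm 𝒮ℒ k) (τ : ℍ) : f (T • τ) = f τ := by
  rw [cuspForm_smul]
  simp [T]

lemma coe_S_smul (τ : ℍ) : ((S • τ : ℍ) : ℂ) = -1 / τ := by
  rw [UpperHalfPlane.modular_S_smul]
  rw [UpperHalfPlane.coe_mk, inv_neg, neg_div, one_div]

lemma coe_T_smul (τ : ℍ) : ((T • τ : ℍ) : ℂ) = τ + 1 := by
  rw [UpperHalfPlane.modular_T_smul, UpperHalfPlane.coe_vadd, add_comm]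
  simp

omit [Module.Free ℤ Λ] [Module.Finite ℤ Λ] in
lemma PolyData.orbitTerm_T (D : PolyData ι₁) (h : IsFrame B sgn φ) (heven : ∀ x, Even (B x x))
    (ν : ι₁ ⊕ ι₂ → ℝ) {k : ℤ} (f : CuspForm 𝒮ℒ k) (τ : ℍ) (c d : ℤ) :
    D.orbitTerm φ ν k f (T • τ) c d = D.orbitTerm φ ν k f τ c (c + d) := by
  have hi : (T • τ).im = τ.im := by
    rw [← UpperHalfPlane.coe_im, coe_T_smul]
    simp
  rw [orbitTerm, orbitTerm, cuspForm_T, coe_T_smul, D.block_add_one h heven, hi]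

/-- The weights balance: `y^{k+1/2}` contributes `|τ|^{-(2p+5)}`, `f` contributes `τ^{p+2}`, and the
conjugated block contributes `τ̄^{p+2} |τ|`. -/
lemma PolyData.orbitTerm_S (D : PolyData ι₁) (h : IsFrame B sgn φ) (heven : ∀ x, Even (B x x))
    {p : ℕ} (h₁ : Fintype.card ι₁ = 2 * p + 1) (h₂ : Fintype.card ι₂ = 1)
    (ν : ι₁ ⊕ ι₂ → ℝ) {k : ℤ} (hk : k = p + 2) (f : CuspForm 𝒮ℒ k) (τ : ℍ) (c d : ℤ) :
    D.orbitTerm φ ν k f (S • τ) c d = D.orbitTerm φ ν k f τ d (-c) := by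
  have hi : (S • τ).im = τ.im / ‖(τ : ℂ)‖ ^ 2 := by
    rw [← UpperHalfPlane.coe_im, coe_S_smul, im_neg_one_div, Complex.normSq_eq_norm_sq]
    rfl
  have hn : 0 < ‖(τ : ℂ)‖ := norm_pos_iff.2 τ.ne_zero
  have hrp : (τ.im / ‖(τ : ℂ)‖ ^ 2) ^ ((k : ℝ) + 1 / 2) =
      τ.im ^ ((k : ℝ) + 1 / 2) / (‖(τ : ℂ)‖ ^ (2 * p + 5)) := by
    rw [Real.div_rpow τ.im_pos.le (by positivity)]
    congr 1
    rw [← Real.rpow_natCast, ← Real.rpow_natCast, ← Real.rpow_mul hn.le]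
    congr 1
    rw [hk]
    push_cast
    ring
  have hz : (τ : ℂ) ^ k = (τ : ℂ) ^ (p + 2) := by
    rw [hk]
    exact_mod_cast zpow_natCast (τ : ℂ) (p + 2)
  have hcc : (τ : ℂ) ^ (p + 2) * (starRingEnd ℂ) (τ : ℂ) ^ (p + 2) =
      ((‖(τ : ℂ)‖ : ℝ) : ℂ) ^ (2 * p + 4) := by
    rw [← mul_pow, Complex.mul_conj, Complex.normSq_eq_norm_sq]
    push_cast
    ring
  have hn' : ((‖(τ : ℂ)‖ : ℝ) : ℂ) ≠ 0 := by exact_mod_cast hn.ne'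
  rw [orbitTerm, orbitTerm, cuspForm_S, coe_S_smul,
    D.block_neg_one_div h heven h₁ h₂ ν τ.im_pos, hi, hrp, hz, Complex.ofReal_div]
  generalize τ.im ^ ((k : ℝ) + 1 / 2) = t
  simp only [map_mul, map_pow, Complex.conj_ofReal]
  push_cast
  field_simp
  linear_combination (t : ℂ) * f τ * ((‖(τ : ℂ)‖ : ℝ) : ℂ) *
    (starRingEnd ℂ) (D.block φ ν τ d (-c)) * hcc

/-- The unfolded integrand is invariant under the simultaneous action of `SL₂(ℤ)`. -/
lemma PolyData.orbitTerm_smul (D : PolyData ι₁) (h : IsFrame B sgn φ)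
    (heven : ∀ x, Even (B x x)) {p : ℕ} (h₁ : Fintype.card ι₁ = 2 * p + 1)
    (h₂ : Fintype.card ι₂ = 1) (ν : ι₁ ⊕ ι₂ → ℝ) {k : ℤ} (hk : k = p + 2) (f : CuspForm 𝒮ℒ k)
    (γ : SL(2, ℤ)) (τ : ℍ) (c d : ℤ) :
    D.orbitTerm φ ν k f (γ • τ) c d =
      D.orbitTerm φ ν k f τ (c * γ 0 0 + d * γ 1 0) (c * γ 0 1 + d * γ 1 1) := by
  have hmem : γ ∈ Subgroup.closure {S, T} := by
    rw [SpecialLinearGroup.SL2Z_generators]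
    trivial
  induction hmem using Subgroup.closure_induction generalizing τ c d with
  | mem x hx =>
    rcases hx with rfl | rfl
    · rw [D.orbitTerm_S h heven h₁ h₂ ν hk]
      simp [S]
    · rw [D.orbitTerm_T h heven ν]
      simp [T]
  | one => simp
  | mul x y _ _ hx hy =>
    rw [mul_smul, hx, hy]
    simp only [Matrix.SpecialLinearGroup.coe_mul, Matrix.mul_apply, Fin.sum_univ_two]
    congr 1 <;> ring
  | inv x _ hx =>
    -- The case of `x` at the point `x⁻¹ • τ` and the row `(c, d) x⁻¹`, which multiplication by `x`
    -- carries back to `(c, d)`.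
    have key := hx (x⁻¹ • τ) (c * (x⁻¹) 0 0 + d * (x⁻¹) 1 0) (c * (x⁻¹) 0 1 + d * (x⁻¹) 1 1)
    rw [smul_inv_smul] at key
    have hdet := Matrix.det_fin_two x.1
    rw [x.2] at hdet
    rw [key]
    simp only [Matrix.SpecialLinearGroup.SL2_inv_expl]
    simp only [Matrix.cons_val', Matrix.cons_val_zero, Matrix.cons_val_one]
    congr 1
    · linear_combination c * hdet
    · linear_combination d * hdet

end Modular

/-! ### Nonzero integral pairs and cosets of `Γ_∞` -/

section Unfolding

open ModularGroup

lemma T_zpow_mul_bottom (n : ℤ) (γ : SL(2, ℤ)) : (T ^ n * γ) 1 = γ 1 := by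
  ext j
  rw [Matrix.SpecialLinearGroup.coe_mul, coe_T_zpow, Matrix.mul_apply]
  simp

/-- If the bottom rows agree, `γ' * γ⁻¹` is upper triangular unipotent, hence a power of `T`. -/
lemma rightRel_gammaInf_iff (γ γ' : SL(2, ℤ)) :
    QuotientGroup.rightRel gammaInf γ γ' ↔ γ 1 0 = γ' 1 0 ∧ γ 1 1 = γ' 1 1 := by
  rw [QuotientGroup.rightRel_apply, gammaInf, Subgroup.mem_zpowers_iff]
  constructor
  · rintro ⟨n, hn⟩
    have : γ' = T ^ n * γ := by rw [hn, inv_mul_cancel_right]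
    rw [this, T_zpow_mul_bottom]
    exact ⟨rfl, rfl⟩
  · rintro ⟨h0, h1⟩
    have hd := Matrix.det_fin_two γ.1
    have hd' := Matrix.det_fin_two γ'.1
    rw [γ.2] at hd
    rw [γ'.2] at hd'
    -- The exponent is the upper right entry of `γ' * γ⁻¹`.
    refine ⟨γ' 0 1 * γ 0 0 - γ' 0 0 * γ 0 1, ?_⟩
    ext i j
    rw [coe_T_zpow, Matrix.SpecialLinearGroup.coe_mul, Matrix.mul_apply,
      Matrix.SpecialLinearGroup.SL2_inv_expl]
    fin_cases i <;> fin_cases j <;> simp [Fin.sum_univ_two]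
    · rw [h0, h1]
      linear_combination hd'
    · ring
    · rw [h0, h1]
      ring
    · rw [← h0, ← h1]
      linear_combination hd

/-- A nonzero integral vector is a positive multiple of the bottom row of a matrix, unique up to
`Γ_∞`. -/
def cosetVector (t : Cosets × ℕ+) : {v : ℤ × ℤ // v ≠ 0} :=
  Quotient.lift (fun γ : SL(2, ℤ) => (⟨((t.2 : ℤ) * γ 1 0, (t.2 : ℤ) * γ 1 1), by
    intro h
    have h0 := congrArg Prod.fst h
    have h1 := congrArg Prod.snd h
    have ht : (t.2 : ℤ) ≠ 0 := by exact_mod_cast t.2.ne_zero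
    simp only [Prod.fst_zero, Prod.snd_zero, mul_eq_zero, ht, false_or] at h0 h1
    have hd := Matrix.det_fin_two γ.1
    rw [γ.2, h0, h1] at hd
    simp at hd⟩ : {v : ℤ × ℤ // v ≠ 0}))
    (fun γ γ' h => by
      obtain ⟨h0, h1⟩ := (rightRel_gammaInf_iff γ γ').1 h
      simp only [h0, h1]) t.1

lemma cosetVector_mk (γ : SL(2, ℤ)) (r : ℕ+) :
    (cosetVector (Quotient.mk _ γ, r) : ℤ × ℤ) = ((r : ℤ) * γ 1 0, (r : ℤ) * γ 1 1) := rfl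

lemma gcd_bottom (γ : SL(2, ℤ)) (r : ℕ+) : Int.gcd ((r : ℤ) * γ 1 0) ((r : ℤ) * γ 1 1) = r := by
  have h1 : Int.gcd (γ 1 0) (γ 1 1) = 1 := by
    rw [← Int.isCoprime_iff_gcd_eq_one]
    exact bottom_row_coprime γ
  rw [Int.gcd_mul_left, h1]
  simp

/-- A bottom row is primitive, so the gcd of the vector recovers `r` and division by it recovers the
row, which determines the coset. Conversely every coprime pair is a bottom row. -/
lemma cosetVector_bijective : Function.Bijective cosetVector := by
  constructor
  · rintro ⟨c, r⟩ ⟨c', r'⟩ h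
    induction c using Quotient.inductionOn with | _ γ
    induction c' using Quotient.inductionOn with | _ γ'
    have hv := congrArg Subtype.val h
    rw [cosetVector_mk, cosetVector_mk, Prod.mk.injEq] at hv
    have hr : r = r' := by
      apply PNat.coe_injective
      rw [← gcd_bottom γ r, ← gcd_bottom γ' r', hv.1, hv.2]
    subst hr
    have hr0 : (r : ℤ) ≠ 0 := by exact_mod_cast r.ne_zero
    refine Prod.ext (Quotient.sound ?_) rfl
    exact (rightRel_gammaInf_iff γ γ').2
      ⟨mul_left_cancel₀ hr0 hv.1, mul_left_cancel₀ hr0 hv.2⟩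
  · rintro ⟨⟨c, d⟩, hv⟩
    have hg : 0 < Int.gcd c d := by
      rw [Nat.pos_iff_ne_zero, Ne, Int.gcd_eq_zero_iff]
      rintro ⟨rfl, rfl⟩
      exact hv rfl
    obtain ⟨c', d', hco, hc, hd⟩ := Int.exists_gcd_one hg
    obtain ⟨γ, -, hγ⟩ := bottom_row_surj (R := ℤ) (a := ![c', d'])
      (by simpa using Int.isCoprime_iff_gcd_eq_one.2 hco)
    refine ⟨(Quotient.mk _ γ, Nat.toPNat (Int.gcd c d) hg), Subtype.ext ?_⟩
    rw [cosetVector_mk, show ((Nat.toPNat (Int.gcd c d) hg : ℕ+) : ℕ) = Int.gcd c d from rfl]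
    have h0 : γ 1 0 = c' := congrFun hγ 0
    have h1 : γ 1 1 = d' := congrFun hγ 1
    rw [h0, h1, Prod.mk.injEq]
    refine ⟨?_, ?_⟩
    · conv_rhs => rw [hc]
      exact mul_comm _ _
    · conv_rhs => rw [hd]
      exact mul_comm _ _

/-- A series over `ℤ²` as a series over `Γ_∞ \ SL₂(ℤ)`. -/
lemma exists_tsum_cosets {G : ℤ × ℤ → ℂ} (hG : Summable G) :
    (∀ γ : SL(2, ℤ), Summable fun r : ℕ+ => G ((r : ℤ) * γ 1 0, (r : ℤ) * γ 1 1)) ∧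
    ∃ H : Cosets → ℂ,
      (∀ γ : SL(2, ℤ), H (Quotient.mk _ γ) = ∑' r : ℕ+, G ((r : ℤ) * γ 1 0, (r : ℤ) * γ 1 1)) ∧
      Summable H ∧ ∑' v, G v = G 0 + ∑' c, H c := by
  have h1 : Summable fun t : Cosets × ℕ+ => G (cosetVector t) :=
    (hG.subtype {v | v ≠ 0}).comp_injective cosetVector_bijective.injective
  refine ⟨fun γ => (h1.prod_factor (Quotient.mk _ γ)).congr fun r => by rw [cosetVector_mk],
    fun c => ∑' r : ℕ+, G (cosetVector (c, r)), fun γ => ?_, h1.prod, ?_⟩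
  · simp only [cosetVector_mk]
  · rw [← h1.tsum_prod, hG.tsum_eq_add_tsum_ite 0]
    congr 1
    have e := (Equiv.ofBijective _ cosetVector_bijective).tsum_eq
      (fun v : {v : ℤ × ℤ // v ≠ 0} => G v)
    simp only [Equiv.ofBijective_apply] at e
    rw [e]
    refine Eq.trans ?_ (tsum_subtype {v : ℤ × ℤ | v ≠ 0} G).symm
    refine tsum_congr fun v => ?_
    by_cases hv : v = 0 <;> simp [hv, Set.indicator]

end Unfolding

/-! ### The Laplacian and the polynomials `P_{w,h⁺,0}` -/

section Polynomials

open MvPolynomial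

variable {b : ℕ}

/-- The linear form with the given coefficients. -/
def linPol (w : Fin b ⊕ Fin 2 → ℝ) : MvPolynomial (Fin b ⊕ Fin 2) ℝ := ∑ i, C (w i) * X i

lemma eval_linPol (w x : Fin b ⊕ Fin 2 → ℝ) : eval x (linPol w) = ∑ i, w i * x i := by
  simp [linPol]

lemma pderiv_linPol (w : Fin b ⊕ Fin 2 → ℝ) (j : Fin b ⊕ Fin 2) :
    pderiv j (linPol w) = C (w j) := by
  classical
  rw [linPol, map_sum, Finset.sum_eq_single j]
  · simp
  · intro i _ hi
    simp [pderiv_X_of_ne hi]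
  · simp

lemma X_eq_linPol (j : Fin b ⊕ Fin 2) :
    (X j : MvPolynomial (Fin b ⊕ Fin 2) ℝ) = linPol (Pi.single j 1) := by
  classical
  rw [linPol, Finset.sum_eq_single j]
  · simp
  · intro i _ hi
    simp [hi]
  · simp

lemma laplacian_linPol_mul (a : ℝ) (w w' : Fin b ⊕ Fin 2 → ℝ) :
    laplacian (C a * (linPol w * linPol w')) = C (2 * a * ∑ i, w i * w' i) := by
  rw [laplacian, Finset.mul_sum, map_sum]
  refine Finset.sum_congr rfl fun i _ => ?_
  simp only [Derivation.leibniz, pderiv_linPol, pderiv_C, smul_eq_mul, map_add, map_mul, mul_zero,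
    add_zero, map_ofNat, zero_add]
  ring

lemma laplacian_linPol (w : Fin b ⊕ Fin 2 → ℝ) : laplacian (linPol w) = 0 := by
  simp [laplacian, pderiv_linPol]

lemma laplacian_C (a : ℝ) : laplacian (C a : MvPolynomial (Fin b ⊕ Fin 2) ℝ) = 0 := by
  simp [laplacian]

lemma laplacian_zero : laplacian (0 : MvPolynomial (Fin b ⊕ Fin 2) ℝ) = 0 := by
  simp [laplacian]

/-- `exp (-Δ / 8πy)` on polynomials with constant Laplacian. -/
lemma eval_expLaplacian (y : ℝ) {P : MvPolynomial (Fin b ⊕ Fin 2) ℝ} {a : ℝ}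
    (hP : laplacian P = C a) (x : Fin b ⊕ Fin 2 → ℝ) :
    eval x (expLaplacian y P) = eval x P - a / (8 * Real.pi * y) := by
  have h2 : ∀ m, laplacian^[m + 2] P = 0 := by
    intro m
    rw [Function.iterate_add_apply]
    have : laplacian^[2] P = 0 := by
      rw [Function.iterate_succ_apply, Function.iterate_one, hP, laplacian_C]
    rw [this]
    exact Function.iterate_fixed laplacian_zero m
  rw [expLaplacian]
  -- In degree `0` the sum defining `expLaplacian` stops before `m = 1`, but then `a = 0`. In
  -- positive degree both `m = 0` and `m = 1` occur, and all later terms vanish.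
  rcases Nat.eq_zero_or_pos P.totalDegree with h0 | h0
  · rw [h0, zero_add, Finset.sum_range_one]
    obtain ⟨c, rfl⟩ : ∃ c, P = C c := ⟨_, (totalDegree_eq_zero_iff_eq_C).1 h0⟩
    rw [laplacian_C] at hP
    have ha : a = 0 := by simpa using hP.symm
    simp [ha]
  · obtain ⟨n, hn⟩ := Nat.exists_eq_add_of_lt h0
    rw [show P.totalDegree + 1 = n + 1 + 1 by omega, Finset.sum_range_succ',
      Finset.sum_range_succ', Finset.sum_eq_zero fun m _ => by rw [h2, smul_zero]]
    simp [hP, div_eq_mul_inv]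
    ring

lemma laplacian_polAB (α β : Fin b) :
    laplacian (polAB α β) = C (4 * if α = β then 1 else 0) := by
  have : polAB α β = C 2 * (linPol (Pi.single (Sum.inl α) 1) * linPol (Pi.single (Sum.inl β) 1)) := by
    rw [polAB, ← X_eq_linPol, ← X_eq_linPol, mul_assoc, map_ofNat]
  rw [this, laplacian_linPol_mul]
  congr 1
  rw [Finset.sum_eq_single (Sum.inl α)]
  · by_cases h : α = β
    · subst h
      norm_num
    · have h' : (Sum.inl α : Fin b ⊕ Fin 2) ≠ Sum.inl β := fun e => h (Sum.inl.inj e)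
      simp [h, h']
  · intro i _ hi
    simp [hi]
  · simp

lemma eval_polAB (α β : Fin b) (x : Fin b ⊕ Fin 2 → ℝ) :
    eval x (polAB α β) = 2 * x (Sum.inl α) * x (Sum.inl β) := by
  simp [polAB]

section Split

lemma coeff_quadratic_zero {R : Type*} [CommRing R] (p q r : R) :
    (Polynomial.C p + Polynomial.C q * Polynomial.X +
      Polynomial.C r * Polynomial.X ^ 2).coeff 0 = p := by
  simp

lemma coeff_quadratic_one {R : Type*} [CommRing R] (p q r : R) :
    (Polynomial.C p + Polynomial.C q * Polynomial.X +
      Polynomial.C r * Polynomial.X ^ 2).coeff 1 = q := by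
  simp only [Polynomial.coeff_add, Polynomial.coeff_C_mul, Polynomial.coeff_X_pow]
  simp

lemma coeff_quadratic_two {R : Type*} [CommRing R] (p q r : R) :
    (Polynomial.C p + Polynomial.C q * Polynomial.X +
      Polynomial.C r * Polynomial.X ^ 2).coeff 2 = r := by
  simp only [Polynomial.coeff_add, Polynomial.coeff_C_mul, Polynomial.coeff_X_pow]
  simp [Polynomial.coeff_X]

variable {V : Type*} [AddCommGroup V] [Module ℝ V]
  (Q : LinearMap.BilinForm ℝ V) (e : Module.Basis (Fin b ⊕ Fin 2) ℝ V) (g : V ≃ₗ[ℝ] V) (u : V)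

/-- The row of the matrix of `wProjCoords`. -/
def wRow (α : Fin b) (i : Fin b ⊕ Fin 2) : ℝ := wProjCoords Q e g u (Pi.single i 1) (Sum.inl α)

/-- The coordinates of `u_{z^⊥} / u_{z^⊥}²`. -/
def uCoeff (α : Fin b) : ℝ :=
  coords e (g (uPos Q e g u)) (Sum.inl α) / Q (uPos Q e g u) (uPos Q e g u)

/-- The vector `g(u_z)` has no coordinates in the positive directions, so the inner variable does
not occur and `splitPol` is a quadratic polynomial in the outer one. -/
lemma polW_polAB (α β : Fin b) (hα : coords e (g (uNeg Q e g u)) (Sum.inl α) = 0)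
    (hβ : coords e (g (uNeg Q e g u)) (Sum.inl β) = 0) :
    polW Q e g u (polAB α β) 0 0 = C 2 * (linPol (wRow Q e g u α) * linPol (wRow Q e g u β)) ∧
    polW Q e g u (polAB α β) 1 0 =
      linPol ((2 * uCoeff Q e g u β) • wRow Q e g u α + (2 * uCoeff Q e g u α) • wRow Q e g u β) ∧
    polW Q e g u (polAB α β) 2 0 = C (2 * uCoeff Q e g u α * uCoeff Q e g u β) := by
  have key : splitPol Q e g u (polAB α β) =
      Polynomial.C (Polynomial.C (C 2 * (linPol (wRow Q e g u α) * linPol (wRow Q e g u β)))) +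
      Polynomial.C (Polynomial.C (linPol ((2 * uCoeff Q e g u β) • wRow Q e g u α +
        (2 * uCoeff Q e g u α) • wRow Q e g u β))) * Polynomial.X +
      Polynomial.C (Polynomial.C (C (2 * uCoeff Q e g u α * uCoeff Q e g u β))) *
        Polynomial.X ^ 2 := by
    have hl : linPol ((2 * uCoeff Q e g u β) • wRow Q e g u α +
        (2 * uCoeff Q e g u α) • wRow Q e g u β) =
        C (2 * uCoeff Q e g u β) * linPol (wRow Q e g u α) +
        C (2 * uCoeff Q e g u α) * linPol (wRow Q e g u β) := by
      simp only [linPol, Finset.mul_sum, ← Finset.sum_add_distrib]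
      refine Finset.sum_congr rfl fun i _ => ?_
      simp only [Pi.add_apply, Pi.smul_apply, smul_eq_mul, map_add, map_mul]
      ring
    rw [hl, splitPol, polAB]
    simp only [map_mul, aeval_X, hα, hβ, zero_div, map_zero, zero_mul, add_zero]
    rw [← linPol.eq_def (fun i => wProjCoords Q e g u (Pi.single i 1) (Sum.inl α)),
      ← linPol.eq_def (fun i => wProjCoords Q e g u (Pi.single i 1) (Sum.inl β))]
    change _ * (Polynomial.C (Polynomial.C (linPol (wRow Q e g u α))) +
      Polynomial.C (Polynomial.C (C (uCoeff Q e g u α))) * Polynomial.X) *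
      (Polynomial.C (Polynomial.C (linPol (wRow Q e g u β))) +
      Polynomial.C (Polynomial.C (C (uCoeff Q e g u β))) * Polynomial.X) = _
    simp only [map_mul, map_add, map_ofNat]
    ring
  rw [polW, polW, polW, key, coeff_quadratic_zero, coeff_quadratic_one, coeff_quadratic_two]
  simp only [Polynomial.coeff_C_zero, and_self]

end Split

end Polynomials

/-! ### Characterisation and calculus of orthogonal projections -/

section Projections

variable {V : Type*} [AddCommGroup V] [Module ℝ V] {Q : LinearMap.BilinForm ℝ V}

/-- `π` is the orthogonal projection onto `W`. -/
structure IsOrthProj (Q : LinearMap.BilinForm ℝ V) (W : Submodule ℝ V) (π : V →ₗ[ℝ] V) : Prop where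
  mem : ∀ v, π v ∈ W
  orth : ∀ v, ∀ w ∈ W, Q w v = Q w (π v)

/-- The existence of `π` gives `W + W^⊥ = V`, and nondegeneracy of the form gives `W ∩ W^⊥ = 0`; so
`orthProj` takes its nondefault branch. -/
lemma IsOrthProj.orthProj_eq {W : Submodule ℝ V} {π : V →ₗ[ℝ] V} (h : IsOrthProj Q W π)
    (hsymm : ∀ x y, Q x y = Q y x) (hQ : ∀ x, (∀ y, Q x y = 0) → x = 0) :
    orthProj Q W = π := by
  have hm : ∀ v, v - π v ∈ Q.orthogonal W := fun v w hw => by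
    rw [map_sub, sub_eq_zero]
    exact h.orth v w hw
  have hc : IsCompl W (Q.orthogonal W) := by
    refine ⟨Submodule.disjoint_def.2 fun x hx hx' => hQ x fun y => ?_,
      codisjoint_iff.2 (eq_top_iff.2 fun v _ => ?_)⟩
    · rw [h.orth y x hx, hsymm]
      exact hx' _ (h.mem y)
    · rw [← add_sub_cancel (π v) v]
      exact Submodule.add_mem_sup (h.mem v) (hm v)
  rw [orthProj, dif_pos hc]
  ext v
  conv_lhs => rw [← add_sub_cancel (π v) v, map_add]
  rw [Submodule.projection_apply_of_mem_left hc (h.mem v),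
    Submodule.projection_apply_of_mem_right hc (hm v), add_zero]

/-- One Gram–Schmidt step: the component along `a` is subtracted. -/
lemma IsOrthProj.inf_span {W : Submodule ℝ V} {π : V →ₗ[ℝ] V} (h : IsOrthProj Q W π)
    (hsymm : ∀ x y, Q x y = Q y x) {a : V} (ha : a ∈ W) (haa : Q a a ≠ 0) :
    IsOrthProj Q (W ⊓ Q.orthogonal (ℝ ∙ a)) (π - ((Q a a)⁻¹ • Q a).smulRight a) := by
  constructor
  · intro v
    refine ⟨W.sub_mem (h.mem v) (W.smul_mem _ ha), ?_⟩
    rintro _ hw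
    obtain ⟨c, rfl⟩ := Submodule.mem_span_singleton.1 hw
    simp only [LinearMap.sub_apply, LinearMap.smulRight_apply, LinearMap.smul_apply, map_smul,
      smul_eq_mul, map_sub, ← h.orth v a ha]
    field_simp
    ring
  · rintro v w ⟨hw, hw'⟩
    have : Q w a = 0 := by
      rw [hsymm]
      exact hw' a (Submodule.mem_span_singleton_self a)
    simp [h.orth v w hw, this]

lemma IsOrthProj.sup {W W' : Submodule ℝ V} {π π' : V →ₗ[ℝ] V} (h : IsOrthProj Q W π)
    (h' : IsOrthProj Q W' π') (hsymm : ∀ x y, Q x y = Q y x)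
    (hW : ∀ x ∈ W, ∀ y ∈ W', Q x y = 0) : IsOrthProj Q (W ⊔ W') (π + π') := by
  constructor
  · exact fun v => Submodule.add_mem_sup (h.mem v) (h'.mem v)
  · intro v w hw
    obtain ⟨x, hx, y, hy, rfl⟩ := Submodule.mem_sup.1 hw
    simp only [map_add, LinearMap.add_apply, h.orth v x hx, h'.orth v y hy]
    rw [hW x hx _ (h'.mem v), hsymm y (π v), hW _ (h.mem v) y hy]
    ring

end Projections

/-! ### The subspaces `z`, `z^⊥`, `w`, `w^⊥` in coordinates -/

section Geometry

variable {b : ℕ} {V : Type*} [AddCommGroup V] [Module ℝ V]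
  {Q : LinearMap.BilinForm ℝ V} {e : Module.Basis (Fin b ⊕ Fin 2) ℝ V} {g : V ≃ₗ[ℝ] V}

/-- The isometry `g₀ ∘ g`. -/
def gCoords (e : Module.Basis (Fin b ⊕ Fin 2) ℝ V) (g : V ≃ₗ[ℝ] V) :
    V ≃ₗ[ℝ] (Fin b ⊕ Fin 2 → ℝ) := g.trans (coords e)

lemma gCoords_apply (v : V) : gCoords e g v = coords e (g v) := rfl

lemma stdForm_eq_sub {ι₁ ι₂ : Type*} [Fintype ι₁] [Fintype ι₂] (x y : ι₁ ⊕ ι₂ → ℝ) :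
    stdForm x y = ∑ i, x (Sum.inl i) * y (Sum.inl i) - ∑ i, x (Sum.inr i) * y (Sum.inr i) := by
  rw [stdForm, Fintype.sum_sum_type]
  simp [sgn, sub_eq_add_neg]

lemma form_eq (he : IsStandardBasis Q e) (hg : IsIsometry Q g) (v v' : V) :
    Q v v' = stdForm (gCoords e g v) (gCoords e g v') := by
  classical
  obtain ⟨h1, h2, h3⟩ := he
  rw [← hg v v', ← e.sum_equivFun (g v), ← e.sum_equivFun (g v')]
  simp only [map_sum, LinearMap.sum_apply, map_smul, LinearMap.smul_apply, smul_eq_mul]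
  rw [stdForm]
  refine Finset.sum_congr rfl fun i _ => ?_
  rw [Finset.sum_eq_single i]
  · have : Q (e i) (e i) = sgn i := by
      rcases i with i | i <;> simp [sgn, h1, h2]
    rw [this]
    simp only [gCoords_apply, coords]
    ring
  · intro j _ hj
    rw [h3 j i hj]
    ring
  · simp

lemma form_symm (he : IsStandardBasis Q e) (hg : IsIsometry Q g) (v v' : V) : Q v v' = Q v' v := by
  rw [form_eq he hg, form_eq he hg v']
  refine Finset.sum_congr rfl fun i _ => by ring

lemma form_nondegenerate (he : IsStandardBasis Q e) (hg : IsIsometry Q g) (v : V)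
    (hv : ∀ v', Q v v' = 0) : v = 0 := by
  classical
  apply (gCoords e g).injective
  rw [map_zero]
  ext i
  have := hv ((gCoords e g).symm (Pi.single i 1))
  rw [form_eq he hg, LinearEquiv.apply_symm_apply, stdForm, Finset.sum_eq_single i] at this
  · rcases i with i | i <;> simpa [sgn] using this
  · intro j _ hj
    simp [hj]
  · simp

lemma mem_negPlane (v : V) : v ∈ negPlane e g ↔ ∀ i, gCoords e g v (Sum.inl i) = 0 := by
  rw [negPlane, Submodule.mem_map_equiv, LinearEquiv.symm_symm, basePlane]
  constructor
  · intro h i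
    rw [gCoords_apply]
    generalize g v = w at h
    induction h using Submodule.span_induction with
    | mem x hx =>
      obtain ⟨j, rfl⟩ := hx
      simp [coords]
    | zero => simp
    | add x y _ _ hx hy => rw [map_add, Pi.add_apply, hx, hy, add_zero]
    | smul a x _ hx => rw [map_smul, Pi.smul_apply, hx, smul_zero]
  · intro h
    rw [← e.sum_equivFun (g v), Fintype.sum_sum_type]
    refine Submodule.add_mem _ ?_ (Submodule.sum_mem _ fun i _ => Submodule.smul_mem _ _
      (Submodule.subset_span ⟨i, rfl⟩))
    refine Submodule.sum_mem _ fun i _ => ?_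
    have := h i
    rw [gCoords_apply, coords] at this
    rw [this, zero_smul]
    exact Submodule.zero_mem _

lemma mem_posSpace (he : IsStandardBasis Q e) (hg : IsIsometry Q g) (v : V) :
    v ∈ posSpace Q e g ↔ ∀ i, gCoords e g v (Sum.inr i) = 0 := by
  classical
  rw [posSpace, LinearMap.BilinForm.mem_orthogonal_iff]
  constructor
  · intro h i
    have := h ((gCoords e g).symm (Pi.single (Sum.inr i) 1)) (by
      rw [mem_negPlane, LinearEquiv.apply_symm_apply]
      simp)
    rw [form_eq he hg, LinearEquiv.apply_symm_apply, stdForm_eq_sub] at this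
    simpa [Pi.single_apply] using this
  · intro h w hw
    rw [mem_negPlane] at hw
    rw [form_eq he hg, stdForm_eq_sub]
    simp [h, hw]

/-- The coordinate projection onto the positive definite part. -/
def posCoords : (Fin b ⊕ Fin 2 → ℝ) →ₗ[ℝ] (Fin b ⊕ Fin 2 → ℝ) :=
  LinearMap.pi (Sum.elim (fun i => LinearMap.proj (Sum.inl i)) fun _ => 0)

/-- The coordinate projection onto the negative definite part. -/
def negCoords : (Fin b ⊕ Fin 2 → ℝ) →ₗ[ℝ] (Fin b ⊕ Fin 2 → ℝ) :=
  LinearMap.pi (Sum.elim (fun _ => 0) fun i => LinearMap.proj (Sum.inr i))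

/-- The projection to `z^⊥`. -/
def posProj (e : Module.Basis (Fin b ⊕ Fin 2) ℝ V) (g : V ≃ₗ[ℝ] V) : V →ₗ[ℝ] V :=
  (gCoords e g).symm.toLinearMap ∘ₗ posCoords ∘ₗ (gCoords e g).toLinearMap

/-- The projection to `z`. -/
def negProj (e : Module.Basis (Fin b ⊕ Fin 2) ℝ V) (g : V ≃ₗ[ℝ] V) : V →ₗ[ℝ] V :=
  (gCoords e g).symm.toLinearMap ∘ₗ negCoords ∘ₗ (gCoords e g).toLinearMap

lemma gCoords_posProj_inl (v : V) (i : Fin b) :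
    gCoords e g (posProj e g v) (Sum.inl i) = gCoords e g v (Sum.inl i) := by
  simp [posProj, posCoords]

lemma gCoords_posProj_inr (v : V) (i : Fin 2) : gCoords e g (posProj e g v) (Sum.inr i) = 0 := by
  simp [posProj, posCoords]

lemma gCoords_negProj_inl (v : V) (i : Fin b) : gCoords e g (negProj e g v) (Sum.inl i) = 0 := by
  simp [negProj, negCoords]

lemma gCoords_negProj_inr (v : V) (i : Fin 2) :
    gCoords e g (negProj e g v) (Sum.inr i) = gCoords e g v (Sum.inr i) := by
  simp [negProj, negCoords]

lemma isOrthProj_posProj (he : IsStandardBasis Q e) (hg : IsIsometry Q g) :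
    IsOrthProj Q (posSpace Q e g) (posProj e g) := by
  constructor
  · exact fun v => (mem_posSpace he hg _).2 (gCoords_posProj_inr v)
  · intro v w hw
    rw [mem_posSpace he hg] at hw
    simp [form_eq he hg, stdForm_eq_sub, hw, gCoords_posProj_inl]

lemma isOrthProj_negProj (he : IsStandardBasis Q e) (hg : IsIsometry Q g) :
    IsOrthProj Q (negPlane e g) (negProj e g) := by
  constructor
  · exact fun v => (mem_negPlane _).2 (gCoords_negProj_inl v)
  · intro v w hw
    rw [mem_negPlane] at hw
    simp [form_eq he hg, stdForm_eq_sub, hw, gCoords_negProj_inr]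

lemma orthProj_posSpace (he : IsStandardBasis Q e) (hg : IsIsometry Q g) :
    orthProj Q (posSpace Q e g) = posProj e g :=
  (isOrthProj_posProj he hg).orthProj_eq (form_symm he hg) (form_nondegenerate he hg)

lemma orthProj_negPlane (he : IsStandardBasis Q e) (hg : IsIsometry Q g) :
    orthProj Q (negPlane e g) = negProj e g :=
  (isOrthProj_negProj he hg).orthProj_eq (form_symm he hg) (form_nondegenerate he hg)

lemma form_posSpace_negPlane (he : IsStandardBasis Q e) (hg : IsIsometry Q g) {x y : V}
    (hx : x ∈ posSpace Q e g) (hy : y ∈ negPlane e g) : Q x y = 0 := by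
  rw [form_symm he hg]
  exact hx y hy

variable {u : V}

lemma form_uPos (he : IsStandardBasis Q e) (hg : IsIsometry Q g) (v : V) :
    Q (uPos Q e g u) v = ∑ i, gCoords e g u (Sum.inl i) * gCoords e g v (Sum.inl i) := by
  rw [uPos, orthProj_posSpace he hg, form_eq he hg, stdForm_eq_sub]
  simp [gCoords_posProj_inl, gCoords_posProj_inr]

lemma form_uNeg (he : IsStandardBasis Q e) (hg : IsIsometry Q g) (v : V) :
    Q (uNeg Q e g u) v = -∑ i, gCoords e g u (Sum.inr i) * gCoords e g v (Sum.inr i) := by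
  rw [uNeg, orthProj_negPlane he hg, form_eq he hg, stdForm_eq_sub]
  simp [gCoords_negProj_inl, gCoords_negProj_inr]

lemma form_uPos_add_uNeg (he : IsStandardBasis Q e) (hg : IsIsometry Q g) (v : V) :
    Q (uPos Q e g u) v + Q (uNeg Q e g u) v = Q u v := by
  rw [form_uPos he hg, form_uNeg he hg, form_eq he hg, stdForm_eq_sub]
  ring

lemma gCoords_uPos_inl (he : IsStandardBasis Q e) (hg : IsIsometry Q g) (i : Fin b) :
    gCoords e g (uPos Q e g u) (Sum.inl i) = gCoords e g u (Sum.inl i) := by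
  rw [uPos, orthProj_posSpace he hg, gCoords_posProj_inl]

lemma gCoords_uPos_inr (he : IsStandardBasis Q e) (hg : IsIsometry Q g) (i : Fin 2) :
    gCoords e g (uPos Q e g u) (Sum.inr i) = 0 := by
  rw [uPos, orthProj_posSpace he hg, gCoords_posProj_inr]

lemma gCoords_uNeg_inl (he : IsStandardBasis Q e) (hg : IsIsometry Q g) (i : Fin b) :
    gCoords e g (uNeg Q e g u) (Sum.inl i) = 0 := by
  rw [uNeg, orthProj_negPlane he hg, gCoords_negProj_inl]

lemma gCoords_uNeg_inr (he : IsStandardBasis Q e) (hg : IsIsometry Q g) (i : Fin 2) :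
    gCoords e g (uNeg Q e g u) (Sum.inr i) = gCoords e g u (Sum.inr i) := by
  rw [uNeg, orthProj_negPlane he hg, gCoords_negProj_inr]

lemma form_uPos_self (he : IsStandardBasis Q e) (hg : IsIsometry Q g) :
    Q (uPos Q e g u) (uPos Q e g u) = ∑ i, gCoords e g u (Sum.inl i) ^ 2 := by
  rw [form_uPos he hg]
  simp only [gCoords_uPos_inl he hg, sq]

lemma form_uNeg_self (he : IsStandardBasis Q e) (hg : IsIsometry Q g) :
    Q (uNeg Q e g u) (uNeg Q e g u) = -∑ i, gCoords e g u (Sum.inr i) ^ 2 := by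
  rw [form_uNeg he hg]
  simp only [gCoords_uNeg_inr he hg, sq]

lemma sum_sq_inr_eq (he : IsStandardBasis Q e) (hg : IsIsometry Q g) (hu : Q u u = 0) :
    ∑ i, gCoords e g u (Sum.inr i) ^ 2 = Q (uPos Q e g u) (uPos Q e g u) := by
  rw [form_eq he hg, stdForm_eq_sub] at hu
  rw [form_uPos_self he hg]
  simp only [sq]
  linarith

lemma form_uNeg_self_eq (he : IsStandardBasis Q e) (hg : IsIsometry Q g) (hu : Q u u = 0) :
    Q (uNeg Q e g u) (uNeg Q e g u) = -Q (uPos Q e g u) (uPos Q e g u) := by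
  rw [form_uNeg_self he hg, sum_sq_inr_eq he hg hu]

/-- For isotropic `u` the positive and negative coordinates have equal Euclidean length, so if one
part vanishes, both do, and `u = 0`. -/
lemma form_uPos_pos (he : IsStandardBasis Q e) (hg : IsIsometry Q g) (hu : Q u u = 0)
    (hu0 : u ≠ 0) : 0 < Q (uPos Q e g u) (uPos Q e g u) := by
  have h1 := form_uPos_self he hg (u := u)
  have h0 : 0 ≤ Q (uPos Q e g u) (uPos Q e g u) := by
    rw [h1]
    positivity
  refine lt_of_le_of_ne h0 fun h => hu0 ?_
  have h2 := sum_sq_inr_eq he hg hu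
  rw [← h] at h2
  rw [← h] at h1
  have h1' := (Finset.sum_eq_zero_iff_of_nonneg fun i _ => sq_nonneg _).1 h1.symm
  have h2' := (Finset.sum_eq_zero_iff_of_nonneg fun i _ => sq_nonneg _).1 h2
  apply (gCoords e g).injective
  rw [map_zero]
  ext i
  rcases i with i | i
  · exact pow_eq_zero_iff two_ne_zero |>.1 (h1' i (Finset.mem_univ _))
  · exact pow_eq_zero_iff two_ne_zero |>.1 (h2' i (Finset.mem_univ _))

lemma uPos_mem (he : IsStandardBasis Q e) (hg : IsIsometry Q g) :
    uPos Q e g u ∈ posSpace Q e g :=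
  (mem_posSpace he hg _).2 (gCoords_uPos_inr he hg)

lemma uNeg_mem (he : IsStandardBasis Q e) (hg : IsIsometry Q g) :
    uNeg Q e g u ∈ negPlane e g :=
  (mem_negPlane _).2 (gCoords_uNeg_inl he hg)

lemma orthProj_wPos (he : IsStandardBasis Q e) (hg : IsIsometry Q g)
    (hs : 0 < Q (uPos Q e g u) (uPos Q e g u)) (v : V) :
    orthProj Q (wPos Q e g u) v = posProj e g v -
      (Q (uPos Q e g u) v / Q (uPos Q e g u) (uPos Q e g u)) • uPos Q e g u := by
  rw [wPos, ((isOrthProj_posProj he hg).inf_span (form_symm he hg) (uPos_mem he hg)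
    hs.ne').orthProj_eq (form_symm he hg) (form_nondegenerate he hg)]
  simp [div_eq_inv_mul]

lemma isOrthProj_wNeg (he : IsStandardBasis Q e) (hg : IsIsometry Q g) (hu : Q u u = 0)
    (hs : 0 < Q (uPos Q e g u) (uPos Q e g u)) :
    IsOrthProj Q (wNeg Q e g u) (negProj e g -
      ((Q (uNeg Q e g u) (uNeg Q e g u))⁻¹ • Q (uNeg Q e g u)).smulRight (uNeg Q e g u)) :=
  (isOrthProj_negProj he hg).inf_span (form_symm he hg) (uNeg_mem he hg) (by
    rw [form_uNeg_self_eq he hg hu]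
    linarith)

lemma orthProj_wNeg (he : IsStandardBasis Q e) (hg : IsIsometry Q g) (hu : Q u u = 0)
    (hs : 0 < Q (uPos Q e g u) (uPos Q e g u)) (v : V) :
    orthProj Q (wNeg Q e g u) v = negProj e g v +
      (Q (uNeg Q e g u) v / Q (uPos Q e g u) (uPos Q e g u)) • uNeg Q e g u := by
  rw [(isOrthProj_wNeg he hg hu hs).orthProj_eq (form_symm he hg) (form_nondegenerate he hg)]
  simp [form_uNeg_self_eq he hg hu, div_eq_inv_mul]

lemma orthProj_sup (he : IsStandardBasis Q e) (hg : IsIsometry Q g) (hu : Q u u = 0)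
    (hs : 0 < Q (uPos Q e g u) (uPos Q e g u)) (v : V) :
    orthProj Q (wPos Q e g u ⊔ wNeg Q e g u) v =
      orthProj Q (wPos Q e g u) v + orthProj Q (wNeg Q e g u) v := by
  have h1 := (isOrthProj_posProj he hg).inf_span (form_symm he hg) (uPos_mem (u := u) he hg) hs.ne'
  have h2 := isOrthProj_wNeg he hg hu hs
  have h3 := h1.sup h2 (form_symm he hg) fun x hx y hy =>
    form_posSpace_negPlane he hg hx.1 hy.1
  have e1 := h1.orthProj_eq (form_symm he hg) (form_nondegenerate he hg)
  have e2 := h2.orthProj_eq (form_symm he hg) (form_nondegenerate he hg)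
  have e3 := h3.orthProj_eq (form_symm he hg) (form_nondegenerate he hg)
  rw [wPos, e1, e2, e3, LinearMap.add_apply]

lemma coords_wMap_inl (he : IsStandardBasis Q e) (hg : IsIsometry Q g) (hu : Q u u = 0)
    (hs : 0 < Q (uPos Q e g u) (uPos Q e g u)) (v : V) (i : Fin b) :
    coords e (wMap Q e g u v) (Sum.inl i) = gCoords e g v (Sum.inl i) -
      Q (uPos Q e g u) v / Q (uPos Q e g u) (uPos Q e g u) * gCoords e g u (Sum.inl i) := by
  rw [wMap, LinearMap.comp_apply, LinearEquiv.coe_coe, ← gCoords_apply, orthProj_sup he hg hu hs,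
    orthProj_wPos he hg hs, orthProj_wNeg he hg hu hs]
  simp only [map_add, map_sub, map_smul, Pi.add_apply, Pi.sub_apply, Pi.smul_apply, smul_eq_mul,
    gCoords_posProj_inl, gCoords_negProj_inl, gCoords_uPos_inl he hg, gCoords_uNeg_inl he hg]
  ring

end Geometry

/-! ### Orthonormal coordinates on a hyperplane -/

section Complement

/-- Coordinates on the orthogonal complement of a vector of `ℝⁿ`. -/
lemma exists_complement_matrix {n : ℕ} (p : Fin n → ℝ) (hp : 0 < ∑ i, p i ^ 2) :
    ∃ m, m + 1 = n ∧ ∃ A : Fin m → Fin n → ℝ,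
      ∀ j j', ∑ i, A i j * A i j' = (if j = j' then 1 else 0) - p j * p j' / ∑ i, p i ^ 2 := by
  rcases n with _ | m
  · simp at hp
  refine ⟨m, rfl, ?_⟩
  set s := ∑ i, p i ^ 2 with hs
  set P : EuclideanSpace ℝ (Fin (m + 1)) := WithLp.toLp 2 fun i => p i / √s with hP
  have hPn : ‖P‖ = 1 := by
    rw [EuclideanSpace.norm_eq, Real.sqrt_eq_one]
    simp only [hP, Real.norm_eq_abs, sq_abs, div_pow, Real.sq_sqrt hp.le]
    rw [← Finset.sum_div, ← hs, div_self hp.ne']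
  -- The rows of the matrix are the remaining vectors of an orthonormal basis that begins with `p /
  -- √s`. The Gram identity is Parseval for two standard basis vectors, with the first summand moved
  -- to the right.
  obtain ⟨o, ho⟩ := Orthonormal.exists_orthonormalBasis_extension_of_card_eq (𝕜 := ℝ)
    (E := EuclideanSpace ℝ (Fin (m + 1))) (ι := Fin (m + 1)) (by simp) (v := fun _ => P) (s := {0})
    (by
      constructor
      · intro i
        simpa using hPn
      · intro i j hij
        exact absurd (Subtype.ext (i.2.trans j.2.symm)) hij)
  refine ⟨fun i j => o i.succ j, fun j j' => ?_⟩
  have key := o.sum_inner_mul_inner (EuclideanSpace.single j (1 : ℝ)) (EuclideanSpace.single j' 1)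
  rw [Fin.sum_univ_succ, ho 0 rfl] at key
  simp only [EuclideanSpace.inner_single_left, EuclideanSpace.inner_single_right, hP] at key
  simp only [map_one, one_mul, conj_trivial] at key
  have h2 : p j / √s * (p j' / √s) = p j * p j' / s := by
    rw [div_mul_div_comm, Real.mul_self_sqrt hp.le]
  have h3 : (EuclideanSpace.single j (1 : ℝ) : EuclideanSpace ℝ (Fin (m + 1))) j' =
      if j = j' then 1 else 0 := by
    simp [eq_comm]
  rw [h2, h3] at key
  linarith

lemma sum_mul_complement_matrix {n m : ℕ} {p : Fin n → ℝ} {s : ℝ} {A : Fin m → Fin n → ℝ}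
    (hA : ∀ j j', ∑ i, A i j * A i j' = (if j = j' then 1 else 0) - p j * p j' / s)
    (x y : Fin n → ℝ) :
    ∑ i, (∑ j, A i j * x j) * ∑ j, A i j * y j =
      ∑ j, x j * y j - (∑ j, p j * x j) * (∑ j, p j * y j) / s := by
  have h1 : ∑ i, (∑ j, A i j * x j) * ∑ j, A i j * y j =
      ∑ j, ∑ j', (∑ i, A i j * A i j') * (x j * y j') := by
    simp_rw [Finset.sum_mul_sum]
    rw [Finset.sum_comm]
    refine Finset.sum_congr rfl fun j _ => ?_
    rw [Finset.sum_comm]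
    refine Finset.sum_congr rfl fun j' _ => ?_
    rw [Finset.sum_mul]
    exact Finset.sum_congr rfl fun i _ => by ring
  rw [h1]
  simp only [hA, sub_mul, Finset.sum_sub_distrib, ite_mul, one_mul, zero_mul, Finset.sum_ite_eq,
    Finset.mem_univ, if_true]
  rw [Finset.sum_mul_sum, Finset.sum_div]
  congr 1
  refine Finset.sum_congr rfl fun j _ => ?_
  rw [Finset.sum_div]
  refine Finset.sum_congr rfl fun j' _ => by ring

end Complement

/-! ### Orthonormal coordinates on `w^⊥ ⊕ w` -/

section Frame

variable {b : ℕ} {V : Type*} [AddCommGroup V] [Module ℝ V]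

/-- Orthonormal coordinates on `w^⊥ ⊕ w`. -/
structure WFrame (Q : LinearMap.BilinForm ℝ V) (e : Module.Basis (Fin b ⊕ Fin 2) ℝ V)
    (g : V ≃ₗ[ℝ] V) (u : V) (m₁ m₂ : ℕ) where
  A₁ : Fin m₁ → Fin b → ℝ
  A₂ : Fin m₂ → Fin 2 → ℝ
  gram₁ : ∀ j j', ∑ i, A₁ i j * A₁ i j' = (if j = j' then 1 else 0) -
    gCoords e g u (Sum.inl j) * gCoords e g u (Sum.inl j') / Q (uPos Q e g u) (uPos Q e g u)
  gram₂ : ∀ j j', ∑ i, A₂ i j * A₂ i j' = (if j = j' then 1 else 0) -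
    gCoords e g u (Sum.inr j) * gCoords e g u (Sum.inr j') / Q (uPos Q e g u) (uPos Q e g u)

variable {Q : LinearMap.BilinForm ℝ V} {e : Module.Basis (Fin b ⊕ Fin 2) ℝ V} {g : V ≃ₗ[ℝ] V}
  {u : V} {m₁ m₂ : ℕ}

lemma exists_wFrame (he : IsStandardBasis Q e) (hg : IsIsometry Q g) (hu : Q u u = 0)
    (hs : 0 < Q (uPos Q e g u) (uPos Q e g u)) :
    ∃ m₁, m₁ + 1 = b ∧ Nonempty (WFrame Q e g u m₁ 1) := by
  obtain ⟨m₁, h₁, A₁, hA₁⟩ := exists_complement_matrix (fun j => gCoords e g u (Sum.inl j)) (by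
    rw [← form_uPos_self he hg]
    exact hs)
  obtain ⟨m₂, h₂, A₂, hA₂⟩ := exists_complement_matrix (fun j => gCoords e g u (Sum.inr j)) (by
    rw [sum_sq_inr_eq he hg hu]
    exact hs)
  obtain rfl : m₂ = 1 := by omega
  refine ⟨m₁, h₁, ⟨⟨A₁, A₂, ?_, ?_⟩⟩⟩
  · simpa only [← form_uPos_self he hg] using hA₁
  · simpa only [sum_sq_inr_eq he hg hu] using hA₂

namespace WFrame

variable (F : WFrame Q e g u m₁ m₂)

/-- The orthonormal coordinates of the projection to `w^⊥ ⊕ w`. -/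
def map : V →ₗ[ℝ] (Fin m₁ ⊕ Fin m₂ → ℝ) :=
  LinearMap.pi (Sum.elim
    (fun i => ∑ j, F.A₁ i j • LinearMap.proj (Sum.inl j))
    (fun i => ∑ j, F.A₂ i j • LinearMap.proj (Sum.inr j))) ∘ₗ (gCoords e g).toLinearMap

lemma map_inl (v : V) (i : Fin m₁) :
    F.map v (Sum.inl i) = ∑ j, F.A₁ i j * gCoords e g v (Sum.inl j) := by
  simp [map]

lemma map_inr (v : V) (i : Fin m₂) :
    F.map v (Sum.inr i) = ∑ j, F.A₂ i j * gCoords e g v (Sum.inr j) := by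
  simp only [map, LinearMap.comp_apply, LinearMap.pi_apply, Sum.elim_inr, LinearMap.sum_apply,
    LinearMap.smul_apply, LinearMap.proj_apply, smul_eq_mul, LinearEquiv.coe_coe]

lemma sum_map_inl (he : IsStandardBasis Q e) (hg : IsIsometry Q g) (v v' : V) :
    ∑ i, F.map v (Sum.inl i) * F.map v' (Sum.inl i) =
      ∑ j, gCoords e g v (Sum.inl j) * gCoords e g v' (Sum.inl j) -
        Q (uPos Q e g u) v * Q (uPos Q e g u) v' / Q (uPos Q e g u) (uPos Q e g u) := by
  simp only [map_inl]
  rw [sum_mul_complement_matrix F.gram₁, ← form_uPos (u := u) he hg, ← form_uPos (u := u) he hg]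

lemma sum_map_inr (he : IsStandardBasis Q e) (hg : IsIsometry Q g) (v v' : V) :
    ∑ i, F.map v (Sum.inr i) * F.map v' (Sum.inr i) =
      ∑ j, gCoords e g v (Sum.inr j) * gCoords e g v' (Sum.inr j) -
        Q (uNeg Q e g u) v * Q (uNeg Q e g u) v' / Q (uPos Q e g u) (uPos Q e g u) := by
  simp only [map_inr]
  rw [sum_mul_complement_matrix F.gram₂, form_uNeg he hg, form_uNeg he hg, neg_mul_neg]

lemma stdForm_map (he : IsStandardBasis Q e) (hg : IsIsometry Q g) (v v' : V) :
    stdForm (F.map v) (F.map v') = Q v v' -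
      Q (uPos Q e g u) v * Q (uPos Q e g u) v' / Q (uPos Q e g u) (uPos Q e g u) +
      Q (uNeg Q e g u) v * Q (uNeg Q e g u) v' / Q (uPos Q e g u) (uPos Q e g u) := by
  rw [stdForm_eq_sub, F.sum_map_inl he hg, F.sum_map_inr he hg, form_eq he hg v, stdForm_eq_sub]
  ring

/-- The squared length of the image in each definite part is what is left after removing the
components along `u_{z^⊥}` and `u_z`, and the hypotheses say that nothing is left. -/
lemma map_eq_zero (he : IsStandardBasis Q e) (hg : IsIsometry Q g) {v : V}
    (h₁ : ∑ j, gCoords e g v (Sum.inl j) * gCoords e g v (Sum.inl j) =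
      Q (uPos Q e g u) v * Q (uPos Q e g u) v / Q (uPos Q e g u) (uPos Q e g u))
    (h₂ : ∑ j, gCoords e g v (Sum.inr j) * gCoords e g v (Sum.inr j) =
      Q (uNeg Q e g u) v * Q (uNeg Q e g u) v / Q (uPos Q e g u) (uPos Q e g u)) :
    F.map v = 0 := by
  have e1 := F.sum_map_inl he hg v v
  have e2 := F.sum_map_inr he hg v v
  rw [h₁, sub_self] at e1
  rw [h₂, sub_self] at e2
  have e1' := (Finset.sum_eq_zero_iff_of_nonneg fun i _ => mul_self_nonneg _).1 e1
  have e2' := (Finset.sum_eq_zero_iff_of_nonneg fun i _ => mul_self_nonneg _).1 e2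
  ext i
  rcases i with i | i
  · exact mul_self_eq_zero.1 (e1' i (Finset.mem_univ _))
  · exact mul_self_eq_zero.1 (e2' i (Finset.mem_univ _))

lemma map_uPos (he : IsStandardBasis Q e) (hg : IsIsometry Q g) : F.map (uPos Q e g u) = 0 := by
  refine F.map_eq_zero he hg ?_ ?_
  · rw [mul_self_div_self, form_uPos_self he hg]
    simp only [gCoords_uPos_inl he hg, sq]
  · rw [form_symm he hg (uNeg Q e g u),
      form_posSpace_negPlane he hg (uPos_mem he hg) (uNeg_mem he hg)]
    simp [gCoords_uPos_inr he hg]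

lemma map_uNeg (he : IsStandardBasis Q e) (hg : IsIsometry Q g) (hu : Q u u = 0) :
    F.map (uNeg Q e g u) = 0 := by
  refine F.map_eq_zero he hg ?_ ?_
  · rw [form_posSpace_negPlane he hg (uPos_mem he hg) (uNeg_mem he hg)]
    simp [gCoords_uNeg_inl he hg]
  · rw [form_uNeg_self_eq he hg hu, neg_mul_neg, mul_self_div_self, ← sum_sq_inr_eq he hg hu]
    simp only [gCoords_uNeg_inr he hg, sq]

lemma map_u (he : IsStandardBasis Q e) (hg : IsIsometry Q g) (hu : Q u u = 0) :
    F.map u = 0 := by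
  have h1 : Q (uPos Q e g u) u = Q (uPos Q e g u) (uPos Q e g u) := by
    rw [form_uPos he hg, form_uPos_self he hg]
    simp only [sq]
  have h2 : Q (uNeg Q e g u) u = -Q (uPos Q e g u) (uPos Q e g u) := by
    rw [← form_uNeg_self_eq he hg hu, form_uNeg he hg, form_uNeg_self he hg]
    simp only [sq]
  refine F.map_eq_zero he hg ?_ ?_
  · rw [h1, mul_self_div_self, form_uPos_self he hg]
    simp only [sq]
  · rw [h2, neg_mul_neg, mul_self_div_self, ← sum_sq_inr_eq he hg hu]
    simp only [sq]

lemma map_mu (he : IsStandardBasis Q e) (hg : IsIsometry Q g) (hu : Q u u = 0) (u' : V) :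
    F.map (mu Q e g u u') = -F.map u' := by
  simp [mu, F.map_uPos he hg, F.map_uNeg he hg hu]

lemma linForm_map (he : IsStandardBasis Q e) (hg : IsIsometry Q g) (α : Fin b) (v : V) :
    linForm (fun i => F.A₁ i α) (F.map v) = gCoords e g v (Sum.inl α) -
      gCoords e g u (Sum.inl α) * Q (uPos Q e g u) v / Q (uPos Q e g u) (uPos Q e g u) := by
  have h := sum_mul_complement_matrix F.gram₁ (Pi.single α 1) fun j => gCoords e g v (Sum.inl j)
  have h1 : ∀ i, ∑ j, F.A₁ i j * (Pi.single α 1 : Fin b → ℝ) j = F.A₁ i α := fun i => by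
    simp [Pi.single_apply]
  simp only [h1] at h
  rw [linForm]
  simp only [map_inl]
  rw [h, form_uPos he hg v]
  simp [Pi.single_apply]

/-- The data of the polynomials `P_{(α,β),w,h,0}`. -/
def polyData (α β : Fin b) : PolyData (Fin m₁) where
  A i := F.A₁ i α
  A' i := F.A₁ i β
  c := gCoords e g u (Sum.inl α)
  c' := gCoords e g u (Sum.inl β)
  s := Q (uPos Q e g u) (uPos Q e g u)

lemma quad_orthProj_wPos (he : IsStandardBasis Q e) (hg : IsIsometry Q g)
    (hs : 0 < Q (uPos Q e g u) (uPos Q e g u)) (v : V) :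
    quad Q (orthProj Q (wPos Q e g u) v) = (∑ i, F.map v (Sum.inl i) ^ 2) / 2 := by
  have h1 := F.sum_map_inl he hg v v
  simp only [← sq] at h1
  rw [quad, h1, orthProj_wPos he hg hs]
  have h2 : Q (posProj e g v) (posProj e g v) = ∑ j, gCoords e g v (Sum.inl j) ^ 2 := by
    rw [form_eq he hg, stdForm_eq_sub]
    simp [gCoords_posProj_inl, gCoords_posProj_inr, sq]
  have h3 : Q (uPos Q e g u) (posProj e g v) = Q (uPos Q e g u) v :=
    ((isOrthProj_posProj he hg).orth v _ (uPos_mem he hg)).symm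
  simp only [map_sub, LinearMap.sub_apply, map_smul, LinearMap.smul_apply, smul_eq_mul, h2, h3,
    form_symm he hg (posProj e g v) (uPos Q e g u)]
  field_simp
  ring

lemma quad_orthProj_wNeg (he : IsStandardBasis Q e) (hg : IsIsometry Q g) (hu : Q u u = 0)
    (hs : 0 < Q (uPos Q e g u) (uPos Q e g u)) (v : V) :
    quad Q (orthProj Q (wNeg Q e g u) v) = -(∑ i, F.map v (Sum.inr i) ^ 2) / 2 := by
  have h1 := F.sum_map_inr he hg v v
  simp only [← sq] at h1
  rw [quad, h1, orthProj_wNeg he hg hu hs]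
  have h2 : Q (negProj e g v) (negProj e g v) = -∑ j, gCoords e g v (Sum.inr j) ^ 2 := by
    rw [form_eq he hg, stdForm_eq_sub]
    simp [gCoords_negProj_inl, gCoords_negProj_inr, sq]
  have h3 : Q (uNeg Q e g u) (negProj e g v) = Q (uNeg Q e g u) v :=
    ((isOrthProj_negProj he hg).orth v _ (uNeg_mem he hg)).symm
  simp only [map_add, LinearMap.add_apply, map_smul, LinearMap.smul_apply, smul_eq_mul, h2, h3,
    form_symm he hg (negProj e g v) (uNeg Q e g u), form_uNeg_self_eq he hg hu]
  field_simp
  ring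

lemma quad_posProj (he : IsStandardBasis Q e) (hg : IsIsometry Q g) (v : V) :
    quad Q (posProj e g v) = (∑ i, F.map v (Sum.inl i) ^ 2) / 2 +
      Q (uPos Q e g u) v ^ 2 / (2 * Q (uPos Q e g u) (uPos Q e g u)) := by
  have h1 := F.sum_map_inl he hg v v
  simp only [← sq] at h1
  rw [quad, h1]
  have h2 : Q (posProj e g v) (posProj e g v) = ∑ j, gCoords e g v (Sum.inl j) ^ 2 := by
    rw [form_eq he hg, stdForm_eq_sub]
    simp [gCoords_posProj_inl, gCoords_posProj_inr, sq]
  rw [h2]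
  ring

lemma quad_negProj (he : IsStandardBasis Q e) (hg : IsIsometry Q g) (v : V) :
    quad Q (negProj e g v) = -(∑ i, F.map v (Sum.inr i) ^ 2) / 2 -
      Q (uNeg Q e g u) v ^ 2 / (2 * Q (uPos Q e g u) (uPos Q e g u)) := by
  have h1 := F.sum_map_inr he hg v v
  simp only [← sq] at h1
  rw [quad, h1]
  have h2 : Q (negProj e g v) (negProj e g v) = -∑ j, gCoords e g v (Sum.inr j) ^ 2 := by
    rw [form_eq he hg, stdForm_eq_sub]
    simp [gCoords_negProj_inl, gCoords_negProj_inr, sq]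
  rw [h2]
  ring

end WFrame

end Frame

/-! ### Identification of the theta terms with the coordinate model -/

section Terms

variable {b : ℕ} {V : Type*} [AddCommGroup V] [Module ℝ V]
  {Q : LinearMap.BilinForm ℝ V} {e : Module.Basis (Fin b ⊕ Fin 2) ℝ V} {g : V ≃ₗ[ℝ] V}
  {u u' : V} {m₁ m₂ : ℕ} (F : WFrame Q e g u m₁ m₂)

lemma form_uPos_u (he : IsStandardBasis Q e) (hg : IsIsometry Q g) :
    Q (uPos Q e g u) u = Q (uPos Q e g u) (uPos Q e g u) := by
  rw [form_uPos he hg u, form_uPos_self he hg]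
  simp only [sq]

lemma form_mu (he : IsStandardBasis Q e) (hg : IsIsometry Q g) (hu : Q u u = 0) (v : V) :
    Q v (mu Q e g u u') = -Q v u' + (Q (uPos Q e g u) v - Q (uNeg Q e g u) v) /
      (2 * Q (uPos Q e g u) (uPos Q e g u)) := by
  rw [mu, form_uNeg_self_eq he hg hu]
  simp only [map_add, map_neg, map_smul, smul_eq_mul, form_symm he hg v (uPos Q e g u),
    form_symm he hg v (uNeg Q e g u)]
  rw [mul_neg, inv_neg]
  ring

lemma form_uPos_mu (he : IsStandardBasis Q e) (hg : IsIsometry Q g) (hu : Q u u = 0)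
    (hs : 0 < Q (uPos Q e g u) (uPos Q e g u)) :
    Q (uPos Q e g u) (mu Q e g u u') = -Q (uPos Q e g u) u' + 1 / 2 := by
  rw [form_mu he hg hu, form_symm he hg (uNeg Q e g u),
    form_posSpace_negPlane he hg (uPos_mem he hg) (uNeg_mem he hg)]
  field_simp
  ring

lemma form_uNeg_mu (he : IsStandardBasis Q e) (hg : IsIsometry Q g) (hu : Q u u = 0)
    (hs : 0 < Q (uPos Q e g u) (uPos Q e g u)) :
    Q (uNeg Q e g u) (mu Q e g u u') = -Q (uNeg Q e g u) u' + 1 / 2 := by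
  rw [form_mu he hg hu, form_uNeg_self_eq he hg hu,
    form_posSpace_negPlane he hg (uPos_mem he hg) (uNeg_mem he hg)]
  field_simp
  ring

/-- Inner products with `μ` are inner products in the standard space. -/
lemma WFrame.stdForm_map_mu (he : IsStandardBasis Q e) (hg : IsIsometry Q g) (hu : Q u u = 0)
    (huu' : Q u u' = 1) (hs : 0 < Q (uPos Q e g u) (uPos Q e g u)) (v : V) :
    stdForm (F.map v) (F.map (mu Q e g u u')) = Q v (mu Q e g u u') -
      Q u v * (1 / 2 - Q (uPos Q e g u) u') / Q (uPos Q e g u) (uPos Q e g u) := by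
  have h1 := form_uPos_add_uNeg he hg (u := u) u'
  have h2 := form_uPos_add_uNeg he hg (u := u) v
  rw [huu'] at h1
  rw [F.stdForm_map he hg, form_uPos_mu he hg hu hs, form_uNeg_mu he hg hu hs, ← h2]
  have h3 : Q (uNeg Q e g u) u' = 1 - Q (uPos Q e g u) u' := by linarith
  rw [h3]
  field_simp
  ring

lemma WFrame.stdForm_mu (he : IsStandardBasis Q e) (hg : IsIsometry Q g) (hu : Q u u = 0)
    (hu' : Q u' u' = 0) (huu' : Q u u' = 1) (hs : 0 < Q (uPos Q e g u) (uPos Q e g u)) :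
    stdForm (F.map (mu Q e g u u')) (F.map (mu Q e g u u')) =
      (1 - 2 * Q (uPos Q e g u) u') / Q (uPos Q e g u) (uPos Q e g u) := by
  have h1 := form_uPos_add_uNeg he hg (u := u) u'
  rw [huu'] at h1
  have h3 : Q (uNeg Q e g u) u' = 1 - Q (uPos Q e g u) u' := by linarith
  have h4 := form_uPos_add_uNeg he hg (u := u) (mu Q e g u u')
  rw [F.stdForm_map_mu he hg hu huu' hs, ← h4, form_mu he hg hu,
    form_symm he hg (mu Q e g u u') u', form_mu he hg hu, hu', form_uPos_mu he hg hu hs,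
    form_uNeg_mu he hg hu hs, h3]
  field_simp
  ring

/-- For `κ` orthogonal to `u` and `u'`, `(κ, u_z) = -(κ, u_{z^⊥})`, whence `(κ, μ) = (κ, u_{z^⊥}) /
u_{z^⊥}²`. The coefficient of `c` is `(u', u_{z^⊥})`, expressed through the norm of the image of `μ`
by `WFrame.stdForm_mu`. -/
lemma form_uPos_eq_lineCoord (he : IsStandardBasis Q e) (hg : IsIsometry Q g) (hu : Q u u = 0)
    (hu' : Q u' u' = 0) (huu' : Q u u' = 1) (hs : 0 < Q (uPos Q e g u) (uPos Q e g u)) {κ : V}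
    (hκ : Q u κ = 0) (hκ' : Q u' κ = 0) (c n : ℤ) :
    Q (uPos Q e g u) (κ + (n : ℝ) • u + (c : ℝ) • u') =
      lineCoord (Q (uPos Q e g u) (uPos Q e g u)) (F.map (mu Q e g u u')) (F.map κ) c n := by
  have h2 := form_uPos_add_uNeg he hg (u := u) κ
  rw [hκ] at h2
  rw [lineCoord, F.stdForm_mu he hg hu hu' huu' hs, F.stdForm_map_mu he hg hu huu' hs,
    form_mu he hg hu, form_symm he hg κ u', hκ, hκ',
    show Q (uNeg Q e g u) κ = -Q (uPos Q e g u) κ by linarith]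
  simp only [map_add, map_smul, smul_eq_mul, form_uPos_u he hg]
  field_simp
  ring

lemma WFrame.map_add_smul_add_smul (he : IsStandardBasis Q e) (hg : IsIsometry Q g)
    (hu : Q u u = 0) (κ : V) (c n : ℝ) :
    F.map (κ + n • u + c • u') = F.map κ + -c • F.map (mu Q e g u u') := by
  rw [F.map_mu he hg hu]
  simp [F.map_u he hg hu]

lemma WFrame.sum_A_mul_A (α β : Fin b) :
    ∑ i, F.A₁ i α * F.A₁ i β + gCoords e g u (Sum.inl α) * gCoords e g u (Sum.inl β) /
      Q (uPos Q e g u) (uPos Q e g u) = if α = β then 1 else 0 := by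
  rw [F.gram₁]
  ring

/-- The terms of `Θ_L` in terms of the splitting `L = K ⊕ ℤu ⊕ ℤu'`. -/
lemma thetaTerm_polAB (he : IsStandardBasis Q e) (hg : IsIsometry Q g) (hu : Q u u = 0)
    (hu' : Q u' u' = 0) (huu' : Q u u' = 1) (hs : 0 < Q (uPos Q e g u) (uPos Q e g u)) {κ : V}
    (hκ : Q u κ = 0) (hκ' : Q u' κ = 0) (c n : ℤ) (α β : Fin b) (τ : UpperHalfPlane) :
    thetaTerm Q (posSpace Q e g) (negPlane e g)
      ((coords e : V →ₗ[ℝ] (Fin b ⊕ Fin 2 → ℝ)) ∘ₗ (g : V →ₗ[ℝ] V)) (polAB α β) τ 0 0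
      (κ + (n : ℝ) • u + (c : ℝ) • u') =
    thetaExp τ 0 (-(c : ℝ) • F.map (mu Q e g u u')) (F.map κ) *
      (lineExp (Q (uPos Q e g u) (uPos Q e g u)) τ c
        (lineCoord (Q (uPos Q e g u) (uPos Q e g u)) (F.map (mu Q e g u u')) (F.map κ) c n) *
      ((F.polyData α β).fullVal τ.im (F.map κ + -(c : ℝ) • F.map (mu Q e g u u'))
        (lineCoord (Q (uPos Q e g u) (uPos Q e g u)) (F.map (mu Q e g u u'))
          (F.map κ) c n) : ℝ)) := by
  have ha := form_uPos_eq_lineCoord F he hg hu hu' huu' hs hκ hκ' c n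
  have hm := F.map_add_smul_add_smul (u' := u') he hg hu κ c n
  have hc : Q u (κ + (n : ℝ) • u + (c : ℝ) • u') = c := by
    simp [hκ, hu, huu']
  rw [← ha, thetaExp, stdForm_eq_sub _ 0, ← hm]
  generalize κ + (n : ℝ) • u + (c : ℝ) • u' = v at hc ⊢
  have hneg : Q (uNeg Q e g u) v = c - Q (uPos Q e g u) v := by
    have := form_uPos_add_uNeg he hg (u := u) v
    linarith
  -- The Laplacian of `P_{(α,β)}` splits into its part on `w^⊥` and its part along `u_{z^⊥}`;
  -- `F.sum_A_mul_A` says that they add up to the Kronecker delta.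
  have hval : MvPolynomial.eval (coords e (g v)) (expLaplacian τ.im (polAB α β)) =
      (F.polyData α β).fullVal τ.im (F.map v) (Q (uPos Q e g u) v) := by
    rw [eval_expLaplacian _ (laplacian_polAB α β), eval_polAB, PolyData.fullVal]
    simp only [WFrame.polyData, F.linForm_map he hg, F.sum_A_mul_A]
    simp only [gCoords_apply]
    ring
  rw [thetaTerm, orthProj_posSpace he hg, orthProj_negPlane he hg, add_zero]
  simp only [LinearMap.comp_apply, LinearEquiv.coe_coe, hval]
  rw [mul_comm, ← mul_assoc, lineExp, expi, expi, ← Complex.exp_add, F.quad_posProj he hg,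
    F.quad_negProj he hg, hneg]
  congr 2
  have hs' : ((Q (uPos Q e g u) (uPos Q e g u) : ℝ) : ℂ) ≠ 0 := by exact_mod_cast hs.ne'
  simp only [map_zero, Pi.zero_apply, mul_zero, Finset.sum_const_zero, sub_zero]
  push_cast
  field_simp
  ring

lemma wProjCoords_coords (v : V) :
    wProjCoords Q e g u (gCoords e g v) = coords e (wMap Q e g u v) := by
  simp [wProjCoords, gCoords_apply]

lemma wRow_inl (he : IsStandardBasis Q e) (hg : IsIsometry Q g) (hu : Q u u = 0)
    (hs : 0 < Q (uPos Q e g u) (uPos Q e g u)) (α i : Fin b) :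
    wRow Q e g u α (Sum.inl i) = (if α = i then 1 else 0) -
      gCoords e g u (Sum.inl α) * gCoords e g u (Sum.inl i) /
        Q (uPos Q e g u) (uPos Q e g u) := by
  rw [wRow, ← (gCoords e g).apply_symm_apply (Pi.single (Sum.inl i) 1), wProjCoords_coords,
    coords_wMap_inl he hg hu hs, form_uPos he hg ((gCoords e g).symm _),
    LinearEquiv.apply_symm_apply]
  simp [Pi.single_apply]
  ring

lemma wRow_inr (he : IsStandardBasis Q e) (hg : IsIsometry Q g) (hu : Q u u = 0)
    (hs : 0 < Q (uPos Q e g u) (uPos Q e g u)) (α : Fin b) (i : Fin 2) :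
    wRow Q e g u α (Sum.inr i) = 0 := by
  rw [wRow, ← (gCoords e g).apply_symm_apply (Pi.single (Sum.inr i) 1), wProjCoords_coords,
    coords_wMap_inl he hg hu hs, form_uPos he hg ((gCoords e g).symm _),
    LinearEquiv.apply_symm_apply]
  simp

/-- Both sides are entries of the orthogonal projection to `w^⊥` in the positive coordinates: the
left by `P Pᵀ = P`, the right by `gram₁`. -/
lemma WFrame.sum_wRow_mul (he : IsStandardBasis Q e) (hg : IsIsometry Q g) (hu : Q u u = 0)
    (hs : 0 < Q (uPos Q e g u) (uPos Q e g u)) (α β : Fin b) :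
    ∑ i, wRow Q e g u α i * wRow Q e g u β i = ∑ i, F.A₁ i α * F.A₁ i β := by
  rw [Fintype.sum_sum_type]
  simp only [wRow_inl he hg hu hs, wRow_inr he hg hu hs, ← F.gram₁]
  rw [mul_zero, Finset.sum_const_zero, add_zero]
  have h2 := form_uPos_self he hg (u := u)
  simp only [F.gram₁]
  generalize Q (uPos Q e g u) (uPos Q e g u) = s at *
  have h3 : ∀ i : Fin b, ((if α = i then (1 : ℝ) else 0) -
      gCoords e g u (Sum.inl α) * gCoords e g u (Sum.inl i) / s) *
      ((if β = i then 1 else 0) - gCoords e g u (Sum.inl β) * gCoords e g u (Sum.inl i) / s) =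
      (if α = i then (if β = i then 1 else 0) -
        gCoords e g u (Sum.inl β) * gCoords e g u (Sum.inl i) / s else 0) -
      (if β = i then gCoords e g u (Sum.inl α) * gCoords e g u (Sum.inl i) / s else 0) +
      gCoords e g u (Sum.inl α) * gCoords e g u (Sum.inl β) / s ^ 2 *
        gCoords e g u (Sum.inl i) ^ 2 := by
    intro i
    split_ifs <;> ring
  simp only [h3, Finset.sum_add_distrib, Finset.sum_sub_distrib, Finset.sum_ite_eq,
    Finset.mem_univ, if_true, ← Finset.mul_sum, ← h2]
  simp only [eq_comm (a := β) (b := α)]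
  field_simp
  ring

/-- The point of evaluation is already projected, so applying the row of the projection again
changes nothing. -/
lemma eval_linPol_wRow (he : IsStandardBasis Q e) (hg : IsIsometry Q g) (hu : Q u u = 0)
    (hs : 0 < Q (uPos Q e g u) (uPos Q e g u)) (α : Fin b) (v : V) :
    MvPolynomial.eval (coords e (wMap Q e g u v)) (linPol (wRow Q e g u α)) =
      linForm (fun i => F.A₁ i α) (F.map v) := by
  rw [eval_linPol, Fintype.sum_sum_type, F.linForm_map he hg]
  simp only [wRow_inl he hg hu hs, wRow_inr he hg hu hs, coords_wMap_inl he hg hu hs, zero_mul,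
    Finset.sum_const_zero, add_zero]
  have h1 := form_uPos he hg (u := u) v
  have h2 := form_uPos_self he hg (u := u)
  generalize hsd : Q (uPos Q e g u) (uPos Q e g u) = s at *
  generalize hwd : Q (uPos Q e g u) v = w at *
  have h3 : ∀ i : Fin b, ((if α = i then (1 : ℝ) else 0) -
      gCoords e g u (Sum.inl α) * gCoords e g u (Sum.inl i) / s) *
      (gCoords e g v (Sum.inl i) - w / s * gCoords e g u (Sum.inl i)) =
      (if α = i then gCoords e g v (Sum.inl i) - w / s * gCoords e g u (Sum.inl i) else 0) -
      gCoords e g u (Sum.inl α) / s * (gCoords e g u (Sum.inl i) * gCoords e g v (Sum.inl i)) +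
      gCoords e g u (Sum.inl α) * w / s ^ 2 * gCoords e g u (Sum.inl i) ^ 2 := by
    intro i
    split_ifs <;> ring
  simp only [h3, Finset.sum_add_distrib, Finset.sum_sub_distrib, Finset.sum_ite_eq,
    Finset.mem_univ, if_true, ← Finset.mul_sum, ← h2, ← h1]
  field_simp
  ring

lemma eval_expLaplacian_polW (he : IsStandardBasis Q e) (hg : IsIsometry Q g) (hu : Q u u = 0)
    (hs : 0 < Q (uPos Q e g u) (uPos Q e g u)) (α β : Fin b) {h : ℕ} (hh : h ≤ 2) (y : ℝ) (v : V) :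
    MvPolynomial.eval (coords e (wMap Q e g u v))
      (expLaplacian y (polW Q e g u (polAB α β) h 0)) =
      (F.polyData α β).val h y (F.map v) := by
  obtain ⟨h0, h1, h2⟩ := polW_polAB Q e g u α β (gCoords_uNeg_inl he hg α) (gCoords_uNeg_inl he hg β)
  have hu' : ∀ γ : Fin b, uCoeff Q e g u γ =
      gCoords e g u (Sum.inl γ) / Q (uPos Q e g u) (uPos Q e g u) := fun γ => by
    rw [uCoeff, ← gCoords_apply, gCoords_uPos_inl he hg]
  interval_cases h
  · rw [h0, eval_expLaplacian _ (laplacian_linPol_mul _ _ _), map_mul, map_mul, MvPolynomial.eval_C,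
      eval_linPol_wRow F he hg hu hs, eval_linPol_wRow F he hg hu hs, F.sum_wRow_mul he hg hu hs]
    simp only [WFrame.polyData, PolyData.val]
    ring
  · rw [h1, eval_expLaplacian _ ((laplacian_linPol _).trans (map_zero _).symm)]
    have h3 : ∀ (r r' : ℝ) (w w' x : Fin b ⊕ Fin 2 → ℝ), MvPolynomial.eval x
        (linPol (r • w + r' • w')) =
        r * MvPolynomial.eval x (linPol w) + r' * MvPolynomial.eval x (linPol w') := by
      intro r r' w w' x
      simp only [eval_linPol, Finset.mul_sum, ← Finset.sum_add_distrib]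
      refine Finset.sum_congr rfl fun i _ => ?_
      simp only [Pi.add_apply, Pi.smul_apply, smul_eq_mul]
      ring
    rw [h3, eval_linPol_wRow F he hg hu hs, eval_linPol_wRow F he hg hu hs, hu', hu']
    simp only [WFrame.polyData, PolyData.val]
    ring
  · rw [h2, eval_expLaplacian _ ((laplacian_C _).trans (map_zero _).symm), MvPolynomial.eval_C,
      hu', hu']
    simp only [WFrame.polyData, PolyData.val]
    ring

/-- The terms of `Θ_K`. -/
lemma thetaTerm_polW (he : IsStandardBasis Q e) (hg : IsIsometry Q g) (hu : Q u u = 0)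
    (huu' : Q u u' = 1) (hs : 0 < Q (uPos Q e g u) (uPos Q e g u)) {κ : V}
    (hκ : Q u κ = 0) (α β : Fin b) {h : ℕ} (hh : h ≤ 2) (r : ℝ)
    (τ : UpperHalfPlane) :
    thetaTerm Q (wPos Q e g u) (wNeg Q e g u)
      ((coords e : V →ₗ[ℝ] (Fin b ⊕ Fin 2 → ℝ)) ∘ₗ wMap Q e g u) (polW Q e g u (polAB α β) h 0) τ
      (r • mu Q e g u u') 0 κ =
    thetaExp τ (r • F.map (mu Q e g u u')) 0 (F.map κ) *
      ((F.polyData α β).val h τ.im (F.map κ + 0) : ℝ) := by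
  rw [thetaTerm, smul_zero, add_zero]
  simp only [LinearMap.comp_apply, LinearEquiv.coe_coe]
  rw [eval_expLaplacian_polW F he hg hu hs α β hh, mul_comm, add_zero, thetaExp,
    F.quad_orthProj_wPos he hg hs, F.quad_orthProj_wNeg he hg hu hs, ← map_smul F.map, smul_zero,
    add_zero, map_smul F.map]
  -- Pairing with `μ` before and after projection differs by a multiple of `(u, κ)`, which vanishes
  -- on `K`.
  have h1 : stdForm (F.map κ) (r • F.map (mu Q e g u u')) = Q κ (r • mu Q e g u u') := by
    have := F.stdForm_map_mu (u' := u') he hg hu huu' hs κ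
    rw [hκ, zero_mul, zero_div, sub_zero] at this
    rw [map_smul, smul_eq_mul, ← this, stdForm, stdForm, Finset.mul_sum]
    refine Finset.sum_congr rfl fun i _ => ?_
    simp only [Pi.smul_apply, smul_eq_mul]
    ring
  rw [h1]

end Terms

/-! ### The decomposition `L = K ⊕ ⟨u, u'⟩` and the frame of `K` -/

section Splitting

variable {L : Type*} [AddCommGroup L] {B : LinearMap.BilinForm ℤ L} {u u' : L}

lemma mem_complementLattice (x : L) :
    x ∈ complementLattice B u u' ↔ B u x = 0 ∧ B u' x = 0 := by
  simp [complementLattice]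

/-- The projection of `L = K ⊕ ⟨u, u'⟩` to `K`. -/
def complementProj (hB : IsEvenUnimodular B) (hu : B u u = 0) (hu' : B u' u' = 0)
    (huu' : B u u' = 1) : L →ₗ[ℤ] complementLattice B u u' :=
  LinearMap.codRestrict _ (LinearMap.id - (B u').smulRight u - (B u).smulRight u') fun x => by
    rw [mem_complementLattice]
    simp [hu, hu', huu', hB.symm u' u]

lemma coe_complementProj (hB : IsEvenUnimodular B) (hu : B u u = 0) (hu' : B u' u' = 0)
    (huu' : B u u' = 1) (x : L) :
    (complementProj hB hu hu' huu' x : L) = x - B u' x • u - B u x • u' := rfl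

/-- The splitting `L = K ⊕ ℤu' ⊕ ℤu`. -/
def splitEquiv (hB : IsEvenUnimodular B) (hu : B u u = 0) (hu' : B u' u' = 0)
    (huu' : B u u' = 1) : ((complementLattice B u u' × ℤ) × ℤ) ≃ₗ[ℤ] L where
  toFun t := t.1.1 + t.2 • u + t.1.2 • u'
  invFun x := ((complementProj hB hu hu' huu' x, B u x), B u' x)
  map_add' s t := by
    simp only [Prod.fst_add, Prod.snd_add, Submodule.coe_add, add_smul]
    abel
  map_smul' a t := by
    simp [smul_smul]
  left_inv t := by
    obtain ⟨⟨⟨x, hx⟩, c⟩, n⟩ := t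
    have hx' := (mem_complementLattice x).1 hx
    have h1 : B u (x + n • u + c • u') = c := by simp [hx'.1, hu, huu']
    have h2 : B u' (x + n • u + c • u') = n := by simp [hx'.2, hu', hB.symm u' u, huu']
    refine Prod.ext (Prod.ext (Subtype.ext ?_) h1) h2
    simp only [coe_complementProj, h1, h2]
    abel
  right_inv x := by
    simp only [coe_complementProj]
    abel

lemma splitEquiv_apply (hB : IsEvenUnimodular B) (hu : B u u = 0) (hu' : B u' u' = 0)
    (huu' : B u u' = 1) (t : (complementLattice B u u' × ℤ) × ℤ) :
    splitEquiv hB hu hu' huu' t = t.1.1 + t.2 • u + t.1.2 • u' := rfl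

/-- A functional on `K` extends to `L` by zero on `u` and `u'`. The vector of `L` representing the
extension is then orthogonal to both, so it lies in `K`. -/
lemma bijective_restrict (hB : IsEvenUnimodular B) (hu : B u u = 0) (hu' : B u' u' = 0)
    (huu' : B u u' = 1) :
    Function.Bijective (B.restrict (complementLattice B u u') :
      complementLattice B u u' → (complementLattice B u u' →ₗ[ℤ] ℤ)) := by
  have hort : ∀ (x : complementLattice B u u') (l : L),
      B x l = B x (complementProj hB hu hu' huu' l) := by
    intro x l
    have hx := (mem_complementLattice _).1 x.2
    rw [coe_complementProj]
    simp [hB.symm x u, hB.symm x u', hx.1, hx.2]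
  constructor
  · rw [injective_iff_map_eq_zero]
    intro x hx
    have : B (x : L) = 0 := by
      ext l
      rw [hort]
      exact LinearMap.congr_fun hx (complementProj hB hu hu' huu' l)
    exact Subtype.ext (hB.unimodular.injective (this.trans (map_zero B).symm))
  · intro f
    obtain ⟨x, hx⟩ := hB.unimodular.surjective (f ∘ₗ complementProj hB hu hu' huu')
    have h0 : complementProj hB hu hu' huu' u = 0 := by
      apply Subtype.ext
      rw [coe_complementProj]
      simp [hu, hB.symm u' u, huu']
    have h0' : complementProj hB hu hu' huu' u' = 0 := by
      apply Subtype.ext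
      rw [coe_complementProj]
      simp [hu', huu']
    have hxm : x ∈ complementLattice B u u' := by
      rw [mem_complementLattice, hB.symm u x, hB.symm u' x, hx]
      simp [h0, h0']
    refine ⟨⟨x, hxm⟩, ?_⟩
    ext y
    have hy : complementProj hB hu hu' huu' y = y := by
      have := (mem_complementLattice _).1 y.2
      apply Subtype.ext
      rw [coe_complementProj]
      simp [this.1, this.2]
    change B x y = f y
    rw [hx, LinearMap.comp_apply, hy]

lemma finrank_complementLattice [Module.Free ℤ L] [Module.Finite ℤ L] {b : ℕ}
    (e : Module.Basis (Fin b ⊕ Fin 2) ℝ (ℝ ⊗[ℤ] L)) (hB : IsEvenUnimodular B) (hu : B u u = 0)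
    (hu' : B u' u' = 0) (huu' : B u u' = 1) :
    Module.finrank ℤ (complementLattice B u u') = b := by
  have h1 : Module.finrank ℤ L = b + 2 := by
    rw [← Module.finrank_baseChange (R := ℝ), Module.finrank_eq_card_basis e]
    simp
  have h2 := (splitEquiv hB hu hu' huu').finrank_eq
  rw [Module.finrank_prod, Module.finrank_prod, Module.finrank_self, h1] at h2
  omega

lemma realForm_toReal (x y : L) : realForm B (toReal x) (toReal y) = (B x y : ℝ) := by
  simp [realForm, toReal]

lemma toReal_add (x y : L) : toReal (x + y) = toReal x + toReal y := TensorProduct.tmul_add _ _ _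

lemma toReal_zsmul (n : ℤ) (x : L) : toReal (n • x) = (n : ℝ) • toReal x := by
  rw [toReal, toReal, TensorProduct.tmul_smul, Int.cast_smul_eq_zsmul]

variable {b : ℕ} {e : Module.Basis (Fin b ⊕ Fin 2) ℝ (ℝ ⊗[ℤ] L)}
  {g : (ℝ ⊗[ℤ] L) ≃ₗ[ℝ] (ℝ ⊗[ℤ] L)} {m₁ m₂ : ℕ}

/-- The coordinates of vectors of `K`. -/
def WFrame.latticeMap (F : WFrame (realForm B) e g (toReal u) m₁ m₂) (u' : L) :
    complementLattice B u u' →+ (Fin m₁ ⊕ Fin m₂ → ℝ) where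
  toFun x := F.map (toReal (x : L))
  map_zero' := by simp [toReal]
  map_add' x y := by
    rw [Submodule.coe_add, toReal_add, map_add]

/-- On vectors orthogonal to `u` the pairings with `u_{z^⊥}` and `u_z` are opposite, so the
corrections in `WFrame.stdForm_map` cancel: projection to `w^⊥ ⊕ w` is isometric on `K`. -/
lemma WFrame.isFrame [Module.Free ℤ L] [Module.Finite ℤ L]
    (F : WFrame (realForm B) e g (toReal u) m₁ 1) (he : IsStandardBasis (realForm B) e)
    (hg : IsIsometry (realForm B) g) (hB : IsEvenUnimodular B) (hu : B u u = 0)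
    (hu' : B u' u' = 0) (huu' : B u u' = 1) (hm : m₁ + 1 = b) :
    IsFrame (B.restrict (complementLattice B u u')) sgn (F.latticeMap u') where
  bij := bijective_restrict hB hu hu' huu'
  card := by
    rw [finrank_complementLattice e hB hu hu' huu']
    simp [hm]
  sq i := by
    rcases i with i | i <;> simp [sgn]
  form x y := by
    change (B (x : L) (y : L) : ℝ) = stdForm (F.map (toReal (x : L))) (F.map (toReal (y : L)))
    have hx := ((mem_complementLattice _).1 x.2).1
    have hy := ((mem_complementLattice _).1 y.2).1
    have h1 := form_uPos_add_uNeg he hg (u := toReal u) (toReal (x : L))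
    have h2 := form_uPos_add_uNeg he hg (u := toReal u) (toReal (y : L))
    rw [realForm_toReal, hx, Int.cast_zero] at h1
    rw [realForm_toReal, hy, Int.cast_zero] at h2
    rw [F.stdForm_map he hg, realForm_toReal, eq_neg_of_add_eq_zero_left h1,
      eq_neg_of_add_eq_zero_left h2]
    ring

end Splitting

/-! ### `Θ_L`, `Θ_K` and `h_{α,β}` in terms of the unfolded series -/

section Assembly

variable {b : ℕ} {L : Type*} [AddCommGroup L] {B : LinearMap.BilinForm ℤ L}
  {e : Module.Basis (Fin b ⊕ Fin 2) ℝ (ℝ ⊗[ℤ] L)} {g : (ℝ ⊗[ℤ] L) ≃ₗ[ℝ] (ℝ ⊗[ℤ] L)}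
  {u u' : L} {m₁ m₂ : ℕ} (F : WFrame (realForm B) e g (toReal u) m₁ m₂)

lemma thetaLTerm_eq (he : IsStandardBasis (realForm B) e) (hg : IsIsometry (realForm B) g)
    (hB : IsEvenUnimodular B) (hu : B u u = 0) (hu' : B u' u' = 0) (huu' : B u u' = 1)
    (hs : 0 < uPosSq B e g u) (α β : Fin b) (τ : UpperHalfPlane)
    (t : (complementLattice B u u' × ℤ) × ℤ) :
    thetaLTerm B e g (polAB α β) τ (splitEquiv hB hu hu' huu' t) =
      (F.polyData α β).fullTerm (F.latticeMap u')
        (F.map (mu (realForm B) e g (toReal u) (toReal u'))) τ t.1.1 t.1.2 t.2 := by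
  have hx := (mem_complementLattice _).1 t.1.1.2
  rw [thetaLTerm, splitEquiv_apply, toReal_add, toReal_add, toReal_zsmul, toReal_zsmul,
    thetaTerm_polAB F he hg (by rw [realForm_toReal, hu, Int.cast_zero])
      (by rw [realForm_toReal, hu', Int.cast_zero]) (by rw [realForm_toReal, huu', Int.cast_one]) hs
      (by rw [realForm_toReal, hx.1, Int.cast_zero]) (by rw [realForm_toReal, hx.2, Int.cast_zero])]
  rfl

lemma thetaKTerm_eq (he : IsStandardBasis (realForm B) e) (hg : IsIsometry (realForm B) g)
    (hu : B u u = 0) (huu' : B u u' = 1) (hs : 0 < uPosSq B e g u) (α β : Fin b)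
    (τ : UpperHalfPlane) {h : ℕ} (hh : h ≤ 2) (r : ℝ) (x : complementLattice B u u') :
    thetaKTerm B e g u u' (polABW B e g u α β h) τ
        (r • mu (realForm B) e g (toReal u) (toReal u')) 0 x =
      thetaExp τ (r • F.map (mu (realForm B) e g (toReal u) (toReal u'))) 0 (F.latticeMap u' x) *
        ((F.polyData α β).val h τ.im (F.latticeMap u' x + 0) : ℝ) := by
  have hx := (mem_complementLattice _).1 x.2
  rw [thetaKTerm, polABW, thetaTerm_polW F he hg (by rw [realForm_toReal, hu, Int.cast_zero])
    (by rw [realForm_toReal, huu', Int.cast_one]) hs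
    (by rw [realForm_toReal, hx.1, Int.cast_zero]) α β hh]
  rfl

/-- The terms of `h_{α,β}` are the conjugated blocks with `c = 0`: there `zFactor` is `ir / (2y)`,
whose conjugate is `r / (2iy)`. -/
lemma auxTerm_eq (he : IsStandardBasis (realForm B) e) (hg : IsIsometry (realForm B) g)
    (hu : B u u = 0) (huu' : B u u' = 1) (hs : 0 < uPosSq B e g u) (α β : Fin b)
    (τ : UpperHalfPlane) (r : ℕ) :
    auxTerm B e g u u' α β τ r = (starRingEnd ℂ) ((F.polyData α β).block (F.latticeMap u')
      (F.map (mu (realForm B) e g (toReal u) (toReal u'))) τ 0 r) := by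
  rw [auxTerm, PolyData.block, map_mul, map_sum, Finset.mul_sum]
  refine Finset.sum_congr rfl fun h hh => ?_
  have hh2 : h ≤ 2 := Nat.lt_succ_iff.1 (Finset.mem_range.1 hh)
  have h1 : thetaK B e g u u' (polABW B e g u α β h) τ
      ((r : ℝ) • mu (realForm B) e g (toReal u) (toReal u')) 0 =
      (F.polyData α β).theta (F.latticeMap u') h τ
        (((r : ℤ) : ℝ) • F.map (mu (realForm B) e g (toReal u) (toReal u')))
        (-((0 : ℤ) : ℝ) • F.map (mu (realForm B) e g (toReal u) (toReal u'))) := by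
    rw [thetaK, PolyData.theta]
    simp only [thetaKTerm_eq F he hg hu huu' hs α β τ hh2]
    simp
  have h2 : (starRingEnd ℂ) (zFactor τ 0 r) = (r : ℂ) / (2 * I * (τ.im : ℂ)) := by
    have hy : (τ.im : ℂ) ≠ 0 := by exact_mod_cast τ.im_ne_zero
    simp only [zFactor, map_div₀, map_mul, Complex.conj_I, Complex.conj_ofReal, map_ofNat, Int.cast_zero, zero_mul, zero_add,
      UpperHalfPlane.coe_im, Int.cast_natCast]
    field_simp
    simp
  have h3 : gaussFactor (F.polyData α β).s τ 0 r =
      Real.exp (-(Real.pi * (r : ℝ) ^ 2) / (2 * τ.im * uPosSq B e g u)) := by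
    rw [gaussFactor, normSq_mul_add]
    simp [WFrame.polyData, uPosSq]
  rw [h1, map_mul, map_pow, h2, Complex.conj_ofReal, h3]
  ring

lemma auxFun_eq (he : IsStandardBasis (realForm B) e) (hg : IsIsometry (realForm B) g)
    (hu : B u u = 0) (huu' : B u u' = 1) (hs : 0 < uPosSq B e g u) (α β : Fin b) (k : ℤ)
    (f : UpperHalfPlane → ℂ) (τ : UpperHalfPlane) :
    auxFun B e g u u' α β k f τ = ∑' r : ℕ+, (F.polyData α β).orbitTerm (F.latticeMap u')
      (F.map (mu (realForm B) e g (toReal u) (toReal u'))) k f τ 0 r /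
        ((√2 * √(uPosSq B e g u) : ℝ) : ℂ) := by
  rw [auxFun, ← tsum_mul_left]
  refine tsum_congr fun r => ?_
  rw [auxTerm_eq F he hg hu huu' hs, prefactor, PolyData.orbitTerm]
  ring

lemma prefactor_mul_thetaK (he : IsStandardBasis (realForm B) e) (hg : IsIsometry (realForm B) g)
    (hu : B u u = 0) (huu' : B u u' = 1) (hs : 0 < uPosSq B e g u) (α β : Fin b) (k : ℤ)
    (f : UpperHalfPlane → ℂ) (τ : UpperHalfPlane) :
    prefactor B e g u k f τ * (starRingEnd ℂ) (thetaK B e g u u' (polABW B e g u α β 0) τ 0 0) =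
      (F.polyData α β).orbitTerm (F.latticeMap u')
        (F.map (mu (realForm B) e g (toReal u) (toReal u'))) k f τ 0 0 /
        ((√2 * √(uPosSq B e g u) : ℝ) : ℂ) := by
  -- The separate theta term is the case `r = 0`, in which all summands with `h⁺ > 0` vanish.
  have h := auxTerm_eq F he hg hu huu' hs α β τ 0
  have h0 : auxTerm B e g u u' α β τ 0 =
      (starRingEnd ℂ) (thetaK B e g u u' (polABW B e g u α β 0) τ 0 0) := by
    rw [auxTerm, Finset.sum_range_succ', Finset.sum_eq_zero]
    · simp
    · intro h _
      simp
  rw [← h0, h, prefactor, PolyData.orbitTerm, Nat.cast_zero]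
  ring

end Assembly

end KMUnfold

end

/-! ### The theorem -/

open KMUnfold in
theorem mainTheorem2 {b : ℕ} {L : Type*} [AddCommGroup L] [Module.Free ℤ L] [Module.Finite ℤ L]
    (B : LinearMap.BilinForm ℤ L) (hB : IsEvenUnimodular B)
    (e : Module.Basis (Fin b ⊕ Fin 2) ℝ (ℝ ⊗[ℤ] L)) (he : IsStandardBasis (realForm B) e)
    (u u' : L) (hu : B u u = 0) (hu' : B u' u' = 0) (huu' : B u u' = 1)
    (k : ℤ) (hk : 2 * k = 2 + b) (f : CuspForm 𝒮ℒ k) (α β : Fin b)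
    (g : (ℝ ⊗[ℤ] L) ≃ₗ[ℝ] (ℝ ⊗[ℤ] L)) (hg : IsIsometry (realForm B) g) :
    -- all the series involved converge absolutely
    (∀ τ : UpperHalfPlane, Summable (thetaLTerm B e g (polAB α β) τ)) ∧
    (∀ (τ : UpperHalfPlane) (r h : ℕ), h ≤ 2 →
      Summable (thetaKTerm B e g u u' (polABW B e g u α β h) τ
        ((r : ℝ) • mu (realForm B) e g (toReal u) (toReal u')) 0)) ∧
    (∀ τ : UpperHalfPlane, Summable fun r : ℕ+ => auxTerm B e g u u' α β τ r) ∧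
    -- the auxiliary function is `Γ_∞`-invariant
    (∀ γ ∈ gammaInf, ∀ τ : UpperHalfPlane,
      auxFun B e g u u' α β k f (γ • τ) = auxFun B e g u u' α β k f τ) ∧
    -- the integrand is a theta term plus the series of `h_{α,β}(γτ, g)` over the cosets `Γ_∞ γ`
    ∀ τ : UpperHalfPlane, ∃ H : Cosets → ℂ,
      (∀ γ : SL(2, ℤ), H (Quotient.mk _ γ) = auxFun B e g u u' α β k f (γ • τ)) ∧
      Summable H ∧
      (τ.im : ℂ) ^ (k + 1) * f τ * (starRingEnd ℂ) (thetaL B e g (polAB α β) τ) =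
        prefactor B e g u k f τ *
            (starRingEnd ℂ) (thetaK B e g u u' (polABW B e g u α β 0) τ 0 0) +
          ∑' c : Cosets, H c := by
  have hQu : realForm B (toReal u) (toReal u) = 0 := by rw [realForm_toReal, hu, Int.cast_zero]
  have hu0 : toReal u ≠ 0 := by
    intro h
    have h1 := realForm_toReal (B := B) u u'
    rw [h, huu'] at h1
    simp at h1
  have hs : 0 < uPosSq B e g u := form_uPos_pos he hg hQu hu0
  obtain ⟨m₁, hm₁, ⟨F⟩⟩ := exists_wFrame he hg hQu hs
  -- `hk` makes `b` even and `hm₁` makes it positive, so `w^⊥` has the odd dimension `2 p + 1` that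
  -- `thetaFactor_eq` requires.
  obtain ⟨p, hp⟩ : ∃ p : ℕ, b = 2 * p + 2 := ⟨(k - 2).toNat, by omega⟩
  have hkp : k = p + 2 := by omega
  have hF := F.isFrame he hg hB hu hu' huu' hm₁
  have heven : ∀ x, Even (B.restrict (complementLattice B u u') x x) := fun x => hB.even (x : L)
  have h₁ : Fintype.card (Fin m₁) = 2 * p + 1 := by
    rw [Fintype.card_fin]
    omega
  have h₂ : Fintype.card (Fin 1) = 1 := Fintype.card_fin 1
  set D := F.polyData α β with hD
  set φ := F.latticeMap u' with hφ
  set ν := F.map (mu (realForm B) e g (toReal u) (toReal u')) with hν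
  have hDs : 0 < D.s := hs
  set C : ℂ := ((√2 * √(uPosSq B e g u) : ℝ) : ℂ) with hC
  have hfull : ∀ τ : UpperHalfPlane, ∀ t, thetaLTerm B e g (polAB α β) τ
      (splitEquiv hB hu hu' huu' t) = D.fullTerm φ ν τ t.1.1 t.1.2 t.2 := fun τ t =>
    thetaLTerm_eq F he hg hB hu hu' huu' hs α β τ t
  have hL : ∀ τ : UpperHalfPlane, Summable (thetaLTerm B e g (polAB α β) τ) := fun τ => by
    rw [← (splitEquiv hB hu hu' huu').toEquiv.summable_iff]
    exact (summable_fullTerm D hF hDs ν τ.im_pos).congr fun t => (hfull τ t).symm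
  have hblock := fun τ : UpperHalfPlane => D.tsum_fullTerm_eq hF hDs ν τ.im_pos
  have horb : ∀ τ : UpperHalfPlane,
      Summable fun v : ℤ × ℤ => D.orbitTerm φ ν k f τ v.1 v.2 / C := fun τ =>
    (((Complex.summable_conj.2 (hblock τ).1).mul_left _).div_const C)
  -- The row `(0, r)` times `γ` is `r` times the bottom row of `γ`.
  have hsmul : ∀ (γ : SL(2, ℤ)) (τ : UpperHalfPlane) (r : ℕ+),
      D.orbitTerm φ ν k f (γ • τ) 0 r = D.orbitTerm φ ν k f τ (r * γ 1 0) (r * γ 1 1) := by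
    intro γ τ r
    rw [D.orbitTerm_smul hF heven h₁ h₂ ν hkp f γ τ]
    simp
  have haux : ∀ (γ : SL(2, ℤ)) (τ : UpperHalfPlane), auxFun B e g u u' α β k f (γ • τ) =
      ∑' r : ℕ+, D.orbitTerm φ ν k f τ (r * γ 1 0) (r * γ 1 1) / C := by
    intro γ τ
    rw [auxFun_eq F he hg hu huu' hs]
    exact tsum_congr fun r => by rw [← hsmul]
  refine ⟨hL, ?_, ?_, ?_, ?_⟩
  · intro τ r h hh
    refine (D.summable_theta hF τ.im_pos h ((r : ℝ) • ν) 0).congr fun x => ?_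
    exact (thetaKTerm_eq F he hg hu huu' hs α β τ hh r x).symm
  · intro τ
    have hinj : Function.Injective fun r : ℕ+ => ((0 : ℤ), (r : ℤ)) := by
      intro r r' h
      simpa using h
    refine (Complex.summable_conj.2 ((hblock τ).1.comp_injective hinj)).congr fun r => ?_
    rw [auxTerm_eq F he hg hu huu' hs]
    rfl
  · rintro γ hγ τ
    obtain ⟨n, rfl⟩ := Subgroup.mem_zpowers_iff.1 hγ
    -- By `haux` the value at `γ • τ` depends only on the bottom row of `γ`, which for `T ^ n` is
    -- that of the identity.
    have h := haux 1 τ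
    rw [one_smul] at h
    rw [haux, h]
    simp [ModularGroup.coe_T_zpow]
  · intro τ
    obtain ⟨-, H, hH, hHs, hsum⟩ := exists_tsum_cosets (horb τ)
    refine ⟨H, fun γ => by rw [hH, haux], hHs, ?_⟩
    have hθ : thetaL B e g (polAB α β) τ =
        ((1 / √(2 * τ.im * D.s) : ℝ) : ℂ) * ∑' v : ℤ × ℤ, D.block φ ν τ v.1 v.2 := by
      have := (hblock τ).2
      rw [UpperHalfPlane.coe_im] at this
      rw [← this, thetaL, ← (splitEquiv hB hu hu' huu').toEquiv.tsum_eq]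
      exact tsum_congr (hfull τ)
    rw [prefactor_mul_thetaK F he hg hu huu' hs, ← hν, ← hφ, ← hD, ← hC]
    have h0 : D.orbitTerm φ ν k f τ 0 0 / C =
        D.orbitTerm φ ν k f τ (0 : ℤ × ℤ).1 (0 : ℤ × ℤ).2 / C := rfl
    rw [h0, ← hsum, hθ, map_mul, Complex.conj_ofReal, Complex.conj_tsum, tsum_div_const]
    simp only [PolyData.orbitTerm]
    rw [tsum_mul_left]
    have hy := τ.im_pos
    -- The factor `(2 y u_{z^⊥}²)^{-1/2}` from Poisson summation lowers the exponent of `y` from `k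
    -- + 1` to `k + 1/2` and produces the denominator `√2 |u_{z^⊥}|`.
    have hpow : (τ.im : ℂ) ^ (k + 1) * ((1 / √(2 * τ.im * D.s) : ℝ) : ℂ) =
        ((τ.im ^ ((k : ℝ) + 1 / 2) : ℝ) : ℂ) / C := by
      have h1 : τ.im ^ (k + 1) = τ.im ^ ((k : ℝ) + 1 / 2) * √τ.im := by
        rw [Real.sqrt_eq_rpow, ← Real.rpow_add hy, ← Real.rpow_intCast]
        congr 1
        push_cast
        ring
      have h2 : √(2 * τ.im * D.s) = √2 * √(uPosSq B e g u) * √τ.im := by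
        rw [mul_right_comm, Real.sqrt_mul (by positivity), Real.sqrt_mul (by positivity)]
        rfl
      rw [hC, ← Complex.ofReal_zpow, h1, h2, ← Complex.ofReal_mul, ← Complex.ofReal_div]
      congr 1
      have h3 : √τ.im ≠ 0 := (Real.sqrt_pos.2 hy).ne'
      field_simp
    linear_combination (f τ * ∑' v : ℤ × ℤ, (starRingEnd ℂ) (D.block φ ν τ v.1 v.2)) * hpow
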